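/- Let $m\ge 1$ be an integer, $\underline a=(a_1,\dots,a_m)\in\mathbb C^m$, $P_m(x,\underline a)=x^m+a_1x^{m-1}+\dots+a_m$, and consider $$(\mathfrak E_m)\qquad \Phi''(x)=\frac{P_m(x,\underline a)}{x^2}\,\Phi(x)$$ on the universal covering of $\mathbb C\setminus\{0\}$. Put $\omega=e^{2i\pi/m}$, $\omega^{\alpha}=e^{2i\pi\alpha/m}$ for $\alpha\in\mathbb C$, and $\lambda\cdot(a_1,\dots,a_n)=(\lambda a_1,\dots,\lambda^n a_n)$. Write $\sqrt{P_m(x,\underline a)}/x=x^{\frac m2-1}+\sum_{k\ge1}b_{\frac m2-k}(\underline a)\,x^{\frac m2-k-1}$ for the expansion at infinity. Let $r(\underline a)=\frac12-\frac m4$ if $m$ is odd and $r(\underline a)=\frac12-\frac m4-b_0(\underline a)$ if $m$ is even, and let $S(x,\underline a)=\frac2m x^{\frac m2}+\sum_{1\le k<m/2}\frac{b_{m/2-k}(\underline a)}{m/2-k}x^{\frac m2-k}$. Let $\Phi_0(x,\underline a)$ be the unique solution of $(\mathfrak E_m)$ that has, as $x\to\infty$ in every strict sub-sector of $|\arg x|<\frac{3\pi}m$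 and uniformly for $\underline a$ in compact sets, an asymptotic expansion $x^{r(\underline a)}e^{-S(x,\underline a)}\phi_0(x,\underline a)$, where $\phi_0$ is a formal series in $x^{-1/2}$ ($m$ odd) or in $x^{-1}$ ($m$ even) with coefficients in $\mathbb C[\underline a]$ and constant term $1$. For $k\in\mathbb Z$ put $\Phi_k(x,\underline a)=\Phi_0(\omega^kx,\omega^k\cdot\underline a)$, where $x\mapsto\omega^kx$ adds $2\pi k/m$ to $\arg x$. The Stokes–Sibuya coefficients $C_0(\underline a),\tilde C_0(\underline a)$ are defined by $\Phi_{-1}=C_0(\underline a)\Phi_0+\tilde C_0(\underline a)\Phi_1$. Let $p=(1+4a_m)^{1/2}$ (either determination of the square root), $s(p)=\frac{1+p}2$ and $\underline a'=(a_1,\dots,a_{m-1})$, so that $\underline a=(\underline a',\frac{p^2-1}4)$. For $p\notin-\mathbb N$, where $\mathbb N=\{0,1,2,\dots\}$, let $f_1=x^{s(p)}g_1$ and $f_2=\lambda f_1\ln x+x^{s(-p)}g_2$ be the solutions of $(\mathfrak E_m)$ with $\lambda\in\mathbb C$, $g_1,g_2$ entire in $x$ and $g_1(0)=g_2(0)=1$,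 normalized by $\lambda=0$ if $p\notin\mathbb Z$, and by the vanishing of the coefficient of $x^p$ in $g_2$ if $p\in\{1,2,\dots\}$; they are unique. Let $\tilde L_0(\underline a',p)$ be the coefficient of $f_2$ in $\Phi_{-1}=L_0(\underline a',p)f_1+\tilde L_0(\underline a',p)f_2$. Then: * for $m=1$ and all $\underline a\in\mathbb C$: $\quad C_0(\underline a)=-2\cos(\pi p)$; * for $m=2$, all $\underline a'=a_1\in\mathbb C$ and all $p\notin-\mathbb N$: $$C_0(\underline a)\,\tilde L_0(\omega\cdot\underline a',p)=-2i\,e^{-i\pi\frac{a_1}2}\cos\!\left(\frac\pi2(p+a_1)\right)\tilde L_0(\underline a',p);$$ * for $m\ge3$, all $\underline a'\in\mathbb C^{m-1}$ and all $p\notin-\mathbb N$: $$C_0(\underline a)\,\tilde L_0(\omega\cdot\underline a',p)=\omega^{r(\underline a)-1+\frac m4}\left(\tilde L_0(\underline a',p)\,\omega^{-r(\underline a)+\frac12-\frac m4+\frac p2}+\tilde L_0(\omega^2\cdot\underline a',p)\,\omega^{r(\underline a)-\frac12+\frac m4-\frac p2}\right).$$ -/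

import Mathlib

open Complex
open scoped Real

namespace StokesSibuya

/-! Points of the universal covering of `ℂ∖{0}` are written as `t : ℂ`, with projection
`x = exp t`; thus `ln x = t`, `arg x = t.im`, `|x| = exp t.re` and `x ^ α = exp (α * t)`.
Functions of `x` on the covering are functions of `t`.
The parameter `(a_1, …, a_m)` is `a : Fin m → ℂ` with `a i = a_{i+1}`. -/

/-- The polynomial `P_m(x, a) = x^m + a_1 x^(m-1) + ⋯ + a_m`. -/
noncomputable def P (m : ℕ) (a : Fin m → ℂ) (x : ℂ) : ℂ :=
  x ^ m + ∑ i : Fin m, a i * x ^ (m - 1 - (i : ℕ))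

/-- The derivation `d/dx` on the covering, `x = exp t`. -/
noncomputable def ddx (u : ℂ → ℂ) (t : ℂ) : ℂ := exp (-t) * deriv u t

/-- `u` is a holomorphic solution, on the whole universal covering of `ℂ∖{0}`, of
`d²Φ/dx² = (P_m(x, a) / x²) Φ`. -/
def IsSolution (m : ℕ) (a : Fin m → ℂ) (u : ℂ → ℂ) : Prop :=
  Differentiable ℂ u ∧ ∀ t : ℂ, ddx (ddx u) t = P m a (exp t) / exp t ^ 2 * u t

/-- `λ · (a_1, …, a_n) = (λ a_1, …, λ^n a_n)`. -/
def scale {n : ℕ} (l : ℂ) (a : Fin n → ℂ) : Fin n → ℂ :=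
  fun i => l ^ ((i : ℕ) + 1) * a i

/-- The number `ω = exp (2iπ/m)`. -/
noncomputable def omega (m : ℕ) : ℂ := exp (2 * π * I / m)

/-- The power `ω ^ α = exp (2iπα/m)` with a complex exponent. -/
noncomputable def omegaPow (m : ℕ) (α : ℂ) : ℂ := exp (2 * π * I * α / m)

/-! ### The asymptotic data at infinity -/

/-- The coefficients of `x^(-m) P_m(x, a) = 1 + a_1 x⁻¹ + ⋯ + a_m x^(-m)` in powers of `x⁻¹`. -/
def revCoeff (m : ℕ) (a : Fin m → ℂ) : ℕ → ℂ
  | 0 => 1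
  | k + 1 => if h : k < m then a ⟨k, h⟩ else 0

/-- The coefficients of the square root, with constant term `1`, of the formal power series
with coefficients `c`, where `c 0 = 1` (see `sqrtCoeff_spec`). -/
noncomputable def sqrtCoeff (c : ℕ → ℂ) : ℕ → ℂ
  | 0 => 1
  | k + 1 => (c (k + 1) - ∑ i : Fin k, sqrtCoeff c ((i : ℕ) + 1) * sqrtCoeff c (k - (i : ℕ))) / 2

theorem sqrtCoeff_spec (c : ℕ → ℂ) (hc : c 0 = 1) :
    PowerSeries.mk (sqrtCoeff c) ^ 2 = PowerSeries.mk c := by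
  have h0 : sqrtCoeff c 0 = 1 := by rw [sqrtCoeff]
  ext n
  rw [sq, PowerSeries.coeff_mul]
  simp only [PowerSeries.coeff_mk]
  rw [Finset.Nat.sum_antidiagonal_eq_sum_range_succ
    (f := fun i j => sqrtCoeff c i * sqrtCoeff c j)]
  cases n with
  | zero => simp [h0, hc]
  | succ k =>
    rw [Finset.sum_range_succ, Finset.sum_range_succ']
    have h1 := sqrtCoeff.eq_2 c k
    rw [Fin.sum_univ_eq_sum_range
      (f := fun i => sqrtCoeff c (i + 1) * sqrtCoeff c (k - i))] at h1
    simp only [Nat.add_sub_add_right, Nat.sub_zero, Nat.sub_self, h0]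
    rw [h1]
    ring

/-- `b m a k` is the coefficient `b_{m/2-k}(a)` of `x^(m/2-k-1)` in the expansion at infinity
`√P_m(x, a) / x = x^(m/2-1) + ∑_{k ≥ 1} b_{m/2-k}(a) x^(m/2-k-1)`. -/
noncomputable def b (m : ℕ) (a : Fin m → ℂ) (k : ℕ) : ℂ := sqrtCoeff (revCoeff m a) k

/-- The exponent `r(a)`: `1/2 - m/4` for odd `m`, and `1/2 - m/4 - b_0(a)` for even `m`. -/
noncomputable def r (m : ℕ) (a : Fin m → ℂ) : ℂ :=
  if Even m then 1 / 2 - (m : ℂ) / 4 - b m a (m / 2) else 1 / 2 - (m : ℂ) / 4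

/-- `S(x, a) = (2/m) x^(m/2) + ∑ b_{m/2-k}(a) / (m/2-k) x^(m/2-k)`, the sum being over the
integers `k` with `1 ≤ k < m/2`. -/
noncomputable def S (m : ℕ) (a : Fin m → ℂ) (t : ℂ) : ℂ :=
  2 / (m : ℂ) * exp ((m : ℂ) / 2 * t) +
    ∑ k ∈ Finset.Icc 1 ((m - 1) / 2),
      b m a k / ((m : ℂ) / 2 - k) * exp (((m : ℂ) / 2 - k) * t)

/-- The factor `x^r(a) exp (-S(x, a))`. -/
noncomputable def leading (m : ℕ) (a : Fin m → ℂ) (t : ℂ) : ℂ :=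
  exp (r m a * t) * exp (-S m a t)

/-- The formal series `φ_0` proceeds in powers of `x^(-1/2)` for odd `m`, and of `x^(-1)` for
even `m`. -/
noncomputable def stepExp (m : ℕ) : ℝ := if Even m then 1 else 1 / 2

/-- The defining property of the solution `Φ_0(x, a)`: for every `a` it solves the equation, and
there is a formal series `φ_0 = ∑ c_n(a) x^(-n·stepExp)`, whose coefficients are polynomials in `a`
and whose constant term is `1`, such that `x^r(a) exp (-S(x, a)) φ_0(x, a)` is the asymptotic
expansion of `Φ_0` as `x → ∞` in every strict sub-sector of `|arg x| < 3π/m`, uniformly for `a` in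
every compact set. -/
def IsPhi0 (m : ℕ) (F : (Fin m → ℂ) → ℂ → ℂ) : Prop :=
  (∀ a, IsSolution m a (F a)) ∧
  ∃ c : ℕ → MvPolynomial (Fin m) ℂ, c 0 = 1 ∧
    ∀ K : Set (Fin m → ℂ), IsCompact K → ∀ θ : ℝ, θ < 3 * π / m → ∀ N : ℕ,
      ∃ A R : ℝ, ∀ a ∈ K, ∀ t : ℂ, |t.im| ≤ θ → R ≤ t.re →
        ‖F a t - leading m a t *
            ∑ n ∈ Finset.range N, MvPolynomial.eval a (c n) * exp (-(n * stepExp m : ℝ) * t)‖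
          ≤ A * ‖leading m a t‖ * Real.exp (-(N * stepExp m) * t.re)

open Classical in
/-- The solution `Φ_0(x, a)` with the above asymptotic expansion at infinity. -/
noncomputable def Phi0 (m : ℕ) : (Fin m → ℂ) → ℂ → ℂ :=
  if h : ∃ F, IsPhi0 m F then h.choose else 0

/-- `Φ_k(x, a) = Φ_0(ω^k x, ω^k · a)` for `k ∈ ℤ`; multiplication by `ω^k` on the covering adds
`2iπk/m` to `t`. -/
noncomputable def Phi (m : ℕ) (k : ℤ) (a : Fin m → ℂ) (t : ℂ) : ℂ :=
  Phi0 m (scale (omega m ^ k) a) (t + 2 * π * I * k / m)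

open Classical in
/-- The pair `(C_k(a), C̃_k(a))` of Stokes–Sibuya coefficients, given by
`Φ_{k-1} = C_k(a) Φ_k + C̃_k(a) Φ_{k+1}`. -/
noncomputable def stokesSibuya (m : ℕ) (k : ℤ) (a : Fin m → ℂ) : ℂ × ℂ :=
  if h : ∃ c : ℂ × ℂ, ∀ t, Phi m (k - 1) a t = c.1 * Phi m k a t + c.2 * Phi m (k + 1) a t
  then h.choose else 0

/-- The Stokes–Sibuya coefficient `C_k(a)`. -/
noncomputable def C (m : ℕ) (k : ℤ) (a : Fin m → ℂ) : ℂ := (stokesSibuya m k a).1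

/-! ### The solutions at the origin and the connection matrices -/

/-- The characteristic exponent `s(p) = (1 + p)/2`. -/
noncomputable def s (p : ℂ) : ℂ := (1 + p) / 2

/-- The parameter `a = (a', a_m)` with `a' = (a_1, …, a_{m-1})` and `a_m = (p² - 1)/4`, that is
`p = (1 + 4 a_m)^(1/2)` for one of the two determinations of the square root. -/
noncomputable def ofPrime (m : ℕ) (a' : Fin (m - 1) → ℂ) (p : ℂ) : Fin m → ℂ :=
  fun i => if h : (i : ℕ) < m - 1 then a' ⟨i, h⟩ else (p ^ 2 - 1) / 4

/-- The defining property of the canonical pair `(f_1, f_2)` of solutions at the origin, for `p`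
not a negative integer: `f_1 = x^s(p) g_1`, `f_2 = μ f_1 ln x + x^s(-p) g_2` with `g_1`, `g_2`
entire in `x`, `g_1(0) = 1`, and
* if `p ∉ ℤ`, then `μ = 0` and `g_2(0) = 1` (so that `f_2` is `f_1` with `-p` in place of `p`);
* if `p` is a positive integer, then `g_2(0) = 1` and the coefficient of `x^p` in `g_2` is `0`;
* if `p = 0`, then `μ = 1` and `g_2(0) = 0`. -/
def IsFrobeniusPair (m : ℕ) (a' : Fin (m - 1) → ℂ) (p : ℂ) (f : (ℂ → ℂ) × (ℂ → ℂ)) : Prop :=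
  IsSolution m (ofPrime m a' p) f.1 ∧ IsSolution m (ofPrime m a' p) f.2 ∧
  ∃ (μ : ℂ) (g₁ g₂ : ℂ → ℂ), Differentiable ℂ g₁ ∧ Differentiable ℂ g₂ ∧ g₁ 0 = 1 ∧
    (∀ t, f.1 t = exp (s p * t) * g₁ (exp t)) ∧
    (∀ t, f.2 t = μ * f.1 t * t + exp (s (-p) * t) * g₂ (exp t)) ∧
    ((∀ n : ℤ, p ≠ n) → μ = 0 ∧ g₂ 0 = 1) ∧
    (∀ n : ℕ, 0 < n → p = n → g₂ 0 = 1 ∧ iteratedDeriv n g₂ 0 = 0) ∧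
    (p = 0 → μ = 1 ∧ g₂ 0 = 0)

open Classical in
/-- The canonical pair `(f_1, f_2)` of solutions at the origin. -/
noncomputable def frobenius (m : ℕ) (a' : Fin (m - 1) → ℂ) (p : ℂ) : (ℂ → ℂ) × (ℂ → ℂ) :=
  if h : ∃ f, IsFrobeniusPair m a' p f then h.choose else 0

open Classical in
/-- The `0∞` connection matrix `M_k(a', p)`, given by
`(Φ_{k-1}, Φ_k)ᵀ = M_k(a', p) (f_1, f_2)ᵀ`. -/
noncomputable def connection (m : ℕ) (k : ℤ) (a' : Fin (m - 1) → ℂ) (p : ℂ) :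
    Matrix (Fin 2) (Fin 2) ℂ :=
  if h : ∃ M : Matrix (Fin 2) (Fin 2) ℂ, ∀ t,
      ![Phi m (k - 1) (ofPrime m a' p) t, Phi m k (ofPrime m a' p) t] =
        M.mulVec ![(frobenius m a' p).1 t, (frobenius m a' p).2 t]
  then h.choose else 0

/-- The entry `L̃_k(a', p)` of the first row and second column of `M_k(a', p)`: the coefficient
of `Φ_{k-1}` on `f_2`. -/
noncomputable def Ltilde (m : ℕ) (k : ℤ) (a' : Fin (m - 1) → ℂ) (p : ℂ) : ℂ :=
  connection m k a' p 0 1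

end StokesSibuya

namespace StokesSibuya

/-! ### Solutions and Wronskians -/

/-! In the coordinate t = ln x the equation reads u'' - u' = P u, and the Wronskian `wr` of two
solutions is constant. Every coefficient in the statement is governed by such Wronskians. Pairing
Φ_{-1} = C_0 Φ_0 + C̃_0 Φ_1 with the solution f_1 at the origin gives a linear relation between
W(f_1, Φ_{-1}), W(f_1, Φ_0) and W(f_1, Φ_1). The equation is invariant under (x, a) ↦ (ωx, ω·a),
which multiplies f_1 by ω^{s(p)} and shifts the index of Φ_k. Hence the three Wronskians are, up to
explicit powers of ω and the common factor W(f_1, f_2), the values of L̃_0 at a', ω·a' and ω²·a'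
(`wr_frobenius_Phi`). Pairing with Φ_0 instead expresses C̃_0 through W(Φ_0, Φ_1), which is read off
from the asymptotics on the positive axis (`wr_Phi_zero_one`). The outcome is `C_mul_Ltilde`. For m
= 1 the rotation is trivial and L̃_0 ≠ 0 cancels; for m = 2 one has ω² = 1 and the two terms merge
into a cosine.

Most of the work lies in showing that the objects exist, since they are introduced by choice. At the
origin, a Frobenius recursion with a logarithmic term at resonance gives (f_1, f_2)
(`exists_isFrobeniusPair`). Being a basis of solutions on the whole covering, this pair also takes
the place of the general existence and uniqueness theorem (`exists_basis`).

At infinity, a truncation Λ of the formal WKB solution satisfies the equation up to a small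
residual. In the variable z = x^{m/2} e^{-iψ} the ratio of an exact solution to Λ obeys a Volterra
equation along horizontal rays. It is solved by iteration on a cone that contains every sector |arg
z| ≤ π - η far out (`exists_volterra`, `exists_solution_cone`). Decay along the rays requires |ψ| <
π/2, so arg x = (2/m)(arg z + ψ) reaches every value below 3π/m in modulus. Solutions obtained for
different ψ, orders and compact sets agree because all are recessive on the positive axis
(`HasLeading.unique`), and together they give Φ_0 (`exists_isPhi0`). -/

theorem ddx_ddx {u : ℂ → ℂ} (hu : Differentiable ℂ u) (t : ℂ) :
    ddx (ddx u) t = (deriv (deriv u) t - deriv u t) / exp t ^ 2 := by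
  have h2 : Differentiable ℂ (deriv u) := hu.deriv
  have h1 : HasDerivAt (ddx u)
      (-exp (-t) * deriv u t + exp (-t) * deriv (deriv u) t) t := by
    have := ((hasDerivAt_id t).neg.cexp).mul (h2 t).hasDerivAt
    refine this.congr_deriv ?_
    simp
  rw [ddx, h1.deriv, exp_neg]
  have := exp_ne_zero t
  field_simp
  ring

theorem isSolution_iff {m : ℕ} {a : Fin m → ℂ} {u : ℂ → ℂ} :
    IsSolution m a u ↔ Differentiable ℂ u ∧
      ∀ t, deriv (deriv u) t = deriv u t + P m a (exp t) * u t := by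
  unfold IsSolution
  refine and_congr_right fun hu => forall_congr' fun t => ?_
  rw [ddx_ddx hu, div_mul_eq_mul_div, div_left_inj' (pow_ne_zero 2 (exp_ne_zero t))]
  constructor <;> intro h <;> linear_combination h

theorem IsSolution.deriv_deriv {m : ℕ} {a : Fin m → ℂ} {u : ℂ → ℂ} (hu : IsSolution m a u)
    (t : ℂ) : deriv (deriv u) t = deriv u t + P m a (exp t) * u t :=
  (isSolution_iff.1 hu).2 t

theorem IsSolution.linear {m : ℕ} {a : Fin m → ℂ} {u v : ℂ → ℂ} (hu : IsSolution m a u)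
    (hv : IsSolution m a v) (α β : ℂ) : IsSolution m a fun t => α * u t + β * v t := by
  have h1 : deriv (fun t => α * u t + β * v t) = fun t => α * deriv u t + β * deriv v t :=
    funext fun t => (((hu.1 t).hasDerivAt.const_mul α).add
      ((hv.1 t).hasDerivAt.const_mul β)).deriv
  have h2 : deriv (fun t => α * deriv u t + β * deriv v t) =
      fun t => α * deriv (deriv u) t + β * deriv (deriv v) t :=
    funext fun t => (((hu.1.deriv t).hasDerivAt.const_mul α).add
      ((hv.1.deriv t).hasDerivAt.const_mul β)).deriv
  refine isSolution_iff.2 ⟨(hu.1.const_mul α).add (hv.1.const_mul β), fun t => ?_⟩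
  simp only [h1, h2, hu.deriv_deriv, hv.deriv_deriv]
  ring

/-- The Wronskian `u dv/dx - (du/dx) v` in the coordinate `t`. -/
noncomputable def wr (u v : ℂ → ℂ) (t : ℂ) : ℂ :=
  exp (-t) * (u t * deriv v t - deriv u t * v t)

theorem wr_self (u : ℂ → ℂ) (t : ℂ) : wr u u t = 0 := by
  unfold wr; ring

theorem wr_swap (u v : ℂ → ℂ) (t : ℂ) : wr v u t = -wr u v t := by
  unfold wr; ring

theorem wr_linear {u v w : ℂ → ℂ} (hv : Differentiable ℂ v) (hw : Differentiable ℂ w)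
    (α β : ℂ) (t : ℂ) :
    wr u (fun t => α * v t + β * w t) t = α * wr u v t + β * wr u w t := by
  have h1 : deriv (fun t => α * v t + β * w t) t = α * deriv v t + β * deriv w t :=
    (((hv t).hasDerivAt.const_mul α).add ((hw t).hasDerivAt.const_mul β)).deriv
  unfold wr; rw [h1]; ring

/-- Expansion of the vanishing determinant with rows (u, v, w), (u, v, w), (u', v', w'). -/
theorem wr_cramer (u v w : ℂ → ℂ) (t : ℂ) :
    u t * wr v w t + v t * wr w u t + w t * wr u v t = 0 := by
  unfold wr; ring

theorem hasDerivAt_wr {u v : ℂ → ℂ} (hu : Differentiable ℂ u) (hv : Differentiable ℂ v) (t : ℂ) :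
    HasDerivAt (wr u v)
      (exp (-t) * (u t * (deriv (deriv v) t - deriv v t) -
        (deriv (deriv u) t - deriv u t) * v t)) t := by
  have h := ((hasDerivAt_id t).neg.cexp).mul
    (((hu t).hasDerivAt.mul (hv.deriv t).hasDerivAt).sub
      ((hu.deriv t).hasDerivAt.mul (hv t).hasDerivAt))
  refine h.congr_deriv ?_
  simp only [Pi.mul_apply, Pi.sub_apply, Pi.neg_apply, id]
  ring

theorem wr_const {m : ℕ} {a : Fin m → ℂ} {u v : ℂ → ℂ} (hu : IsSolution m a u)
    (hv : IsSolution m a v) (t t' : ℂ) : wr u v t = wr u v t' := by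
  refine is_const_of_deriv_eq_zero (fun t => (hasDerivAt_wr hu.1 hv.1 t).differentiableAt)
    (fun t => ?_) t t'
  rw [(hasDerivAt_wr hu.1 hv.1 t).deriv, hu.deriv_deriv, hv.deriv_deriv]
  ring

theorem IsSolution.eq_combination {m : ℕ} {a : Fin m → ℂ} {u v w : ℂ → ℂ}
    (hu : IsSolution m a u) (hv : IsSolution m a v) (hw : IsSolution m a w)
    (h : wr v w 0 ≠ 0) (t : ℂ) :
    u t = wr u w 0 / wr v w 0 * v t + wr v u 0 / wr v w 0 * w t := by
  have := wr_cramer u v w t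
  rw [wr_const hv hw t 0, wr_const hw hu t 0, wr_const hu hv t 0, wr_swap u w, wr_swap v u] at this
  field_simp
  linear_combination this

/-- Solutions with vanishing Wronskian are proportional. -/
theorem IsSolution.eq_mul_of_wr_eq_zero {m : ℕ} {a : Fin m → ℂ} {u v f g : ℂ → ℂ}
    (hu : IsSolution m a u) (hv : IsSolution m a v) (hf : IsSolution m a f)
    (hg : IsSolution m a g) (hfg : wr f g 0 ≠ 0) (h : wr u v 0 = 0) {t₀ : ℂ} (ht₀ : v t₀ ≠ 0)
    (t : ℂ) : u t = u t₀ / v t₀ * v t := by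
  have hd : IsSolution m a fun t => 1 * u t + (-(u t₀ / v t₀)) * v t := hu.linear hv _ _
  set d : ℂ → ℂ := fun t => 1 * u t + (-(u t₀ / v t₀)) * v t with hd_def
  have h0 : d t₀ = 0 := by simp only [hd_def]; field_simp; ring
  have h1 : deriv d t₀ = 0 := by
    have h2 : wr v d 0 = 0 := by
      rw [hd_def, wr_linear hu.1 hv.1, wr_self, wr_swap u v, h]; ring
    rw [wr_const hv hd 0 t₀, wr, h0, mul_zero, sub_zero] at h2
    rcases mul_eq_zero.1 h2 with h2 | h2
    · exact absurd h2 (exp_ne_zero _)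
    · exact (mul_eq_zero.1 h2).resolve_left ht₀
  -- Uniqueness for the Cauchy problem comes from the given basis: zero data at t₀ annihilate the
  -- Wronskians of d with f and g, which are the coefficients of d in that basis.
  have h3 : d t = 0 := by
    have h4 : wr d g t₀ = 0 := by simp [wr, h0, h1]
    have h5 : wr f d t₀ = 0 := by simp [wr, h0, h1]
    rw [hd.eq_combination hf hg hfg t, wr_const hd hg 0 t₀, wr_const hf hd 0 t₀, h4, h5]
    simp
  simp only [hd_def] at h3
  linear_combination h3

/-! ### The symmetry `x ↦ ω x` -/

/-- P is isobaric of weight m when x has weight 1 and a_i has weight i. -/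
theorem P_scale {m : ℕ} {l : ℂ} (hl : l ^ m = 1) (a : Fin m → ℂ) (x : ℂ) :
    P m (scale l a) (l * x) = P m a x := by
  unfold P scale
  rw [mul_pow, hl, one_mul]
  congr 1
  refine Finset.sum_congr rfl fun i _ => ?_
  have h : l ^ ((i : ℕ) + 1) * l ^ (m - 1 - (i : ℕ)) = 1 := by
    rw [← pow_add, ← hl]
    congr 1
    omega
  rw [mul_pow]
  linear_combination a i * x ^ (m - 1 - (i : ℕ)) * h

theorem scale_scale {n : ℕ} (l l' : ℂ) (a : Fin n → ℂ) :
    scale l (scale l' a) = scale (l * l') a := by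
  funext i
  simp only [scale, mul_pow]
  ring

theorem scale_one {n : ℕ} (a : Fin n → ℂ) : scale 1 a = a := by
  funext i
  simp [scale]

theorem omega_ne_zero (m : ℕ) : omega m ≠ 0 := exp_ne_zero _

theorem omega_pow_self {m : ℕ} (hm : 1 ≤ m) : omega m ^ m = 1 := by
  have : (m : ℂ) ≠ 0 := Nat.cast_ne_zero.2 (by omega)
  rw [omega, ← exp_nat_mul, mul_div_cancel₀ _ this, exp_two_pi_mul_I]

theorem omega_zpow_pow {m : ℕ} (hm : 1 ≤ m) (k : ℤ) : (omega m ^ k) ^ m = 1 := by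
  rw [← zpow_natCast, ← zpow_mul, mul_comm, zpow_mul, zpow_natCast, omega_pow_self hm, one_zpow]

theorem omega_zpow (m : ℕ) (k : ℤ) : omega m ^ k = exp (2 * π * I * k / m) := by
  rw [omega, ← exp_int_mul]
  congr 1
  ring

theorem ofPrime_scale {m : ℕ} (hm : 1 ≤ m) {l : ℂ} (hl : l ^ m = 1) (a' : Fin (m - 1) → ℂ)
    (p : ℂ) : scale l (ofPrime m a' p) = ofPrime m (scale l a') p := by
  funext i
  simp only [scale, ofPrime]
  split_ifs with h
  · rfl
  · have : (i : ℕ) + 1 = m := by omega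
    rw [this, hl, one_mul]

theorem deriv_comp_add (u : ℂ → ℂ) (c : ℂ) :
    deriv (fun t => u (t + c)) = fun t => deriv u (t + c) :=
  funext fun t => deriv_comp_add_const (f := u) c t

theorem IsSolution.shift {m : ℕ} {a : Fin m → ℂ} {l c : ℂ} {u : ℂ → ℂ} (hl : l ^ m = 1)
    (hc : exp c = l) (hu : IsSolution m (scale l a) u) :
    IsSolution m a fun t => u (t + c) := by
  refine isSolution_iff.2 ⟨hu.1.comp (differentiable_id.add_const c), fun t => ?_⟩
  rw [deriv_comp_add, deriv_comp_add]
  simp only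
  rw [hu.deriv_deriv, exp_add, hc, mul_comm (exp t), P_scale hl]

theorem wr_shift (u v : ℂ → ℂ) (c t : ℂ) :
    wr (fun t => u (t + c)) (fun t => v (t + c)) t = exp c * wr u v (t + c) := by
  unfold wr
  rw [deriv_comp_add, deriv_comp_add, ← mul_assoc, ← exp_add]
  congr 2
  ring

/-! ### Integration along horizontal rays in a cone -/

open Set Filter Topology MeasureTheory

/-- The domain `R < κ re z + |im z|`, a sector with shifted vertex. -/
def cone (κ R : ℝ) : Set ℂ := {z | R < κ * z.re + |z.im|}

theorem isOpen_cone (κ R : ℝ) : IsOpen (cone κ R) :=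
  isOpen_lt continuous_const (by fun_prop)

theorem cone_anti {κ R R' : ℝ} (h : R ≤ R') : cone κ R' ⊆ cone κ R :=
  fun _ hz => lt_of_le_of_lt h hz

theorem cone_add {κ R : ℝ} (hκ : 0 ≤ κ) {z : ℂ} (hz : z ∈ cone κ R) {s : ℝ} (hs : 0 ≤ s) :
    z + s ∈ cone κ R := by
  have : 0 ≤ κ * s := mul_nonneg hκ hs
  simp only [cone, mem_ofPred_eq, add_re, ofReal_re, add_im, ofReal_im, add_zero] at hz ⊢
  linarith

theorem cone_slit {κ R : ℝ} (hκ : 0 < κ) (hR : 0 ≤ R) {z : ℂ} (hz : z ∈ cone κ R) :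
    z ∈ slitPlane := by
  simp only [cone, mem_ofPred_eq] at hz
  by_cases h : z.im = 0
  · rw [h, abs_zero, add_zero] at hz
    exact Or.inl (pos_of_mul_pos_right (hR.trans_lt hz) hκ.le)
  · exact Or.inr h

theorem cone_norm {κ R : ℝ} (hκ : 0 ≤ κ) (hκ1 : κ ≤ 1) {z : ℂ} (hz : z ∈ cone κ R) :
    R < 2 * ‖z‖ := by
  have h1 := (le_abs_self _).trans (abs_re_le_norm z)
  have h2 := abs_im_le_norm z
  have h3 : κ * z.re ≤ ‖z‖ := by
    nlinarith [mul_le_mul_of_nonneg_left h1 hκ, norm_nonneg z]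
  simp only [cone, mem_ofPred_eq] at hz
  linarith

/-- A ray pointing to the right cannot come much closer to 0 than its starting point. If Re z < 0,
the cone forces |Re z| ≤ |Im z| / κ, and the shift does not change Im z. -/
theorem cone_shift {κ R : ℝ} (hκ : 0 < κ) (hR : 0 ≤ R) {z : ℂ} (hz : z ∈ cone κ R)
    {s : ℝ} (hs : 0 ≤ s) : ‖z‖ + s ≤ (3 + 2 / κ) * ‖z + s‖ := by
  have key : ‖z‖ ≤ (1 + 1 / κ) * ‖z + s‖ := by
    rcases le_or_gt 0 z.re with h | h
    · have h1 : ‖z‖ ≤ ‖z + s‖ := by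
        rw [norm_eq_sqrt_sq_add_sq, norm_eq_sqrt_sq_add_sq]
        apply Real.sqrt_le_sqrt
        simp only [add_re, ofReal_re, add_im, ofReal_im, add_zero]
        nlinarith
      have : 0 ≤ 1 / κ * ‖z + s‖ := by positivity
      linarith
    · have h1 : |z.im| ≤ ‖z + s‖ := by
        have := abs_im_le_norm (z + s)
        simpa using this
      have h2 : ‖z‖ ≤ |z.re| + |z.im| := norm_le_abs_re_add_abs_im z
      have h3 : |z.re| ≤ 1 / κ * |z.im| := by
        rw [abs_of_neg h, one_div, ← div_eq_inv_mul, le_div_iff₀ hκ]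
        simp only [cone, mem_ofPred_eq] at hz
        linarith
      have h4 : 1 / κ * |z.im| ≤ 1 / κ * ‖z + s‖ := by gcongr
      linarith
  have h5 : s ≤ ‖z + s‖ + ‖z‖ := by
    have := norm_sub_le (z + s) z
    rwa [add_sub_cancel_left, norm_real, Real.norm_of_nonneg hs] at this
  have : (3 + 2 / κ) * ‖z + s‖ = 2 * ((1 + 1 / κ) * ‖z + s‖) + ‖z + s‖ := by ring
  linarith

theorem isPreconnected_cone {κ : ℝ} (hκ : 0 < κ) (R : ℝ) : IsPreconnected (cone κ R) := by
  have h1 : cone κ R = {z : ℂ | R < κ * z.re + z.im} ∪ {z : ℂ | R < κ * z.re - z.im} := by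
    ext z
    simp only [cone, mem_ofPred_eq, mem_union, sub_eq_add_neg]
    rcases abs_cases z.im with ⟨h, h'⟩ | ⟨h, h'⟩
    · rw [h]; exact ⟨Or.inl, fun h => h.elim id fun h => by linarith⟩
    · rw [h]; exact ⟨Or.inr, fun h => h.elim (fun h => by linarith) id⟩
  rw [h1]
  have hc : ∀ c : ℝ, Convex ℝ {z : ℂ | R < κ * z.re + c * z.im} := fun c =>
    convex_halfSpace_gt (f := fun z : ℂ => κ * z.re + c * z.im)
      ⟨fun x y => by simp only [add_re, add_im]; ring,
        fun r x => by simp only [real_smul, re_ofReal_mul, im_ofReal_mul, smul_eq_mul]; ring⟩ R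
  have h2 : Convex ℝ {z : ℂ | R < κ * z.re + z.im} := by simpa using hc 1
  have h3 : Convex ℝ {z : ℂ | R < κ * z.re - z.im} := by
    simpa [sub_eq_add_neg] using hc (-1)
  refine IsPreconnected.union (((R + 1) / κ : ℝ) : ℂ) ?_ ?_ h2.isPreconnected h3.isPreconnected <;>
  · simp only [mem_ofPred_eq, ofReal_re, ofReal_im]
    rw [mul_div_cancel₀ _ hκ.ne']
    linarith

theorem hasDerivAt_neg_inv_one_add {s : ℝ} (hs : 0 ≤ s) :
    HasDerivAt (fun s : ℝ => -(1 + s)⁻¹) (((1 + s) ^ 2)⁻¹) s := by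
  have h := ((hasDerivAt_id s).const_add 1).inv (by simp only [id]; positivity)
  refine h.neg.congr_deriv ?_
  simp [neg_div]

theorem tendsto_neg_inv_one_add : Tendsto (fun s : ℝ => -(1 + s)⁻¹) atTop (𝓝 0) := by
  have := (tendsto_inv_atTop_zero.comp (tendsto_atTop_add_const_left atTop (1 : ℝ) tendsto_id)).neg
  simpa [Function.comp_def] using this

theorem integrableOn_inv_one_add_sq : IntegrableOn (fun s : ℝ => ((1 + s) ^ 2)⁻¹) (Ioi 0) :=
  integrableOn_Ioi_deriv_of_nonneg' (fun _ hs => hasDerivAt_neg_inv_one_add hs)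
    (fun _ _ => by positivity) tendsto_neg_inv_one_add

theorem integral_inv_one_add_sq : ∫ s in Ioi (0 : ℝ), ((1 + s) ^ 2)⁻¹ = 1 := by
  rw [integral_Ioi_of_hasDerivAt_of_nonneg' (fun _ hs => hasDerivAt_neg_inv_one_add hs)
    (fun _ _ => by positivity) tendsto_neg_inv_one_add]
  simp

/-- The integral of `f` over the horizontal ray starting at `z`. -/
noncomputable def rayIntegral (f : ℂ → ℂ) (z : ℂ) : ℂ := ∫ s in Ioi (0 : ℝ), f (z + s)

theorem norm_rayIntegral_le {f : ℂ → ℂ} {z : ℂ} {B : ℝ}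
    (h : ∀ s : ℝ, 0 ≤ s → ‖f (z + s)‖ ≤ B * ((1 + s) ^ 2)⁻¹) : ‖rayIntegral f z‖ ≤ B := by
  refine (norm_integral_le_of_norm_le (integrableOn_inv_one_add_sq.const_mul B)
    ((ae_restrict_iff' measurableSet_Ioi).2 (Eventually.of_forall fun s hs => h s (le_of_lt hs)))).trans
    ?_
  rw [integral_const_mul, integral_inv_one_add_sq, mul_one]

/-- Differentiation under the integral sign, the derivative being dominated through Cauchy's
estimate; then the integral of f'(z + s) over s telescopes to -f(z). -/
theorem hasDerivAt_rayIntegral {U : Set ℂ} (hU : IsOpen U)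
    (hshift : ∀ z ∈ U, ∀ s : ℝ, 0 ≤ s → z + s ∈ U) {f : ℂ → ℂ} (hf : DifferentiableOn ℂ f U)
    {z : ℂ} (hz : z ∈ U) {B : ℝ}
    (hB : ∀ᶠ w in 𝓝 z, ∀ s : ℝ, 0 ≤ s → ‖f (w + s)‖ ≤ B * ((1 + s) ^ 2)⁻¹) :
    HasDerivAt (rayIntegral f) (-f z) z := by
  obtain ⟨ε, hε, hεB⟩ := Metric.eventually_nhds_iff_ball.1 (hB.and (hU.mem_nhds hz))
  have hε4 : 0 < ε / 4 := by positivity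
  have hdiff : ∀ w ∈ Metric.ball z ε, ∀ s : ℝ, 0 ≤ s → HasDerivAt f (deriv f (w + s)) (w + s) :=
    fun w hw s hs =>
      (hf.differentiableAt (hU.mem_nhds (hshift w (hεB w hw).2 s hs))).hasDerivAt
  have hcont : ∀ w ∈ Metric.ball z ε, ContinuousOn (fun s : ℝ => f (w + s)) (Ici 0) :=
    fun w hw s hs => ((hdiff w hw s hs).continuousAt.comp
      (f := fun s : ℝ => w + s) (by fun_prop)).continuousWithinAt
  have hmeas : ∀ w ∈ Metric.ball z ε,
      AEStronglyMeasurable (fun s : ℝ => f (w + s)) (volume.restrict (Ioi 0)) :=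
    fun w hw => ((hcont w hw).mono Ioi_subset_Ici_self).aestronglyMeasurable measurableSet_Ioi
  have hz0 : z ∈ Metric.ball z ε := Metric.mem_ball_self hε
  have hdcont : ContinuousOn (fun s : ℝ => deriv f (z + s)) (Ici 0) := fun s hs =>
    ((((hf.deriv hU).differentiableAt (hU.mem_nhds (hshift z hz s hs))).continuousAt.comp
      (f := fun s : ℝ => z + s) (by fun_prop))).continuousWithinAt
  have key := hasDerivAt_integral_of_dominated_loc_of_deriv_le (μ := volume.restrict (Ioi (0 : ℝ)))
    (F := fun w (s : ℝ) => f (w + s)) (F' := fun w (s : ℝ) => deriv f (w + s))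
    (x₀ := z) (s := Metric.ball z (ε / 4))
    (bound := fun s => B * ((1 + s) ^ 2)⁻¹ / (ε / 4))
    (Metric.ball_mem_nhds z hε4)
    (Filter.mem_of_superset (Metric.ball_mem_nhds z hε) hmeas)
    (Integrable.mono' (integrableOn_inv_one_add_sq.const_mul B) (hmeas z hz0)
      ((ae_restrict_iff' measurableSet_Ioi).2
        (Eventually.of_forall fun s hs => (hεB z hz0).1 s (le_of_lt hs))))
    ((hdcont.mono Ioi_subset_Ici_self).aestronglyMeasurable measurableSet_Ioi)
    ((ae_restrict_iff' measurableSet_Ioi).2 (Eventually.of_forall fun s hs w hw => ?_))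
    ((integrableOn_inv_one_add_sq.const_mul B).div_const _)
    ((ae_restrict_iff' measurableSet_Ioi).2 (Eventually.of_forall fun s hs w hw => ?_))
  · refine key.2.congr_deriv ?_
    have hd : ∀ s ∈ Ici (0 : ℝ), HasDerivAt (fun s : ℝ => f (z + s)) (deriv f (z + s)) s := by
      intro s hs
      have h1 : HasDerivAt (fun s : ℂ => f (z + s)) (deriv f (z + s)) (s : ℂ) := by
        have := (hdiff z hz0 s hs).comp_const_add z (s : ℂ)
        exact this
      exact h1.comp_ofReal
    have ht : Tendsto (fun s : ℝ => f (z + s)) atTop (𝓝 0) := by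
      refine squeeze_zero_norm' (Filter.eventually_atTop.2 ⟨0, fun s hs => (hεB z hz0).1 s hs⟩) ?_
      have h2 : Tendsto (fun s : ℝ => (1 + s) ^ 2) atTop atTop :=
        (tendsto_pow_atTop two_ne_zero).comp (tendsto_atTop_add_const_left _ _ tendsto_id)
      simpa using (tendsto_inv_atTop_zero.comp h2).const_mul B
    rw [integral_Ioi_of_hasDerivAt_of_tendsto' hd key.1 ht]
    simp
  -- Cauchy's estimate on the circle of radius ε/4 about w + s. Translated back by s, the circle is
  -- within ε/4 + ε/4 < ε of z, where the assumed bound holds.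
  · have hs' : 0 ≤ s := le_of_lt hs
    refine norm_deriv_le_of_forall_mem_sphere_norm_le hε4 ?_ fun y hy => ?_
    · refine (hf.mono fun y hy => ?_).diffContOnCl
      have h1 := Metric.closure_ball_subset_closedBall hy
      have : y - s ∈ Metric.ball z ε := by
        rw [Metric.mem_ball, dist_eq] at hw ⊢
        rw [Metric.mem_closedBall, dist_eq] at h1
        calc ‖y - s - z‖ = ‖(y - (w + s)) + (w - z)‖ := by congr 1; ring
          _ ≤ _ := norm_add_le _ _
          _ < ε := by linarith
      simpa using hshift _ (hεB _ this).2 s hs'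
    · have : y - s ∈ Metric.ball z ε := by
        rw [Metric.mem_ball, dist_eq] at hw ⊢
        rw [mem_sphere_iff_norm] at hy
        calc ‖y - s - z‖ = ‖(y - (w + s)) + (w - z)‖ := by congr 1; ring
          _ ≤ _ := norm_add_le _ _
          _ < ε := by linarith
      simpa using (hεB _ this).1 s hs'
  · have hw' : w ∈ Metric.ball z ε := Metric.ball_subset_ball (by linarith) hw
    exact (hdiff w hw' s (le_of_lt hs)).comp_add_const w (s : ℂ)

/-- Two of the j + 2 powers pay for integrability in s; the other j survive as decay in z. -/
theorem inv_pow_shift {κ R : ℝ} (hκ : 0 < κ) (hR : 2 ≤ R) {z : ℂ} (hz : z ∈ cone κ R)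
    (h1 : 1 ≤ ‖z‖) {s : ℝ} (hs : 0 ≤ s) (j : ℕ) :
    (‖z + s‖ ^ (j + 2))⁻¹ ≤ (3 + 2 / κ) ^ (j + 2) * (‖z‖ ^ j)⁻¹ * ((1 + s) ^ 2)⁻¹ := by
  have hK : 0 < 3 + 2 / κ := by positivity
  have h2 := cone_shift hκ (by linarith) hz hs
  have h3 : ‖z‖ ^ j * (1 + s) ^ 2 ≤ (3 + 2 / κ) ^ (j + 2) * ‖z + s‖ ^ (j + 2) := by
    calc ‖z‖ ^ j * (1 + s) ^ 2 ≤ (‖z‖ + s) ^ j * (‖z‖ + s) ^ 2 := by gcongr; linarith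
      _ = (‖z‖ + s) ^ (j + 2) := by ring
      _ ≤ ((3 + 2 / κ) * ‖z + s‖) ^ (j + 2) := by gcongr
      _ = _ := mul_pow _ _ _
  have h4 : 0 < ‖z + s‖ := by
    by_contra h
    have : ‖z + s‖ = 0 := le_antisymm (not_lt.1 h) (norm_nonneg _)
    rw [this, mul_zero] at h2
    linarith
  rw [mul_assoc, ← mul_inv, ← div_eq_mul_inv, le_div_iff₀ (by positivity),
    inv_mul_le_iff₀ (by positivity)]
  linarith

/-- One step of the Volterra iteration. -/
noncomputable def volterraStep (H g e : ℂ → ℂ) : ℂ → ℂ :=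
  fun z => -rayIntegral (fun z => (H z)⁻¹ * rayIntegral (fun z => H z * g z * e z) z) z

/-! ### The Volterra equation for the ratio of an exact to an approximate solution -/

section Volterra

variable {κ R A B : ℝ} {n : ℕ} {H g : ℂ → ℂ}

/-- Each of the two nested ray integrals costs two powers of |z|, so g = O(|z|^{-(n+4)}) leaves the
factor |z|^{-n}. The growth condition on H lets |H z| be pulled out of the inner integral, where it
cancels against the prefactor 1 / H z. -/
theorem volterraStep_spec (hκ : 0 < κ) (hκ1 : κ ≤ 1) (hR : 2 ≤ R) (hA : 0 ≤ A) (hB : 0 ≤ B)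
    (hH : DifferentiableOn ℂ H (cone κ R)) (hH0 : ∀ z ∈ cone κ R, H z ≠ 0)
    (hHs : ∀ z ∈ cone κ R, ∀ s : ℝ, 0 ≤ s → ‖H (z + s)‖ ≤ B * ‖H z‖)
    (hg : DifferentiableOn ℂ g (cone κ R))
    (hgA : ∀ z ∈ cone κ R, ‖g z‖ ≤ A * (‖z‖ ^ (n + 4))⁻¹)
    {e : ℂ → ℂ} {v : ℝ} (he : DifferentiableOn ℂ e (cone κ R)) (hev : ∀ z ∈ cone κ R, ‖e z‖ ≤ v)
    {z : ℂ} (hz : z ∈ cone κ R) :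
    HasDerivAt (volterraStep H g e) ((H z)⁻¹ * rayIntegral (fun z => H z * g z * e z) z) z ∧
    HasDerivAt (rayIntegral fun z => H z * g z * e z) (-(H z * g z * e z)) z ∧
    ‖(H z)⁻¹ * rayIntegral (fun z => H z * g z * e z) z‖ ≤
      B * A * (3 + 2 / κ) ^ (2 * n + 8) * v ∧
    ‖volterraStep H g e z‖ ≤ B * A * (3 + 2 / κ) ^ (2 * n + 8) * v * (‖z‖ ^ n)⁻¹ := by
  have hK : 1 ≤ 3 + 2 / κ := by
    have : 0 < 2 / κ := by positivity
    linarith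
  set K := 3 + 2 / κ with hK_def
  have hv : 0 ≤ v := (norm_nonneg _).trans (hev z hz)
  have hn1 : ∀ z ∈ cone κ R, 1 ≤ ‖z‖ := fun z hz => by
    have := cone_norm hκ.le hκ1 hz
    linarith
  have hshift : ∀ z ∈ cone κ R, ∀ s : ℝ, 0 ≤ s → z + s ∈ cone κ R :=
    fun z hz s hs => cone_add hκ.le hz hs
  have hfd : DifferentiableOn ℂ (fun z => H z * g z * e z) (cone κ R) := (hH.mul hg).mul he
  have hfb : ∀ z ∈ cone κ R, ∀ s : ℝ, 0 ≤ s → ‖H (z + s) * g (z + s) * e (z + s)‖ ≤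
      B * ‖H z‖ * (A * (K ^ (n + 4) * (‖z‖ ^ (n + 2))⁻¹)) * v * ((1 + s) ^ 2)⁻¹ := by
    intro z hz s hs
    rw [norm_mul, norm_mul]
    have h1 := hgA _ (hshift z hz s hs)
    have h2 := inv_pow_shift hκ hR hz (hn1 z hz) hs (n + 2)
    calc ‖H (z + s)‖ * ‖g (z + s)‖ * ‖e (z + s)‖
        ≤ B * ‖H z‖ * (A * (K ^ (n + 4) * (‖z‖ ^ (n + 2))⁻¹ * ((1 + s) ^ 2)⁻¹)) * v := by
          gcongr
          · exact hHs z hz s hs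
          · exact h1.trans (by gcongr)
          · exact hev _ (hshift z hz s hs)
      _ = _ := by ring
  have hJ1 : ∀ z ∈ cone κ R, HasDerivAt (rayIntegral fun z => H z * g z * e z)
      (-(H z * g z * e z)) z := by
    intro z hz
    have hHc : ContinuousAt H z := hH.continuousOn.continuousAt ((isOpen_cone κ R).mem_nhds hz)
    refine hasDerivAt_rayIntegral (isOpen_cone κ R) hshift hfd hz
      (B := B * (‖H z‖ + 1) * (A * (K ^ (n + 4) * 1)) * v) ?_
    filter_upwards [hHc.norm.eventually (gt_mem_nhds (lt_add_one ‖H z‖)),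
      (isOpen_cone κ R).mem_nhds hz] with w hw1 hw2 s hs
    refine (hfb w hw2 s hs).trans ?_
    have : (‖w‖ ^ (n + 2))⁻¹ ≤ 1 := inv_le_one_of_one_le₀ (one_le_pow₀ (hn1 w hw2))
    gcongr
  set q : ℂ → ℂ := fun z => (H z)⁻¹ * rayIntegral (fun z => H z * g z * e z) z with hq
  have hqd : DifferentiableOn ℂ q (cone κ R) := fun z hz =>
    (((hH.differentiableAt ((isOpen_cone κ R).mem_nhds hz)).inv (hH0 z hz)).mul
      (hJ1 z hz).differentiableAt).differentiableWithinAt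
  have hqb : ∀ z ∈ cone κ R, ‖q z‖ ≤ B * A * K ^ (n + 4) * v * (‖z‖ ^ (n + 2))⁻¹ := by
    intro z hz
    have h1 := norm_rayIntegral_le (f := fun z => H z * g z * e z) (hfb z hz)
    have h2 : ‖H z‖ ≠ 0 := norm_ne_zero_iff.2 (hH0 z hz)
    calc ‖q z‖ = ‖H z‖⁻¹ * ‖rayIntegral (fun z => H z * g z * e z) z‖ := by
          rw [hq, norm_mul, norm_inv]
      _ ≤ ‖H z‖⁻¹ * (B * ‖H z‖ * (A * (K ^ (n + 4) * (‖z‖ ^ (n + 2))⁻¹)) * v) := by gcongr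
      _ = _ := by field_simp
  have hqs : ∀ z ∈ cone κ R, ∀ s : ℝ, 0 ≤ s →
      ‖q (z + s)‖ ≤ B * A * K ^ (2 * n + 6) * v * (‖z‖ ^ n)⁻¹ * ((1 + s) ^ 2)⁻¹ := by
    intro z hz s hs
    have h2 := inv_pow_shift hκ hR hz (hn1 z hz) hs n
    calc ‖q (z + s)‖ ≤ B * A * K ^ (n + 4) * v * (‖z + s‖ ^ (n + 2))⁻¹ :=
          hqb _ (hshift z hz s hs)
      _ ≤ B * A * K ^ (n + 4) * v * (K ^ (n + 2) * (‖z‖ ^ n)⁻¹ * ((1 + s) ^ 2)⁻¹) := by gcongr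
      _ = _ := by ring
  have hKle : K ^ (2 * n + 6) ≤ K ^ (2 * n + 8) := pow_le_pow_right₀ hK (by omega)
  have hKle' : K ^ (n + 4) ≤ K ^ (2 * n + 8) := pow_le_pow_right₀ hK (by omega)
  refine ⟨?_, hJ1 z hz, ?_, ?_⟩
  · have := (hasDerivAt_rayIntegral (isOpen_cone κ R) hshift hqd hz
      (B := B * A * K ^ (2 * n + 6) * v * 1) ?_).neg
    · rw [neg_neg] at this
      exact this
    · filter_upwards [(isOpen_cone κ R).mem_nhds hz] with w hw s hs
      refine (hqs w hw s hs).trans ?_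
      have : (‖w‖ ^ n)⁻¹ ≤ 1 := inv_le_one_of_one_le₀ (one_le_pow₀ (hn1 w hw))
      gcongr
  · refine (hqb z hz).trans ?_
    have : (‖z‖ ^ (n + 2))⁻¹ ≤ 1 := inv_le_one_of_one_le₀ (one_le_pow₀ (hn1 z hz))
    calc B * A * K ^ (n + 4) * v * (‖z‖ ^ (n + 2))⁻¹ ≤ B * A * K ^ (2 * n + 8) * v * 1 := by
          gcongr
      _ = _ := mul_one _
  · rw [volterraStep, norm_neg]
    refine (norm_rayIntegral_le (hqs z hz)).trans ?_
    gcongr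

/-- V is the Neumann series of `volterraStep` applied to 1 and Q is its derivative, so that (H V')'
= -H g V with V close to 1. In the cone |z| > R/2 ≥ 2C, where C is the constant of
`volterraStep_spec`; hence one step contracts by C |z|^{-n} ≤ 1/2 and the k-th iterate is at most
2^{-k}. -/
theorem exists_volterra (hκ : 0 < κ) (hκ1 : κ ≤ 1) (hR : 2 ≤ R) (hA : 0 ≤ A) (hB : 0 ≤ B)
    (hn : 1 ≤ n) (hRC : 4 * (B * A * (3 + 2 / κ) ^ (2 * n + 8)) ≤ R)
    (hH : DifferentiableOn ℂ H (cone κ R)) (hH0 : ∀ z ∈ cone κ R, H z ≠ 0)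
    (hHs : ∀ z ∈ cone κ R, ∀ s : ℝ, 0 ≤ s → ‖H (z + s)‖ ≤ B * ‖H z‖)
    (hg : DifferentiableOn ℂ g (cone κ R))
    (hgA : ∀ z ∈ cone κ R, ‖g z‖ ≤ A * (‖z‖ ^ (n + 4))⁻¹) :
    ∃ V Q : ℂ → ℂ, ∀ z ∈ cone κ R, HasDerivAt V (Q z) z ∧
      HasDerivAt (fun z => H z * Q z) (-(H z * g z * V z)) z ∧
      ‖V z - 1‖ ≤ 2 * (B * A * (3 + 2 / κ) ^ (2 * n + 8)) * (‖z‖ ^ n)⁻¹ := by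
  set C := B * A * (3 + 2 / κ) ^ (2 * n + 8) with hC
  have hC0 : 0 ≤ C := by positivity
  have hn1 : ∀ z ∈ cone κ R, 1 ≤ ‖z‖ := fun z hz => by
    have := cone_norm hκ.le hκ1 hz
    linarith
  have hhalf : ∀ z ∈ cone κ R, C * (‖z‖ ^ n)⁻¹ ≤ 1 / 2 := by
    intro z hz
    have h1 := cone_norm hκ.le hκ1 hz
    have h2 : ‖z‖ ≤ ‖z‖ ^ n := le_self_pow₀ (hn1 z hz) (by omega)
    have h3 := hn1 z hz
    rw [← div_eq_mul_inv, div_le_iff₀ (by positivity)]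
    linarith
  set e : ℕ → ℂ → ℂ := fun k => (volterraStep H g)^[k] fun _ => 1 with he
  have he1 : ∀ k, e (k + 1) = volterraStep H g (e k) := fun k =>
    Function.iterate_succ_apply' _ _ _
  have hek : ∀ k, DifferentiableOn ℂ (e k) (cone κ R) ∧ ∀ z ∈ cone κ R, ‖e k z‖ ≤ (1 / 2) ^ k := by
    intro k
    induction k with
    | zero => exact ⟨differentiableOn_const _, fun z _ => by simp [he]⟩
    | succ k ih =>
      have h := fun z hz =>
        volterraStep_spec hκ hκ1 hR hA hB hH hH0 hHs hg hgA ih.1 ih.2 (z := z) hz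
      rw [he1]
      refine ⟨fun z hz => (h z hz).1.differentiableAt.differentiableWithinAt, fun z hz => ?_⟩
      refine (h z hz).2.2.2.trans ?_
      rw [← hC, pow_succ (1 / 2 : ℝ) k]
      have := mul_le_mul_of_nonneg_left (hhalf z hz) (pow_nonneg (by norm_num : (0 : ℝ) ≤ 1 / 2) k)
      linarith
  have hstep := fun k z (hz : z ∈ cone κ R) =>
    volterraStep_spec hκ hκ1 hR hA hB hH hH0 hHs hg hgA (hek k).1 (hek k).2 hz
  set q : ℕ → ℂ → ℂ := fun k z => (H z)⁻¹ * rayIntegral (fun z => H z * g z * e k z) z with hq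
  have hgeo : Summable fun k : ℕ => ((1 : ℝ) / 2) ^ k := summable_geometric_two
  have hes : ∀ z ∈ cone κ R, Summable fun k => e k z := fun z hz =>
    Summable.of_norm_bounded hgeo fun k => (hek k).2 z hz
  have hes' : ∀ z ∈ cone κ R, Summable fun k => e (k + 1) z := fun z hz =>
    (summable_nat_add_iff 1).2 (hes z hz)
  have hV : ∀ z ∈ cone κ R, ∑' k, e k z = 1 + ∑' k, e (k + 1) z := fun z hz => by
    rw [(hes z hz).tsum_eq_zero_add]
    simp [he]
  have hqJ : ∀ k, ∀ z ∈ cone κ R, H z * q k z = rayIntegral (fun z => H z * g z * e k z) z :=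
    fun k z hz => by rw [hq, mul_inv_cancel_left₀ (hH0 z hz)]
  have hqs : ∀ z ∈ cone κ R, Summable fun k => q k z := fun z hz =>
    Summable.of_norm_bounded (hgeo.mul_left C) fun k => (hstep k z hz).2.2.1
  refine ⟨fun z => 1 + ∑' k, e (k + 1) z, fun z => ∑' k, q k z, fun z hz => ⟨?_, ?_, ?_⟩⟩
  · refine (hasDerivAt_tsum_of_isPreconnected (hgeo.mul_left C) (isOpen_cone κ R)
      (isPreconnected_cone hκ R) (fun k y hy => ?_) (fun k y hy => (hstep k y hy).2.2.1) hz
      (hes' z hz) hz).const_add 1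
    rw [he1]
    exact (hstep k y hy).1
  · have hHc : ContinuousAt H z := hH.continuousOn.continuousAt ((isOpen_cone κ R).mem_nhds hz)
    obtain ⟨ε, hε, hεB⟩ := Metric.eventually_nhds_iff_ball.1
      ((hHc.norm.eventually (gt_mem_nhds (lt_add_one ‖H z‖))).and ((isOpen_cone κ R).mem_nhds hz))
    have hz0 : z ∈ Metric.ball z ε := Metric.mem_ball_self hε
    have h1 := hasDerivAt_tsum_of_isPreconnected
      (g := fun k => rayIntegral fun z => H z * g z * e k z)
      (g' := fun k z => -(H z * g z * e k z)) (u := fun k => (‖H z‖ + 1) * A * (1 / 2) ^ k)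
      (hgeo.mul_left _) Metric.isOpen_ball (convex_ball z ε).isPreconnected
      (fun k y hy => (hstep k y (hεB y hy).2).2.1) (fun k y hy => ?_) hz0 ?_ hz0
    · rw [tsum_neg, tsum_mul_left, hV z hz] at h1
      refine h1.congr_of_eventuallyEq ?_
      filter_upwards [(isOpen_cone κ R).mem_nhds hz] with w hw
      rw [← tsum_mul_left]
      exact tsum_congr fun k => hqJ k w hw
    · obtain ⟨hy1, hy2⟩ := hεB y hy
      rw [norm_neg, norm_mul, norm_mul]
      have h2 : (‖y‖ ^ (n + 4))⁻¹ ≤ 1 := inv_le_one_of_one_le₀ (one_le_pow₀ (hn1 y hy2))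
      have h3 : ‖g y‖ ≤ A := (hgA y hy2).trans (mul_le_of_le_one_right hA h2)
      gcongr
      exact (hek k).2 y hy2
    · refine ((hqs z hz).mul_left (H z)).congr fun k => ?_
      exact hqJ k z hz
  · rw [add_sub_cancel_left]
    have h1 : ∀ k, ‖e (k + 1) z‖ ≤ C * (‖z‖ ^ n)⁻¹ * (1 / 2) ^ k := fun k => by
      rw [he1]
      refine (hstep k z hz).2.2.2.trans (le_of_eq ?_)
      ring
    refine (tsum_of_norm_bounded ((hasSum_geometric_two).mul_left _) h1).trans (le_of_eq ?_)
    ring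

end Volterra

/-! ### Entire power series -/

/-- The coefficients of an everywhere convergent power series. -/
def Rapid (h : ℕ → ℂ) : Prop := ∀ R : ℝ, 1 ≤ R → ∃ B : ℝ, ∀ n, ‖h n‖ * R ^ n ≤ B

theorem Rapid.of_le {h k : ℕ → ℂ} (hh : Rapid h) {C : ℝ} (hk : ∀ n, ‖k n‖ ≤ C * ‖h n‖) :
    Rapid k := by
  intro R hR
  obtain ⟨B, hB⟩ := hh R hR
  refine ⟨|C| * |B|, fun n => ?_⟩
  have hR0 : 0 ≤ R ^ n := by positivity
  calc ‖k n‖ * R ^ n ≤ C * ‖h n‖ * R ^ n := mul_le_mul_of_nonneg_right (hk n) hR0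
    _ ≤ |C| * (‖h n‖ * R ^ n) := by
      rw [mul_assoc]; exact mul_le_mul_of_nonneg_right (le_abs_self C) (by positivity)
    _ ≤ |C| * |B| := mul_le_mul_of_nonneg_left ((hB n).trans (le_abs_self B)) (abs_nonneg _)

theorem Rapid.const_mul {h : ℕ → ℂ} (hh : Rapid h) (c : ℂ) : Rapid fun n => c * h n :=
  hh.of_le (C := ‖c‖) fun _ => (norm_mul _ _).le

theorem Rapid.add {h k : ℕ → ℂ} (hh : Rapid h) (hk : Rapid k) : Rapid fun n => h n + k n := by
  intro R hR
  obtain ⟨B, hB⟩ := hh R hR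
  obtain ⟨B', hB'⟩ := hk R hR
  refine ⟨B + B', fun n => ?_⟩
  have hR0 : 0 ≤ R ^ n := by positivity
  have := mul_le_mul_of_nonneg_right (norm_add_le (h n) (k n)) hR0
  linarith [hB n, hB' n, add_mul ‖h n‖ ‖k n‖ (R ^ n)]

theorem Rapid.natCast_mul {h : ℕ → ℂ} (hh : Rapid h) : Rapid fun n => n * h n := by
  intro R hR
  obtain ⟨B, hB⟩ := hh (2 * R) (by linarith)
  refine ⟨B, fun n => le_trans ?_ (hB n)⟩
  have h1 : (n : ℝ) ≤ 2 ^ n := by exact_mod_cast (Nat.lt_two_pow_self).le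
  rw [norm_mul, norm_natCast, mul_pow]
  calc (n : ℝ) * ‖h n‖ * R ^ n = n * (‖h n‖ * R ^ n) := by ring
    _ ≤ 2 ^ n * (‖h n‖ * R ^ n) := by gcongr
    _ = _ := by ring

theorem Rapid.succ {h : ℕ → ℂ} (hh : Rapid h) : Rapid fun n => h (n + 1) := by
  intro R hR
  obtain ⟨B, hB⟩ := hh R hR
  refine ⟨B, fun n => le_trans ?_ (hB (n + 1))⟩
  exact mul_le_mul_of_nonneg_left (pow_le_pow_right₀ hR n.le_succ) (norm_nonneg _)

/-- The coefficients of `x ^ j` times the series with coefficients `h`. -/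
def shiftSeq (j : ℕ) (h : ℕ → ℂ) (n : ℕ) : ℂ := if j ≤ n then h (n - j) else 0

theorem Rapid.shiftSeq {h : ℕ → ℂ} (hh : Rapid h) (j : ℕ) : Rapid (shiftSeq j h) := by
  intro R hR
  obtain ⟨B, hB⟩ := hh R hR
  have hB0 : 0 ≤ B := le_trans (by positivity) (hB 0)
  refine ⟨B * R ^ j, fun n => ?_⟩
  unfold StokesSibuya.shiftSeq
  split_ifs with hj
  · obtain ⟨k, rfl⟩ := Nat.exists_eq_add_of_le hj
    rw [Nat.add_sub_cancel_left, pow_add]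
    calc ‖h k‖ * (R ^ j * R ^ k) = ‖h k‖ * R ^ k * R ^ j := by ring
      _ ≤ _ := mul_le_mul_of_nonneg_right (hB k) (by positivity)
  · rw [norm_zero, zero_mul]; positivity

theorem Rapid.sum {ι : Type*} (s : Finset ι) {h : ι → ℕ → ℂ} (hh : ∀ i ∈ s, Rapid (h i)) :
    Rapid fun n => ∑ i ∈ s, h i n := by
  classical
  induction s using Finset.induction_on with
  | empty => intro R _; exact ⟨0, fun n => by simp⟩
  | insert i s hi ih =>
    simp only [Finset.sum_insert hi]
    exact (hh i (Finset.mem_insert_self i s)).add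
      (ih fun j hj => hh j (Finset.mem_insert_of_mem hj))

/-- The sum of a power series. -/
noncomputable def gser (h : ℕ → ℂ) (x : ℂ) : ℂ := ∑' n, h n * x ^ n

/-- Boundedness at twice the radius yields a geometric majorant on the disc. -/
theorem Rapid.exists_bound {h : ℕ → ℂ} (hh : Rapid h) (r : ℝ) :
    ∃ B : ℝ, ∀ n, ∀ x : ℂ, ‖x‖ ≤ r → ‖h n * x ^ n‖ ≤ B * (1 / 2) ^ n := by
  obtain ⟨B, hB⟩ := hh (2 * max r 1) (by linarith [le_max_right r 1])
  refine ⟨B, fun n x hx => ?_⟩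
  have h1 : ‖x‖ ^ n ≤ (max r 1) ^ n := pow_le_pow_left₀ (norm_nonneg _) (hx.trans (le_max_left _ _)) n
  rw [norm_mul, norm_pow]
  calc ‖h n‖ * ‖x‖ ^ n ≤ ‖h n‖ * (max r 1) ^ n := by gcongr
    _ = ‖h n‖ * (2 * max r 1) ^ n * (1 / 2) ^ n := by
      rw [mul_assoc, ← mul_pow]
      congr 2
      ring
    _ ≤ _ := by gcongr; exact hB n

theorem Rapid.summable {h : ℕ → ℂ} (hh : Rapid h) (x : ℂ) : Summable fun n => h n * x ^ n := by
  obtain ⟨B, hB⟩ := hh.exists_bound ‖x‖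
  exact Summable.of_norm_bounded (summable_geometric_two.mul_left B) fun n => hB n x le_rfl

theorem gser_zero (h : ℕ → ℂ) : gser h 0 = h 0 := by
  rw [gser, tsum_eq_single 0 fun n hn => by rw [zero_pow hn, mul_zero]]
  simp

theorem gser_add {h k : ℕ → ℂ} (hh : Rapid h) (hk : Rapid k) (x : ℂ) :
    gser (fun n => h n + k n) x = gser h x + gser k x := by
  unfold gser
  rw [← (hh.summable x).tsum_add (hk.summable x)]
  exact tsum_congr fun n => add_mul _ _ _

theorem gser_const_mul (h : ℕ → ℂ) (c x : ℂ) : gser (fun n => c * h n) x = c * gser h x := by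
  unfold gser
  rw [← tsum_mul_left]
  exact tsum_congr fun n => mul_assoc _ _ _

theorem gser_shiftSeq {h : ℕ → ℂ} (hh : Rapid h) (j : ℕ) (x : ℂ) :
    gser (shiftSeq j h) x = x ^ j * gser h x := by
  unfold gser
  rw [← ((hh.shiftSeq j).summable x).sum_add_tsum_nat_add j, Finset.sum_eq_zero, zero_add,
    ← tsum_mul_left]
  · refine tsum_congr fun n => ?_
    rw [shiftSeq, if_pos (Nat.le_add_left j n), Nat.add_sub_cancel, pow_add]
    ring
  · intro i hi
    rw [shiftSeq, if_neg (by rw [Finset.mem_range] at hi; omega), zero_mul]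

theorem gser_sum {ι : Type*} (s : Finset ι) {h : ι → ℕ → ℂ} (hh : ∀ i ∈ s, Rapid (h i)) (x : ℂ) :
    gser (fun n => ∑ i ∈ s, h i n) x = ∑ i ∈ s, gser (h i) x := by
  unfold gser
  rw [← Summable.tsum_finsetSum fun i hi => (hh i hi).summable x]
  exact tsum_congr fun n => Finset.sum_mul _ _ _

theorem hasDerivAt_gser {h : ℕ → ℂ} (hh : Rapid h) (x : ℂ) :
    HasDerivAt (gser h) (gser (fun n => (n + 1 : ℕ) * h (n + 1)) x) x := by
  have hh' : Rapid fun n => (n + 1 : ℕ) * h (n + 1) := (hh.natCast_mul).succ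
  obtain ⟨B, hB⟩ := hh'.exists_bound (‖x‖ + 1)
  have hx : x ∈ Metric.ball (0 : ℂ) (‖x‖ + 1) := by simp
  have hsum : Summable fun n => B * ((1 : ℝ) / 2) ^ n := summable_geometric_two.mul_left B
  have h1 := hasDerivAt_tsum_of_isPreconnected (g := fun n x => h (n + 1) * x ^ (n + 1))
    (g' := fun n x => (n + 1 : ℕ) * h (n + 1) * x ^ n) hsum Metric.isOpen_ball
    (convex_ball (0 : ℂ) (‖x‖ + 1)).isPreconnected (fun n y _ => ?_)
    (fun n y hy => hB n y (by simpa using (mem_ball_zero_iff.1 hy).le)) hx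
    ((summable_nat_add_iff 1).2 (hh.summable x)) hx
  · have h2 : gser h = fun x => h 0 + ∑' n, h (n + 1) * x ^ (n + 1) := by
      funext y
      rw [gser, (hh.summable y).tsum_eq_zero_add]
      simp
    rw [h2]
    exact h1.const_add _
  · refine ((hasDerivAt_pow (n + 1) y).const_mul (h (n + 1))).congr_deriv ?_
    simp only [Nat.add_sub_cancel]
    ring

theorem differentiable_gser {h : ℕ → ℂ} (hh : Rapid h) : Differentiable ℂ (gser h) :=
  fun x => (hasDerivAt_gser hh x).differentiableAt

theorem iteratedDeriv_gser {h : ℕ → ℂ} (hh : Rapid h) (j : ℕ) :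
    iteratedDeriv j (gser h) 0 = j.factorial * h j := by
  induction j generalizing h with
  | zero => simp [gser_zero]
  | succ j ih =>
    rw [iteratedDeriv_succ', funext fun x => (hasDerivAt_gser hh x).deriv,
      ih (hh.natCast_mul).succ, Nat.factorial_succ]
    push_cast
    ring

theorem mul_gser_succ {h : ℕ → ℂ} (hh : Rapid h) (x : ℂ) :
    x * gser (fun n => (n + 1 : ℕ) * h (n + 1)) x = gser (fun n => n * h n) x := by
  unfold gser
  rw [(hh.natCast_mul.summable x).tsum_eq_zero_add, ← tsum_mul_left]
  simp only [Nat.cast_zero, zero_mul, zero_add]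
  refine tsum_congr fun n => ?_
  ring

/-- The function `x ^ σ ∑ h_n x ^ n` on the covering. -/
noncomputable def eser (σ : ℂ) (h : ℕ → ℂ) (t : ℂ) : ℂ := exp (σ * t) * gser h (exp t)

theorem hasDerivAt_eser {h : ℕ → ℂ} (hh : Rapid h) (σ t : ℂ) :
    HasDerivAt (eser σ h) (eser σ (fun n => (σ + n) * h n) t) t := by
  have h1 := (((hasDerivAt_id t).const_mul σ).cexp).mul
    ((hasDerivAt_gser hh (exp t)).comp t (hasDerivAt_exp t))
  refine h1.congr_deriv ?_
  have h2 : gser (fun n => (σ + n) * h n) (exp t) =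
      σ * gser h (exp t) + exp t * gser (fun n => (n + 1 : ℕ) * h (n + 1)) (exp t) := by
    rw [mul_gser_succ hh, ← gser_const_mul, ← gser_add (hh.const_mul σ) hh.natCast_mul]
    congr 1
    funext n
    ring
  rw [eser, h2]
  simp only [Function.comp_apply, id]
  ring

theorem Rapid.add_natCast_mul {h : ℕ → ℂ} (hh : Rapid h) (σ : ℂ) :
    Rapid fun n => (σ + n) * h n := by
  simpa only [add_mul] using (hh.const_mul σ).add hh.natCast_mul

/-! ### The differential operator on Frobenius series -/

theorem P_eq_sum (m : ℕ) (a : Fin m → ℂ) (x : ℂ) :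
    P m a x = ∑ k ∈ Finset.range (m + 1), revCoeff m a k * x ^ (m - k) := by
  rw [Finset.sum_range_succ', P, add_comm]
  simp only [revCoeff, Nat.sub_zero, one_mul, add_left_inj]
  rw [Finset.sum_range fun i => (if h : i < m then a ⟨i, h⟩ else 0) * x ^ (m - (i + 1))]
  refine Finset.sum_congr rfl fun i _ => ?_
  rw [dif_pos i.2, Nat.sub_sub, add_comm 1]

theorem revCoeff_ofPrime {m : ℕ} (hm : 1 ≤ m) (a' : Fin (m - 1) → ℂ) (p : ℂ) :
    revCoeff m (ofPrime m a' p) m = (p ^ 2 - 1) / 4 := by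
  obtain ⟨k, rfl⟩ : ∃ k, m = k + 1 := ⟨m - 1, by omega⟩
  simp [revCoeff, ofPrime]

/-- The right-hand side of the recursion for Frobenius series. -/
noncomputable def lowerConv (m : ℕ) (a : Fin m → ℂ) (h : ℕ → ℂ) (n : ℕ) : ℂ :=
  ∑ k ∈ Finset.range m, revCoeff m a k * shiftSeq (m - k) h n

theorem Rapid.lowerConv {h : ℕ → ℂ} (hh : Rapid h) (m : ℕ) (a : Fin m → ℂ) :
    Rapid (lowerConv m a h) :=
  Rapid.sum (Finset.range m) fun k _ => (hh.shiftSeq (m - k)).const_mul (revCoeff m a k)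

theorem P_mul_gser {h : ℕ → ℂ} (hh : Rapid h) (m : ℕ) (a : Fin m → ℂ) (x : ℂ) :
    P m a x * gser h x = gser (fun n => lowerConv m a h n + revCoeff m a m * h n) x := by
  rw [gser_add (hh.lowerConv m a) (hh.const_mul _), gser_const_mul]
  unfold StokesSibuya.lowerConv
  rw [gser_sum _ fun k _ => (hh.shiftSeq (m - k)).const_mul (revCoeff m a k), P_eq_sum,
    Finset.sum_range_succ, add_mul, Finset.sum_mul]
  congr 1
  · refine Finset.sum_congr rfl fun k _ => ?_
    rw [gser_const_mul, gser_shiftSeq hh, mul_assoc]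
  · simp

/-- The indicial factor is (s(q) + n)(s(q) + n - 1) - (q² - 1)/4 = n (n + q), and the remaining
terms of P multiply the series by positive powers of x. -/
theorem eser_residual {m : ℕ} (hm : 1 ≤ m) (a' : Fin (m - 1) → ℂ) {p q : ℂ} (hq : q ^ 2 = p ^ 2)
    {h : ℕ → ℂ} (hh : Rapid h) (t : ℂ) :
    deriv (deriv (eser (s q) h)) t - deriv (eser (s q) h) t -
        P m (ofPrime m a' p) (exp t) * eser (s q) h t =
      eser (s q) (fun n => n * (n + q) * h n - lowerConv m (ofPrime m a' p) h n) t := by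
  have h1 : deriv (eser (s q) h) = eser (s q) fun n => (s q + n) * h n :=
    funext fun t => (hasDerivAt_eser hh _ t).deriv
  have hh1 := hh.add_natCast_mul (s q)
  rw [h1, (hasDerivAt_eser hh1 _ t).deriv]
  have h2 : (fun n : ℕ => (s q + n) * ((s q + n) * h n)) = fun n : ℕ =>
      (s q + n) * h n + ((n * (n + q) * h n - lowerConv m (ofPrime m a' p) h n) +
        (lowerConv m (ofPrime m a' p) h n + revCoeff m (ofPrime m a' p) m * h n)) := by
    funext n
    rw [revCoeff_ofPrime hm, ← hq, s]
    ring
  have hr : Rapid fun n : ℕ => n * (n + q) * h n - lowerConv m (ofPrime m a' p) h n := by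
    have := ((hh.add_natCast_mul q).natCast_mul).add
      ((hh.lowerConv m (ofPrime m a' p)).const_mul (-1))
    convert this using 2 with n
    ring
  have hc := (hh.lowerConv m (ofPrime m a' p)).add (hh.const_mul (revCoeff m (ofPrime m a' p) m))
  rw [h2]
  unfold eser
  rw [gser_add hh1 (hr.add hc), gser_add hr hc, ← P_mul_gser hh]
  ring

/-! ### The recursion at the origin -/

/-- For a given radius R, once n ≥ 2 C m R^m the factor C/n makes the lower terms contribute at most
half of the bound carried by the induction. The finitely many earlier terms are absorbed into that
bound. -/
theorem rapid_of_recursion {m : ℕ} {h src : ℕ → ℂ} (hsrc : Rapid src) {C : ℝ} (hC : 0 ≤ C) {n₀ : ℕ}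
    (hrec : ∀ n, n₀ ≤ n → ‖h n‖ ≤
      C / n * ∑ k ∈ Finset.range m, ‖shiftSeq (m - k) h n‖ + ‖src n‖) : Rapid h := by
  intro R hR
  obtain ⟨B, hB⟩ := hsrc R hR
  have hB0 : 0 ≤ B := le_trans (by positivity) (hB 0)
  obtain ⟨n₁, hn₁⟩ := exists_nat_ge (2 * (C * m * R ^ m))
  set N := max n₀ (max n₁ 1)
  set B' := 2 * B + ∑ n ∈ Finset.range N, ‖h n‖ * R ^ n with hB'
  have hsum0 : 0 ≤ ∑ n ∈ Finset.range N, ‖h n‖ * R ^ n :=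
    Finset.sum_nonneg fun _ _ => by positivity
  refine ⟨B', fun n => ?_⟩
  induction n using Nat.strong_induction_on with
  | _ n ih =>
  rcases lt_or_ge n N with hn | hn
  · have := Finset.single_le_sum (f := fun n => ‖h n‖ * R ^ n) (fun _ _ => by positivity)
      (Finset.mem_range.2 hn)
    linarith
  have hn0 : n₀ ≤ n := (le_max_left _ _).trans hn
  have hn1 : n₁ ≤ n := ((le_max_left _ _).trans (le_max_right _ _)).trans hn
  have hn2 : 1 ≤ n := ((le_max_right _ _).trans (le_max_right _ _)).trans hn
  have hnpos : (0 : ℝ) < n := by exact_mod_cast hn2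
  have h1 : ∀ k ∈ Finset.range m, ‖shiftSeq (m - k) h n‖ * R ^ n ≤ B' * R ^ m := by
    intro k hk
    have hk' := Finset.mem_range.1 hk
    unfold shiftSeq
    split_ifs with hj
    · have h2 := ih (n - (m - k)) (by omega)
      have h3 : R ^ n = R ^ (n - (m - k)) * R ^ (m - k) := by rw [← pow_add]; congr 1; omega
      rw [h3, ← mul_assoc]
      exact mul_le_mul h2 (pow_le_pow_right₀ hR (by omega)) (by positivity)
        (by linarith)
    · rw [norm_zero, zero_mul]
      have : 0 ≤ B' := by linarith
      positivity
  have h2 : (∑ k ∈ Finset.range m, ‖shiftSeq (m - k) h n‖) * R ^ n ≤ m * (B' * R ^ m) := by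
    rw [Finset.sum_mul]
    exact (Finset.sum_le_sum h1).trans (by simp)
  have h3 : C / n * (m * (B' * R ^ m)) ≤ B' / 2 := by
    have h4 : 2 * (C * m * R ^ m) ≤ n := hn₁.trans (by exact_mod_cast hn1)
    rw [div_mul_eq_mul_div, div_le_iff₀ hnpos]
    have : 0 ≤ B' := by linarith
    nlinarith
  calc ‖h n‖ * R ^ n ≤ (C / n * ∑ k ∈ Finset.range m, ‖shiftSeq (m - k) h n‖ + ‖src n‖) * R ^ n :=
        mul_le_mul_of_nonneg_right (hrec n hn0) (by positivity)
    _ = C / n * ((∑ k ∈ Finset.range m, ‖shiftSeq (m - k) h n‖) * R ^ n) + ‖src n‖ * R ^ n := by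
        ring
    _ ≤ C / n * (m * (B' * R ^ m)) + B := by
        gcongr
        exact hB n
    _ ≤ B' := by linarith

/-- The solution of `n (n + q) h_n = lowerConv h n + src n` with `h_0` given and `h_n = 0` if
`n (n + q) = 0`. -/
noncomputable def frobSeq (m : ℕ) (a : Fin m → ℂ) (q h₀ : ℂ) (src : ℕ → ℂ) (n : ℕ) : ℂ :=
  if hn : n = 0 then h₀ else
    ((∑ k : Fin m, revCoeff m a k *
      (if m - (k : ℕ) ≤ n then frobSeq m a q h₀ src (n - (m - (k : ℕ))) else 0)) + src n) /
      (n * (n + q))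
termination_by n
decreasing_by
  have := k.2
  omega

theorem frobSeq_zero (m : ℕ) (a : Fin m → ℂ) (q h₀ : ℂ) (src : ℕ → ℂ) :
    frobSeq m a q h₀ src 0 = h₀ := by
  rw [frobSeq]; simp

theorem frobSeq_of_ne_zero (m : ℕ) (a : Fin m → ℂ) (q h₀ : ℂ) (src : ℕ → ℂ) {n : ℕ} (hn : n ≠ 0) :
    frobSeq m a q h₀ src n =
      (lowerConv m a (frobSeq m a q h₀ src) n + src n) / (n * (n + q)) := by
  rw [frobSeq, dif_neg hn, lowerConv, Finset.sum_range]
  rfl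

theorem lowerConv_zero (m : ℕ) (a : Fin m → ℂ) (h : ℕ → ℂ) : lowerConv m a h 0 = 0 :=
  Finset.sum_eq_zero fun k hk => by
    rw [shiftSeq, if_neg (by have := Finset.mem_range.1 hk; omega), mul_zero]

theorem lowerConv_congr {m : ℕ} {a : Fin m → ℂ} {h k : ℕ → ℂ} {n : ℕ}
    (H : ∀ i < n, h i = k i) : lowerConv m a h n = lowerConv m a k n :=
  Finset.sum_congr rfl fun j hj => by
    have := Finset.mem_range.1 hj
    unfold shiftSeq
    split_ifs with h1
    · rw [H _ (by omega)]
    · rfl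

theorem rapid_frobSeq (m : ℕ) (a : Fin m → ℂ) (q h₀ : ℂ) {src : ℕ → ℂ} (hsrc : Rapid src) :
    Rapid (frobSeq m a q h₀ src) := by
  obtain ⟨n₁, hn₁⟩ := exists_nat_ge (2 * ‖q‖)
  set A := ∑ k ∈ Finset.range m, ‖revCoeff m a k‖ with hA
  have hA0 : 0 ≤ A := Finset.sum_nonneg fun _ _ => norm_nonneg _
  refine rapid_of_recursion (m := m) (hsrc.const_mul 2) (C := 2 * A) (by positivity)
    (n₀ := max n₁ 1) fun n hn => ?_
  have hn1 : n₁ ≤ n := (le_max_left _ _).trans hn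
  have hn2 : 1 ≤ n := (le_max_right _ _).trans hn
  have hn1' : (1 : ℝ) ≤ n := by exact_mod_cast hn2
  have hq : 2 * ‖q‖ ≤ n := hn₁.trans (by exact_mod_cast hn1)
  have hd : (n : ℝ) / 2 ≤ ‖(n : ℂ) * (n + q)‖ := by
    have h1 : (n : ℝ) - ‖q‖ ≤ ‖(n : ℂ) + q‖ := by
      have := norm_sub_norm_le (n : ℂ) (-q)
      rwa [norm_natCast, norm_neg, sub_neg_eq_add] at this
    rw [norm_mul, norm_natCast]
    nlinarith
  rw [frobSeq_of_ne_zero m a q h₀ src (by omega), norm_div]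
  have h2 : ‖lowerConv m a (frobSeq m a q h₀ src) n‖ ≤
      A * ∑ k ∈ Finset.range m, ‖shiftSeq (m - k) (frobSeq m a q h₀ src) n‖ := by
    refine (norm_sum_le _ _).trans ?_
    rw [hA, Finset.sum_mul]
    refine Finset.sum_le_sum fun k hk => ?_
    rw [norm_mul]
    gcongr
    exact Finset.single_le_sum (f := fun k => ‖shiftSeq (m - k) (frobSeq m a q h₀ src) n‖)
      (fun _ _ => norm_nonneg _) hk
  set S := ∑ k ∈ Finset.range m, ‖shiftSeq (m - k) (frobSeq m a q h₀ src) n‖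
  calc _ ≤ (A * S + ‖src n‖) / (n / 2) := by
        have h3 : ‖lowerConv m a (frobSeq m a q h₀ src) n + src n‖ ≤ A * S + ‖src n‖ :=
          (norm_add_le _ _).trans (by gcongr)
        exact div_le_div₀ ((norm_nonneg _).trans h3) h3 (by positivity) hd
    _ = 2 * A / n * S + 2 * ‖src n‖ * (1 / n) := by
        field_simp
    _ ≤ 2 * A / n * S + ‖2 * src n‖ := by
        rw [norm_mul, norm_ofNat]
        have h4 : 2 * ‖src n‖ * (1 / (n : ℝ)) ≤ 2 * ‖src n‖ * 1 :=
          mul_le_mul_of_nonneg_left ((div_le_one (by linarith)).2 hn1') (by positivity)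
        linarith

theorem frobSeq_eq (m : ℕ) (a : Fin m → ℂ) (q h₀ : ℂ) {src : ℕ → ℂ} (hsrc : src 0 = 0)
    (h : ∀ n : ℕ, n ≠ 0 → (n : ℂ) + q = 0 →
      lowerConv m a (frobSeq m a q h₀ src) n + src n = 0) (n : ℕ) :
    n * (n + q) * frobSeq m a q h₀ src n - lowerConv m a (frobSeq m a q h₀ src) n = src n := by
  rcases eq_or_ne n 0 with rfl | hn
  · rw [lowerConv_zero, hsrc]; simp
  · rw [frobSeq_of_ne_zero m a q h₀ src hn, ← frobSeq_of_ne_zero m a q h₀ src hn]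
    -- At the resonant index the divisor vanishes, and the equation reduces to the assumed
    -- compatibility condition.
    by_cases h1 : (n : ℂ) + q = 0
    · rw [h1]
      linear_combination -(h n hn h1)
    · rw [frobSeq_of_ne_zero m a q h₀ src hn]
      have : (n : ℂ) ≠ 0 := Nat.cast_ne_zero.2 hn
      field_simp
      ring

theorem isSolution_eser {m : ℕ} (hm : 1 ≤ m) (a' : Fin (m - 1) → ℂ) {p q : ℂ}
    (hq : q ^ 2 = p ^ 2) (hq' : ∀ n : ℕ, q ≠ -((n : ℂ) + 1)) :
    IsSolution m (ofPrime m a' p)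
      (eser (s q) (frobSeq m (ofPrime m a' p) q 1 fun _ => 0)) := by
  have hz : Rapid fun _ => (0 : ℂ) := fun R _ => ⟨0, fun _ => by simp⟩
  have hr := rapid_frobSeq m (ofPrime m a' p) q 1 hz
  refine isSolution_iff.2 ⟨fun t => (hasDerivAt_eser hr _ t).differentiableAt, fun t => ?_⟩
  have h1 := eser_residual hm a' hq hr t
  rw [funext (frobSeq_eq m (ofPrime m a' p) q 1 rfl fun n hn h => ?_)] at h1
  · have h2 : eser (s q) (fun _ => 0) t = 0 := by simp [eser, gser]
    rw [h2] at h1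
    linear_combination h1
  · obtain ⟨k, rfl⟩ := Nat.exists_eq_succ_of_ne_zero hn
    refine absurd ?_ (hq' k)
    push_cast at h
    linear_combination h

theorem eser_shift {n : ℕ} {h : ℕ → ℂ} (hh : Rapid h) (σ t : ℂ) :
    eser (σ + n) h t = eser σ (shiftSeq n h) t := by
  rw [eser, eser, gser_shiftSeq hh, add_mul, exp_add, exp_nat_mul]
  ring

/-- The second solution at the origin when `p` is a natural number. -/
theorem isSolution_log {m : ℕ} (hm : 1 ≤ m) (a' : Fin (m - 1) → ℂ) (n : ℕ) {μ : ℂ} {g h : ℕ → ℂ}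
    (hg : Rapid g) (hh : Rapid h)
    (hsol : IsSolution m (ofPrime m a' n) (eser (s n) g))
    (hrec : ∀ k : ℕ, k * (k + -(n : ℂ)) * h k - lowerConv m (ofPrime m a' n) h k =
      -μ * (2 * k - n) * shiftSeq n g k) :
    IsSolution m (ofPrime m a' n) fun t =>
      μ * eser (s n) g t * t + eser (s (-n)) h t := by
  have hf := hsol.1
  have hv : Differentiable ℂ (eser (s (-n)) h) :=
    fun t => (hasDerivAt_eser hh _ t).differentiableAt
  set f := eser (s n) g with hf_def
  set v := eser (s (-n)) h with hv_def
  have h1 : deriv (fun t => μ * f t * t + v t) =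
      fun t => μ * deriv f t * t + μ * f t + deriv v t := funext fun t => by
    refine ((((hf t).hasDerivAt.const_mul μ).mul (hasDerivAt_id t)).add
      (hv t).hasDerivAt).deriv.trans ?_
    simp
  have h2 : ∀ t, deriv (fun t => μ * deriv f t * t + μ * f t + deriv v t) t =
      μ * deriv (deriv f) t * t + μ * deriv f t + μ * deriv f t + deriv (deriv v) t := fun t => by
    refine (((((hf.deriv t).hasDerivAt.const_mul μ).mul (hasDerivAt_id t)).add
      ((hf t).hasDerivAt.const_mul μ)).add (hv.deriv t).hasDerivAt).deriv.trans ?_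
    simp
  refine isSolution_iff.2 ⟨((hf.const_mul μ).mul differentiable_id).add hv, fun t => ?_⟩
  rw [h1, h2]
  have h3 := eser_residual hm a' (q := -n) (p := n) (by ring) hh t
  rw [funext hrec] at h3
  -- The operator sends μ f t to μ (2 f' - f). Since s(n) = s(-n) + n, the series of f is moved by n
  -- places, and its coefficient at index k acquires the factor 2 (s(-n) + k) - 1 = 2k - n.
  have h4 : eser (s (-n)) (fun k : ℕ => -μ * (2 * k - n) * shiftSeq n g k) t =
      -μ * (2 * deriv f t - f t) := by
    have h5 : deriv f t = eser (s n) (fun k => (s n + k) * g k) t :=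
      (hasDerivAt_eser hg _ t).deriv
    have hsn : s (n : ℂ) = s (-n) + n := by unfold s; ring
    have hg' := hg.add_natCast_mul (s n)
    rw [h5, hf_def]
    conv_rhs => rw [hsn]
    rw [eser_shift (hsn ▸ hg') , eser_shift hg, eser, eser, eser]
    have h6 : (fun k : ℕ => -μ * (2 * k - n) * shiftSeq n g k) = fun k =>
        (-2 * μ) * shiftSeq n (fun k => (s (-n) + n + k) * g k) k + μ * shiftSeq n g k := by
      funext k
      unfold shiftSeq s
      split_ifs with hk
      · beta_reduce
        rw [Nat.cast_sub hk]
        ring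
      · ring
    rw [h6, gser_add (((hsn ▸ hg').shiftSeq n).const_mul _) ((hg.shiftSeq n).const_mul _),
      gser_const_mul, gser_const_mul]
    ring
  rw [h4] at h3
  linear_combination h3 + μ * t * hsol.deriv_deriv t

/-- Only the second solution can meet a resonance, at the index n = p when p is a natural number;
the logarithm is what restores compatibility there. For p = 0 the two exponents coincide, and f_2
starts from the logarithm, with zero constant term in g_2. -/
theorem exists_isFrobeniusPair {m : ℕ} (hm : 1 ≤ m) (a' : Fin (m - 1) → ℂ) {p : ℂ}
    (hp : ∀ n : ℕ, p ≠ -((n : ℂ) + 1)) : ∃ f, IsFrobeniusPair m a' p f := by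
  have hz : Rapid fun _ => (0 : ℂ) := fun R _ => ⟨0, fun _ => by simp⟩
  set g := frobSeq m (ofPrime m a' p) p 1 fun _ => 0 with hg_def
  have hg : Rapid g := rapid_frobSeq _ _ _ _ hz
  have hf := isSolution_eser hm a' (p := p) rfl hp
  have hg0 : gser g 0 = 1 := by rw [gser_zero, hg_def, frobSeq_zero]
  by_cases hZ : ∃ n : ℤ, p = n
  · obtain ⟨n, hn⟩ : ∃ n : ℕ, p = n := by
      obtain ⟨n, rfl⟩ := hZ
      rcases Int.eq_nat_or_neg n with ⟨k, rfl | rfl⟩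
      · exact ⟨k, by simp⟩
      · rcases k with _ | k
        · exact ⟨0, by simp⟩
        · exact absurd (by push_cast; ring) (hp k)
    subst hn
    set h₀ : ℂ := if n = 0 then 0 else 1 with hh₀
    -- For n > 0 the source at index n is -μ n, so compatibility determines μ. The source vanishes
    -- below n, which allows μ to be computed from the source-free recursion without circularity.
    set μ : ℂ := if n = 0 then 1 else
      lowerConv m (ofPrime m a' n) (frobSeq m (ofPrime m a' n) (-n) h₀ fun _ => 0) n / n with hμ
    set src : ℕ → ℂ := fun k => -μ * (2 * k - n) * shiftSeq n g k with hsrc_def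
    have hsrc : Rapid src := by
      have h1 := ((hg.shiftSeq n).const_mul (μ * n)).add
        ((hg.shiftSeq n).natCast_mul.const_mul (-2 * μ))
      convert h1 using 2 with k
      simp only [hsrc_def]
      ring
    set h := frobSeq m (ofPrime m a' n) (-n) h₀ src with hh_def
    have hh : Rapid h := rapid_frobSeq _ _ _ _ hsrc
    have hsrc0 : src 0 = 0 := by
      simp only [hsrc_def, shiftSeq]
      split_ifs with h1
      · have : n = 0 := by omega
        simp [this]
      · simp
    have hlow : ∀ i < n, frobSeq m (ofPrime m a' n) (-n) h₀ (fun _ => 0) i = h i := by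
      intro i
      induction i using Nat.strong_induction_on with
      | _ i ih =>
      intro hi
      rcases eq_or_ne i 0 with rfl | hi0
      · rw [hh_def, frobSeq_zero, frobSeq_zero]
      · rw [hh_def, frobSeq_of_ne_zero _ _ _ _ _ hi0, frobSeq_of_ne_zero _ _ _ _ _ hi0, ← hh_def,
          lowerConv_congr fun j hj => ih j hj (hj.trans hi)]
        simp only [hsrc_def, shiftSeq, if_neg (not_le.2 hi), mul_zero]
    have hrec : ∀ k : ℕ, k * (k + -(n : ℂ)) * h k - lowerConv m (ofPrime m a' n) h k = src k := by
      refine frobSeq_eq m (ofPrime m a' n) (-n) h₀ hsrc0 fun k hk hkn => ?_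
      have hkn' : k = n := by
        have : (k : ℂ) = n := by linear_combination hkn
        exact_mod_cast this
      subst hkn'
      have hk' : (k : ℂ) ≠ 0 := Nat.cast_ne_zero.2 hk
      have hsk : src k = -μ * (2 * k - k) := by
        simp only [hsrc_def, shiftSeq, le_refl, if_true, Nat.sub_self]
        rw [hg_def, frobSeq_zero, mul_one]
      rw [← hh_def, hsk, ← lowerConv_congr hlow, hμ, if_neg hk]
      field_simp
      ring
    have hf2 := isSolution_log hm a' n hg hh hf hrec
    refine ⟨(eser (s n) g, fun t => μ * eser (s n) g t * t + eser (s (-n)) h t), hf, hf2,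
      μ, gser g, gser h, differentiable_gser hg, differentiable_gser hh, hg0, fun _ => rfl,
      fun _ => rfl, fun H => absurd (by simp) (H n), fun k hk hkn => ?_, fun H => ?_⟩
    · have hkn' : n = k := by exact_mod_cast hkn
      subst hkn'
      refine ⟨?_, ?_⟩
      · rw [gser_zero, hh_def, frobSeq_zero, hh₀, if_neg hk.ne']
      -- At the resonant index the quotient in `frobSeq` has divisor 0 and therefore equals 0, which
      -- is precisely the required normalization.
      · rw [iteratedDeriv_gser hh, hh_def, frobSeq_of_ne_zero _ _ _ _ _ hk.ne']
        simp
    · have hn0 : n = 0 := by exact_mod_cast H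
      refine ⟨by rw [hμ, if_pos hn0], ?_⟩
      rw [gser_zero, hh_def, frobSeq_zero, hh₀, if_pos hn0]
  · push Not at hZ
    have hp' : ∀ n : ℕ, -p ≠ -((n : ℂ) + 1) := fun n hn =>
      hZ (n + 1) (by push_cast; linear_combination -hn)
    have hf2 := isSolution_eser hm a' (p := p) (q := -p) (by ring) hp'
    refine ⟨(eser (s p) g, eser (s (-p)) (frobSeq m (ofPrime m a' p) (-p) 1 fun _ => 0)), hf, hf2,
      0, gser g, gser (frobSeq m (ofPrime m a' p) (-p) 1 fun _ => 0), differentiable_gser hg,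
      differentiable_gser (rapid_frobSeq _ _ _ _ hz),
      hg0, fun _ => rfl, fun t => ?_, fun _ => ⟨rfl, ?_⟩, fun k _ hk => ?_, fun H => ?_⟩
    · simp only [zero_mul, zero_add]
      rfl
    · rw [gser_zero, frobSeq_zero]
    · exact absurd hk (by exact_mod_cast hZ k)
    · exact absurd H (by exact_mod_cast hZ 0)

/-! ### Polynomials in `x ^ (-stepExp)` with coefficients polynomial in `a` -/

/-- Evaluation of a polynomial in `ξ` with coefficients in `ℂ[a]`. -/
noncomputable def ev {m : ℕ} (a : Fin m → ℂ) (ξ : ℂ) :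
    Polynomial (MvPolynomial (Fin m) ℂ) →+* ℂ :=
  Polynomial.eval₂RingHom (MvPolynomial.eval a) ξ

theorem ev_C {m : ℕ} (a : Fin m → ℂ) (ξ : ℂ) (q : MvPolynomial (Fin m) ℂ) :
    ev a ξ (Polynomial.C q) = MvPolynomial.eval a q :=
  Polynomial.eval₂_C _ _

theorem ev_X {m : ℕ} (a : Fin m → ℂ) (ξ : ℂ) : ev a ξ Polynomial.X = ξ :=
  Polynomial.eval₂_X _ _

theorem exists_ev_bound {m : ℕ} (q : Polynomial (MvPolynomial (Fin m) ℂ)) {K : Set (Fin m → ℂ)}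
    (hK : IsCompact K) : ∃ C : ℝ, 0 ≤ C ∧ ∀ a ∈ K, ∀ ξ : ℂ, ‖ξ‖ ≤ 1 → ‖ev a ξ q‖ ≤ C := by
  induction q using Polynomial.induction_on' with
  | add p q hp hq =>
    obtain ⟨C, hC0, hC⟩ := hp
    obtain ⟨C', hC0', hC'⟩ := hq
    refine ⟨C + C', by positivity, fun a ha ξ hξ => ?_⟩
    rw [map_add]
    exact (norm_add_le _ _).trans (add_le_add (hC a ha ξ hξ) (hC' a ha ξ hξ))
  | monomial n c =>
    obtain ⟨C, hC⟩ := hK.exists_bound_of_continuousOn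
      (MvPolynomial.continuous_eval c).continuousOn
    refine ⟨|C|, abs_nonneg _, fun a ha ξ hξ => ?_⟩
    rw [← Polynomial.C_mul_X_pow_eq_monomial, map_mul, map_pow, ev_C, ev_X, norm_mul, norm_pow]
    calc _ ≤ C * 1 := mul_le_mul (hC a ha) (pow_le_one₀ (norm_nonneg _) hξ) (by positivity)
          ((norm_nonneg _).trans (hC a ha))
      _ ≤ |C| := by rw [mul_one]; exact le_abs_self C

/-- The denominator of the step exponent. -/
def stepDen (m : ℕ) : ℕ := if Even m then 1 else 2

/-- The number of steps in `x ^ (m/2)`. -/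
def halfDeg (m : ℕ) : ℕ := if Even m then m / 2 else m

theorem stepDen_pos (m : ℕ) : 0 < stepDen m := by unfold stepDen; split_ifs <;> norm_num

theorem halfDeg_pos {m : ℕ} (hm : 1 ≤ m) : 0 < halfDeg m := by
  unfold halfDeg
  split_ifs with h
  · obtain ⟨k, rfl⟩ := h; omega
  · omega

theorem two_mul_halfDeg (m : ℕ) : 2 * halfDeg m = stepDen m * m := by
  unfold halfDeg stepDen
  split_ifs with h
  · obtain ⟨k, rfl⟩ := h; omega
  · rfl

theorem halfDeg_lt {m j : ℕ} (hj : m / 2 < j) : halfDeg m < stepDen m * j := by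
  unfold halfDeg stepDen
  split_ifs with h
  · omega
  · omega

theorem stepDen_mul_stepExp (m : ℕ) : (stepDen m : ℝ) * stepExp m = 1 := by
  unfold stepDen stepExp
  split_ifs <;> norm_num

theorem stepExp_pos (m : ℕ) : 0 < stepExp m := by unfold stepExp; split_ifs <;> norm_num

theorem halfDeg_mul_stepExp (m : ℕ) : (halfDeg m : ℝ) * stepExp m = m / 2 := by
  have h1 : (2 : ℝ) * halfDeg m = stepDen m * m := by exact_mod_cast two_mul_halfDeg m
  have h2 := stepDen_mul_stepExp m
  linear_combination stepExp m / 2 * h1 + m / 2 * h2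

/-- The variable `ξ = x ^ (-stepExp)` of the asymptotic expansion. -/
noncomputable def xi (m : ℕ) (t : ℂ) : ℂ := exp (-(stepExp m * t))

theorem xi_pow (m n : ℕ) (t : ℂ) : xi m t ^ n = exp (-(n * stepExp m * t)) := by
  rw [xi, ← exp_nat_mul]
  congr 1
  ring

theorem norm_xi_pow (m n : ℕ) (t : ℂ) : ‖xi m t‖ ^ n = Real.exp (-(n * stepExp m) * t.re) := by
  rw [← norm_pow, xi_pow, norm_exp]
  congr 1
  have : -((n : ℂ) * stepExp m * t) = ((-(n * stepExp m) : ℝ) : ℂ) * t := by push_cast; ring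
  rw [this, re_ofReal_mul]

theorem norm_xi_le_one (m : ℕ) {t : ℂ} (ht : 0 ≤ t.re) : ‖xi m t‖ ≤ 1 := by
  have := norm_xi_pow m 1 t
  rw [pow_one] at this
  rw [this, Real.exp_le_one_iff]
  have := mul_nonneg (stepExp_pos m).le ht
  push_cast
  linarith

theorem hasDerivAt_xi_pow (m n : ℕ) (t : ℂ) :
    HasDerivAt (fun t => xi m t ^ n) (-(n * stepExp m) * xi m t ^ n) t := by
  simp only [xi_pow]
  have h := (((hasDerivAt_id t).const_mul ((n : ℂ) * stepExp m)).neg).cexp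
  refine h.congr_deriv ?_
  simp only [Pi.neg_apply, id]
  ring

/-- The power `x ^ (m/2)`. -/
noncomputable def zeta (m : ℕ) (t : ℂ) : ℂ := exp (m / 2 * t)

theorem zeta_mul_xi_pow (m : ℕ) (t : ℂ) : zeta m t * xi m t ^ halfDeg m = 1 := by
  rw [zeta, xi_pow, ← exp_add]
  have : ((halfDeg m : ℂ) * stepExp m) = m / 2 := by
    rw [← ofReal_natCast, ← ofReal_mul, halfDeg_mul_stepExp]
    push_cast
    rfl
  rw [this]
  simp

theorem zeta_mul_xi_pow_stepDen (m k : ℕ) (t : ℂ) :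
    zeta m t * xi m t ^ (stepDen m * k) = exp ((m / 2 - k) * t) := by
  rw [zeta, xi_pow, ← exp_add]
  have : ((stepDen m : ℂ) * stepExp m) = 1 := by exact_mod_cast stepDen_mul_stepExp m
  congr 1
  push_cast
  linear_combination -k * t * this

/-! ### The truncated square root of `P` -/

/-- The coefficients `revCoeff` as polynomials in `a`. -/
noncomputable def revPoly (m : ℕ) : ℕ → MvPolynomial (Fin m) ℂ
  | 0 => 1
  | k + 1 => if h : k < m then MvPolynomial.X ⟨k, h⟩ else 0

/-- The coefficients `b` as polynomials in `a`. -/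
noncomputable def bPoly (m : ℕ) : ℕ → MvPolynomial (Fin m) ℂ
  | 0 => 1
  | k + 1 => MvPolynomial.C (1 / 2) * (revPoly m (k + 1) -
      ∑ i : Fin k, bPoly m ((i : ℕ) + 1) * bPoly m (k - (i : ℕ)))

theorem eval_bPoly {m : ℕ} (a : Fin m → ℂ) (k : ℕ) :
    MvPolynomial.eval a (bPoly m k) = b m a k := by
  unfold b
  induction k using Nat.strong_induction_on with
  | _ k ih =>
  rcases k with _ | k
  · rw [bPoly, sqrtCoeff, map_one]
  · rw [bPoly, sqrtCoeff, map_mul, MvPolynomial.eval_C, map_sub, map_sum]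
    have h1 : MvPolynomial.eval a (revPoly m (k + 1)) = revCoeff m a (k + 1) := by
      simp only [revPoly, revCoeff]
      split_ifs <;> simp
    have h2 : ∑ i : Fin k, MvPolynomial.eval a (bPoly m ((i : ℕ) + 1) * bPoly m (k - (i : ℕ))) =
        ∑ i : Fin k, sqrtCoeff (revCoeff m a) ((i : ℕ) + 1) *
          sqrtCoeff (revCoeff m a) (k - (i : ℕ)) := by
      refine Finset.sum_congr rfl fun i _ => ?_
      have := i.2
      rw [map_mul, ih _ (by omega), ih _ (by omega)]
    rw [h1, h2]
    ring

theorem b_zero (m : ℕ) (a : Fin m → ℂ) : b m a 0 = 1 := by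
  rw [b, sqrtCoeff]

theorem b_conv {m : ℕ} (a : Fin m → ℂ) (k : ℕ) :
    ∑ q ∈ Finset.HasAntidiagonal.antidiagonal k, b m a q.1 * b m a q.2 = revCoeff m a k := by
  have h := congrArg (PowerSeries.coeff k) (sqrtCoeff_spec (revCoeff m a) (by simp [revCoeff]))
  rw [sq, PowerSeries.coeff_mul] at h
  simp only [PowerSeries.coeff_mk] at h
  exact h

/-- The part of `√P` with nonnegative exponents. -/
noncomputable def sqrtP (m : ℕ) (a : Fin m → ℂ) (t : ℂ) : ℂ :=
  ∑ k ∈ Finset.range (m / 2 + 1), b m a k * exp ((m / 2 - k) * t)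

/-- The number `1/2 - m/4`. -/
noncomputable def nu (m : ℕ) : ℂ := 1 / 2 - m / 4

/-- For even m the term k = m/2 of `sqrtP` is the constant b_0 = ν - r; it has no counterpart in S
and goes into the power x^r instead. Consequently x^r e^{-S} has logarithmic derivative ν - `sqrtP`
in t, for both parities. -/
theorem hasDerivAt_S {m : ℕ} (hm : 1 ≤ m) (a : Fin m → ℂ) (t : ℂ) :
    HasDerivAt (S m a) (sqrtP m a t - (nu m - r m a)) t := by
  have hm0 : (m : ℂ) ≠ 0 := Nat.cast_ne_zero.2 (by omega)
  have hE : ∀ α : ℂ, HasDerivAt (fun t => exp (α * t)) (α * exp (α * t)) t := fun α => by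
    refine (((hasDerivAt_id t).const_mul α).cexp).congr_deriv ?_
    simp only [id]
    ring
  have h1 := ((hE (m / 2)).const_mul (2 / (m : ℂ))).add
    (HasDerivAt.fun_sum fun k (_ : k ∈ Finset.Icc 1 ((m - 1) / 2)) =>
      (hE ((m : ℂ) / 2 - k)).const_mul (b m a k / ((m : ℂ) / 2 - k)))
  refine h1.congr_deriv ?_
  have h2 : ∀ k ∈ Finset.Icc 1 ((m - 1) / 2), b m a k / ((m : ℂ) / 2 - k) *
      (((m : ℂ) / 2 - k) * exp (((m : ℂ) / 2 - k) * t)) =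
        b m a k * exp (((m : ℂ) / 2 - k) * t) := by
    intro k hk
    have : (m : ℂ) / 2 - k ≠ 0 := by
      intro h
      have h3 : (m : ℂ) = (2 * k : ℕ) := by push_cast; linear_combination 2 * h
      have h4 : m = 2 * k := by exact_mod_cast h3
      rw [Finset.mem_Icc] at hk
      omega
    rw [← mul_assoc, div_mul_cancel₀ _ this]
  have h3 : ∑ k ∈ Finset.range ((m - 1) / 2 + 1), b m a k * exp (((m : ℂ) / 2 - k) * t) =
      ∑ k ∈ Finset.Icc 1 ((m - 1) / 2), b m a k * exp (((m : ℂ) / 2 - k) * t) +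
        exp ((m : ℂ) / 2 * t) := by
    rw [Finset.sum_range_succ', b_zero, ← Finset.Ico_add_one_right_eq_Icc,
      Finset.sum_Ico_eq_sum_range, Nat.add_sub_cancel]
    simp only [Nat.cast_zero, sub_zero, one_mul, add_comm 1]
  have h4 : 2 / (m : ℂ) * (m / 2 * exp ((m : ℂ) / 2 * t)) = exp ((m : ℂ) / 2 * t) := by
    field_simp
  rw [Finset.sum_congr rfl h2, h4, add_comm, ← h3, sqrtP, nu, r]
  by_cases he : Even m
  · obtain ⟨j, rfl⟩ := he
    have h5 : (j + j - 1) / 2 + 1 = j := by omega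
    have h6 : (j + j) / 2 = j := by omega
    rw [if_pos ⟨j, rfl⟩, h5, h6, Finset.sum_range_succ]
    push_cast
    have h7 : ((j : ℂ) + j) / 2 - j = 0 := by ring
    rw [h7, zero_mul, exp_zero]
    ring
  · have h5 : (m - 1) / 2 = m / 2 := by
      rw [Nat.not_even_iff_odd] at he
      obtain ⟨j, rfl⟩ := he
      omega
    rw [if_neg he, h5]
    ring

theorem leading_ne_zero (m : ℕ) (a : Fin m → ℂ) (t : ℂ) : leading m a t ≠ 0 :=
  mul_ne_zero (exp_ne_zero _) (exp_ne_zero _)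

theorem hasDerivAt_leading {m : ℕ} (hm : 1 ≤ m) (a : Fin m → ℂ) (t : ℂ) :
    HasDerivAt (leading m a) ((nu m - sqrtP m a t) * leading m a t) t := by
  refine (((hasDerivAt_id t).const_mul (r m a)).cexp.mul
    ((hasDerivAt_S hm a t).neg).cexp).congr_deriv ?_
  simp only [leading, id, Pi.neg_apply]
  ring

/-- The index set of the terms of `(∑ b_k x ^ (m/2-k))²` not in the square of the truncation. -/
def tailIndex (m : ℕ) : Finset (ℕ × ℕ) :=
  ((Finset.range (m + 1) ×ˢ Finset.range (m + 1)).filter fun q => q.1 + q.2 ≤ m).filter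
    fun q => ¬(q.1 ≤ m / 2 ∧ q.2 ≤ m / 2)

/-- P is the square of the full series Σ b_k x^{m/2-k}. The products left out by the truncation have
an index above m/2, hence an exponent below m/2. -/
theorem P_eq_sqrtP_sq (m : ℕ) (a : Fin m → ℂ) (t : ℂ) :
    P m a (exp t) = sqrtP m a t ^ 2 +
      ∑ q ∈ tailIndex m, b m a q.1 * b m a q.2 * exp ((m - q.1 - q.2) * t) := by
  set f : ℕ × ℕ → ℂ := fun q => b m a q.1 * b m a q.2 * exp ((m - q.1 - q.2) * t) with hf
  set A := (Finset.range (m + 1) ×ˢ Finset.range (m + 1)).filter fun q => q.1 + q.2 ≤ m with hA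
  have h1 : P m a (exp t) = ∑ q ∈ A, f q := by
    rw [P_eq_sum, ← Finset.sum_fiberwise_of_maps_to (t := Finset.range (m + 1))
      (g := fun q : ℕ × ℕ => q.1 + q.2)
      (fun q hq => Finset.mem_range_succ_iff.2 (Finset.mem_filter.1 hq).2)]
    refine Finset.sum_congr rfl fun k hk => ?_
    have hk' : k ≤ m := Finset.mem_range_succ_iff.1 hk
    have h2 : (A.filter fun q => q.1 + q.2 = k) = Finset.HasAntidiagonal.antidiagonal k := by
      ext q
      simp only [hA, Finset.mem_filter, Finset.mem_product, Finset.mem_range,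
        Finset.HasAntidiagonal.mem_antidiagonal]
      omega
    rw [h2, ← b_conv, Finset.sum_mul]
    refine Finset.sum_congr rfl fun q hq => ?_
    rw [Finset.HasAntidiagonal.mem_antidiagonal] at hq
    have h3 : ((m - k : ℕ) : ℂ) = m - q.1 - q.2 := by
      rw [Nat.cast_sub hk', ← hq]
      push_cast
      ring
    rw [hf, ← exp_nat_mul, h3]
  have h2 : sqrtP m a t ^ 2 =
      ∑ q ∈ A.filter (fun q => q.1 ≤ m / 2 ∧ q.2 ≤ m / 2), f q := by
    have h3 : A.filter (fun q => q.1 ≤ m / 2 ∧ q.2 ≤ m / 2) =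
        Finset.range (m / 2 + 1) ×ˢ Finset.range (m / 2 + 1) := by
      ext q
      simp only [hA, Finset.mem_filter, Finset.mem_product, Finset.mem_range]
      omega
    rw [h3, sq, sqrtP, Finset.sum_mul_sum, Finset.sum_product]
    refine Finset.sum_congr rfl fun i _ => Finset.sum_congr rfl fun l _ => ?_
    have h4 : ((m : ℂ) - i - l) * t = (m / 2 - i) * t + (m / 2 - l) * t := by ring
    simp only [hf]
    rw [h4, exp_add]
    ring
  rw [h1, h2, tailIndex, Finset.sum_filter_add_sum_filter_not]

/-! ### The formal solution -/

/-- `sqrtP` divided by `x ^ (m/2)`. -/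
noncomputable def sqrtPol (m : ℕ) : Polynomial (MvPolynomial (Fin m) ℂ) :=
  ∑ k ∈ Finset.range (m / 2 + 1), Polynomial.C (bPoly m k) * Polynomial.X ^ (stepDen m * k)

/-- The coefficient of the derivative in the equation for the formal series, divided by
`x ^ (m/2)`. -/
noncomputable def coeffOne (m : ℕ) : Polynomial (MvPolynomial (Fin m) ℂ) :=
  Polynomial.C (MvPolynomial.C (2 * nu m - 1)) * Polynomial.X ^ halfDeg m - 2 * sqrtPol m

/-- The coefficient of order zero in the equation for the formal series, divided by
`x ^ (m/2)`. -/
noncomputable def coeffZero (m : ℕ) : Polynomial (MvPolynomial (Fin m) ℂ) :=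
  Polynomial.C (MvPolynomial.C (nu m ^ 2 - nu m)) * Polynomial.X ^ halfDeg m +
    ∑ k ∈ Finset.range (m / 2 + 1), Polynomial.C (MvPolynomial.C (k : ℂ) * bPoly m k) *
      Polynomial.X ^ (stepDen m * k) -
    ∑ q ∈ tailIndex m, Polynomial.C (bPoly m q.1 * bPoly m q.2) *
      Polynomial.X ^ (stepDen m * (q.1 + q.2) - halfDeg m)

theorem sqrtP_eq (m : ℕ) (a : Fin m → ℂ) (t : ℂ) :
    sqrtP m a t = zeta m t * ev a (xi m t) (sqrtPol m) := by
  rw [sqrtP, sqrtPol, map_sum, Finset.mul_sum]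
  refine Finset.sum_congr rfl fun k _ => ?_
  rw [map_mul, map_pow, ev_C, ev_X, eval_bPoly, ← zeta_mul_xi_pow_stepDen]
  ring

theorem coeffOne_spec (m : ℕ) (a : Fin m → ℂ) (t : ℂ) :
    2 * (nu m - sqrtP m a t) - 1 = zeta m t * ev a (xi m t) (coeffOne m) := by
  rw [coeffOne, map_sub, map_mul, map_mul, map_pow, ev_C, ev_X, MvPolynomial.eval_C, map_ofNat,
    sqrtP_eq]
  linear_combination (-(2 * nu m - 1)) * zeta_mul_xi_pow m t

theorem hasDerivAt_sqrtP (m : ℕ) (a : Fin m → ℂ) (t : ℂ) :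
    HasDerivAt (sqrtP m a)
      (m / 2 * sqrtP m a t -
        ∑ k ∈ Finset.range (m / 2 + 1), k * b m a k * exp ((m / 2 - k) * t)) t := by
  have h1 : HasDerivAt (sqrtP m a) (∑ k ∈ Finset.range (m / 2 + 1),
      b m a k * (exp (((m : ℂ) / 2 - k) * t) * ((m : ℂ) / 2 - k))) t :=
    HasDerivAt.fun_sum fun k _ => by
      refine ((((hasDerivAt_id t).const_mul ((m : ℂ) / 2 - k)).cexp).const_mul
        (b m a k)).congr_deriv ?_
      simp only [id]
      ring
  refine h1.congr_deriv ?_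
  rw [sqrtP, Finset.mul_sum, ← Finset.sum_sub_distrib]
  exact Finset.sum_congr rfl fun k _ => by ring

theorem coeffZero_spec (m : ℕ) (a : Fin m → ℂ) (t : ℂ) :
    (nu m - sqrtP m a t) ^ 2 - deriv (sqrtP m a) t - (nu m - sqrtP m a t) - P m a (exp t) =
      zeta m t * ev a (xi m t) (coeffZero m) := by
  rw [(hasDerivAt_sqrtP m a t).deriv, P_eq_sqrtP_sq, coeffZero, map_sub, map_add, map_sum, map_sum,
    map_mul, map_pow, ev_C, ev_X, MvPolynomial.eval_C]
  have h1 : ∑ k ∈ Finset.range (m / 2 + 1), (k : ℂ) * b m a k * exp ((m / 2 - k) * t) =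
      zeta m t * ∑ k ∈ Finset.range (m / 2 + 1), ev a (xi m t)
        (Polynomial.C (MvPolynomial.C (k : ℂ) * bPoly m k) * Polynomial.X ^ (stepDen m * k)) := by
    rw [Finset.mul_sum]
    refine Finset.sum_congr rfl fun k _ => ?_
    rw [map_mul, map_pow, ev_C, ev_X, map_mul, MvPolynomial.eval_C, eval_bPoly,
      ← zeta_mul_xi_pow_stepDen]
    ring
  have h2 : ∑ q ∈ tailIndex m, b m a q.1 * b m a q.2 * exp ((m - q.1 - q.2) * t) =
      zeta m t * ∑ q ∈ tailIndex m, ev a (xi m t) (Polynomial.C (bPoly m q.1 * bPoly m q.2) *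
        Polynomial.X ^ (stepDen m * (q.1 + q.2) - halfDeg m)) := by
    rw [Finset.mul_sum]
    refine Finset.sum_congr rfl fun q hq => ?_
    rw [map_mul, map_pow, ev_C, ev_X, map_mul, eval_bPoly, eval_bPoly]
    have h3 : halfDeg m ≤ stepDen m * (q.1 + q.2) := by
      refine (halfDeg_lt ?_).le
      simp only [tailIndex, Finset.mem_filter] at hq
      omega
    have h4 := pow_sub_mul_pow (xi m t) h3
    have h5 : exp ((m - q.1 - q.2) * t) = zeta m t * (zeta m t *
        xi m t ^ (stepDen m * (q.1 + q.2))) := by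
      rw [zeta_mul_xi_pow_stepDen, zeta, ← exp_add]
      congr 1
      push_cast
      ring
    rw [h5, ← h4]
    linear_combination b m a q.1 * b m a q.2 * zeta m t *
      xi m t ^ (stepDen m * (q.1 + q.2) - halfDeg m) * zeta_mul_xi_pow m t
  rw [h1, h2]
  -- With this value of ν the terms linear in `sqrtP` cancel: it is the exponent of the WKB
  -- amplitude.
  have h3 : (m : ℂ) / 2 = 1 - 2 * nu m := by unfold nu; ring
  rw [h3]
  linear_combination (-(nu m ^ 2 - nu m)) * zeta_mul_xi_pow m t

theorem coeff_zero_sqrtPol (m : ℕ) : (sqrtPol m).coeff 0 = 1 := by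
  rw [sqrtPol, Polynomial.finsetSum_coeff, Finset.sum_range_succ', Finset.sum_eq_zero]
  · simp [bPoly]
  · intro k _
    rw [Polynomial.coeff_C_mul_X_pow, if_neg]
    have := stepDen_pos m
    positivity

theorem coeff_zero_coeffOne {m : ℕ} (hm : 1 ≤ m) : (coeffOne m).coeff 0 = -2 := by
  have h := (halfDeg_pos hm).ne
  rw [coeffOne, Polynomial.coeff_sub, Polynomial.coeff_C_mul_X_pow, if_neg h, two_mul,
    Polynomial.coeff_add, coeff_zero_sqrtPol]
  norm_num

theorem coeff_zero_coeffZero {m : ℕ} (hm : 1 ≤ m) : (coeffZero m).coeff 0 = 0 := by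
  have h := (halfDeg_pos hm).ne
  rw [coeffZero, Polynomial.coeff_sub, Polynomial.coeff_add, Polynomial.coeff_C_mul_X_pow, if_neg h,
    Polynomial.finsetSum_coeff, Polynomial.finsetSum_coeff, Finset.sum_eq_zero, Finset.sum_eq_zero]
  · simp
  · intro q hq
    rw [Polynomial.coeff_C_mul_X_pow, if_neg]
    have h3 : halfDeg m < stepDen m * (q.1 + q.2) := by
      refine halfDeg_lt ?_
      simp only [tailIndex, Finset.mem_filter] at hq
      omega
    omega
  · intro k _
    rw [Polynomial.coeff_C_mul_X_pow]
    rcases k with _ | k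
    · simp
    · rw [if_neg]
      have := stepDen_pos m
      positivity

/-- The action of the equation for the formal series on the monomial `ξ ^ n`, divided by
`x ^ (m/2) ξ ^ n`. -/
noncomputable def monomialOp (m n : ℕ) : Polynomial (MvPolynomial (Fin m) ℂ) :=
  Polynomial.C (MvPolynomial.C ((n * stepExp m : ℂ) ^ 2)) * Polynomial.X ^ halfDeg m -
    Polynomial.C (MvPolynomial.C (n * stepExp m : ℂ)) * coeffOne m + coeffZero m

/-- This constant term is the divisor in the recursion for the formal series, and it is nonzero for
n ≥ 1. -/
theorem coeff_zero_monomialOp {m : ℕ} (hm : 1 ≤ m) (n : ℕ) :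
    (monomialOp m n).coeff 0 = MvPolynomial.C (2 * (n * stepExp m) : ℂ) := by
  rw [monomialOp, Polynomial.coeff_add, Polynomial.coeff_sub, Polynomial.coeff_C_mul_X_pow,
    if_neg (halfDeg_pos hm).ne, Polynomial.coeff_C_mul, coeff_zero_coeffOne hm,
    coeff_zero_coeffZero hm, MvPolynomial.C_mul (a := 2), map_ofNat]
  ring

/-- The coefficients of the formal series `φ_0`. -/
noncomputable def formalCoeff (m : ℕ) (k : ℕ) : MvPolynomial (Fin m) ℂ :=
  if k = 0 then 1 else -(MvPolynomial.C (1 / (2 * (k * stepExp m)) : ℂ) *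
    ∑ n : Fin k, formalCoeff m n * (monomialOp m n).coeff (k - n))
termination_by k
decreasing_by exact n.2

theorem formalCoeff_zero (m : ℕ) : formalCoeff m 0 = 1 := by
  rw [formalCoeff, if_pos rfl]

theorem formalCoeff_conv {m : ℕ} (hm : 1 ≤ m) (k : ℕ) :
    ∑ n ∈ Finset.range (k + 1), formalCoeff m n * (monomialOp m n).coeff (k - n) = 0 := by
  rw [Finset.sum_range_succ, Nat.sub_self, coeff_zero_monomialOp hm]
  rcases eq_or_ne k 0 with rfl | hk
  · simp
  · conv_lhs => rw [formalCoeff, if_neg hk]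
    rw [Finset.sum_range]
    have h1 : MvPolynomial.C (σ := Fin m) (1 / (2 * (k * stepExp m)) : ℂ) *
        MvPolynomial.C (2 * (k * stepExp m) : ℂ) = 1 := by
      rw [← MvPolynomial.C_mul, one_div_mul_cancel, MvPolynomial.C_1]
      have h2 : (stepExp m : ℂ) ≠ 0 := ofReal_ne_zero.2 (stepExp_pos m).ne'
      have h3 : (k : ℂ) ≠ 0 := Nat.cast_ne_zero.2 hk
      exact mul_ne_zero two_ne_zero (mul_ne_zero h3 h2)
    linear_combination (-∑ i : Fin k, formalCoeff m i * (monomialOp m i).coeff (k - i)) * h1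

/-- The truncated formal series. -/
noncomputable def formalPol (m N : ℕ) : Polynomial (MvPolynomial (Fin m) ℂ) :=
  ∑ n ∈ Finset.range N, Polynomial.C (formalCoeff m n) * Polynomial.X ^ n

/-- The residual of the truncated formal series, divided by `x ^ (m/2)`. -/
noncomputable def residualPol (m N : ℕ) : Polynomial (MvPolynomial (Fin m) ℂ) :=
  ∑ n ∈ Finset.range N, Polynomial.C (formalCoeff m n) * (monomialOp m n * Polynomial.X ^ n)

/-- In degrees below N the truncation removes nothing, and the coefficients are the convolutions
that the recursion sets to zero. -/
theorem X_pow_dvd_residualPol {m : ℕ} (hm : 1 ≤ m) (N : ℕ) :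
    Polynomial.X ^ N ∣ residualPol m N := by
  rw [Polynomial.X_pow_dvd_iff]
  intro k hk
  rw [residualPol, Polynomial.finsetSum_coeff, ← formalCoeff_conv hm k]
  symm
  have h1 : ∑ n ∈ Finset.range N, (Polynomial.C (formalCoeff m n) *
      (monomialOp m n * Polynomial.X ^ n)).coeff k =
      ∑ n ∈ Finset.range N, if n ≤ k then
        formalCoeff m n * (monomialOp m n).coeff (k - n) else 0 :=
    Finset.sum_congr rfl fun n _ => by
      rw [Polynomial.coeff_C_mul, Polynomial.coeff_mul_X_pow']
      split_ifs <;> simp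
  rw [h1, ← Finset.sum_filter]
  refine Finset.sum_congr ?_ fun _ _ => rfl
  ext n
  simp only [Finset.mem_filter, Finset.mem_range]
  omega

/-- The approximate solution obtained by truncating the formal solution. -/
noncomputable def approx (m N : ℕ) (a : Fin m → ℂ) (t : ℂ) : ℂ :=
  leading m a t * ev a (xi m t) (formalPol m N)

theorem ev_formalPol (m N : ℕ) (a : Fin m → ℂ) (ξ : ℂ) :
    ev a ξ (formalPol m N) =
      ∑ n ∈ Finset.range N, MvPolynomial.eval a (formalCoeff m n) * ξ ^ n := by
  rw [formalPol, map_sum]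
  exact Finset.sum_congr rfl fun n _ => by rw [map_mul, map_pow, ev_C, ev_X]

/-- With E = ν - `sqrtP` the logarithmic derivative of `leading`, the operator applied to `leading`
· φ is `leading` times φ'' + (2E - 1) φ' + (E² + E' - E - P) φ. The two coefficients are `coeffOne`
and `coeffZero`, multiplied by x^{m/2}. -/
theorem approx_residual {m : ℕ} (hm : 1 ≤ m) (N : ℕ) (a : Fin m → ℂ) (t : ℂ) :
    Differentiable ℂ (approx m N a) ∧
    deriv (deriv (approx m N a)) t - deriv (approx m N a) t - P m a (exp t) * approx m N a t =
      leading m a t * (zeta m t * ev a (xi m t) (residualPol m N)) := by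
  set c : ℕ → ℂ := fun n => MvPolynomial.eval a (formalCoeff m n) with hc
  set h : ℂ := (stepExp m : ℂ) with hh
  set φ : ℂ → ℂ := fun t => ∑ n ∈ Finset.range N, c n * xi m t ^ n with hφ
  set φ₁ : ℂ → ℂ := fun t => ∑ n ∈ Finset.range N, -(n * h) * c n * xi m t ^ n with hφ₁
  set φ₂ : ℂ → ℂ := fun t => ∑ n ∈ Finset.range N, (n * h) ^ 2 * c n * xi m t ^ n with hφ₂
  have hd1 : ∀ t, HasDerivAt φ (φ₁ t) t := fun t =>
    (HasDerivAt.fun_sum fun n _ => (hasDerivAt_xi_pow m n t).const_mul (c n)).congr_deriv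
      (Finset.sum_congr rfl fun n _ => by ring)
  have hd2 : ∀ t, HasDerivAt φ₁ (φ₂ t) t := fun t =>
    (HasDerivAt.fun_sum fun n _ => (hasDerivAt_xi_pow m n t).const_mul (-(n * h) * c n)).congr_deriv
      (Finset.sum_congr rfl fun n _ => by ring)
  have hY : ∀ t, HasDerivAt (sqrtP m a) (deriv (sqrtP m a) t) t := fun t =>
    (hasDerivAt_sqrtP m a t).differentiableAt.hasDerivAt
  have hL := hasDerivAt_leading hm a
  have heq : approx m N a = fun t => leading m a t * φ t :=
    funext fun t => by rw [approx, ev_formalPol]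
  have hΛ : ∀ t, HasDerivAt (approx m N a)
      (leading m a t * ((nu m - sqrtP m a t) * φ t + φ₁ t)) t := fun t => by
    rw [heq]
    refine ((hL t).mul (hd1 t)).congr_deriv ?_
    ring
  have hΛ' : ∀ t, HasDerivAt (fun t => leading m a t * ((nu m - sqrtP m a t) * φ t + φ₁ t))
      (leading m a t * (((nu m - sqrtP m a t) ^ 2 - deriv (sqrtP m a) t) * φ t +
        2 * (nu m - sqrtP m a t) * φ₁ t + φ₂ t)) t := fun t => by
    refine ((hL t).mul ((((hY t).const_sub (nu m)).mul (hd1 t)).add (hd2 t))).congr_deriv ?_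
    simp only [Pi.add_apply, Pi.mul_apply]
    ring
  refine ⟨fun t => (hΛ t).differentiableAt, ?_⟩
  rw [funext fun t => (hΛ t).deriv, (hΛ' t).deriv, heq]
  have h1 : zeta m t * ev a (xi m t) (residualPol m N) =
      φ₂ t + zeta m t * ev a (xi m t) (coeffOne m) * φ₁ t +
        zeta m t * ev a (xi m t) (coeffZero m) * φ t := by
    simp only [residualPol, map_sum, hφ, hφ₁, hφ₂, Finset.mul_sum]
    rw [← Finset.sum_add_distrib, ← Finset.sum_add_distrib]
    refine Finset.sum_congr rfl fun n _ => ?_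
    simp only [monomialOp, map_mul, map_pow, map_add, map_sub, ev_C, ev_X, MvPolynomial.eval_C,
      ← hh]
    linear_combination c n * (n * h) ^ 2 * xi m t ^ n * zeta_mul_xi_pow m t
  rw [h1, ← coeffOne_spec, ← coeffZero_spec]
  ring

/-! ### Wronskians at the origin -/

/-- The exponential covers the dense set of nonzero points; continuity then gives the value at the
origin, which is out of reach on the covering. -/
theorem const_of_exp {Ψ : ℂ → ℂ} (hΨ : Continuous Ψ) {c : ℂ} (h : ∀ t, Ψ (exp t) = c) (x : ℂ) :
    Ψ x = c := by
  have h1 := hΨ.ext_on (dense_compl_singleton (0 : ℂ)) (continuous_const (y := c)) fun y hy => by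
    rw [← exp_log (show y ≠ 0 from hy)]
    exact h _
  exact congrFun h1 x

theorem hasDerivAt_exp_mul_comp_exp {g : ℂ → ℂ} (hg : Differentiable ℂ g) (σ t : ℂ) :
    HasDerivAt (fun t => exp (σ * t) * g (exp t))
      (exp (σ * t) * (σ * g (exp t) + exp t * deriv g (exp t))) t := by
  refine ((((hasDerivAt_id t).const_mul σ).cexp).mul
    ((hg (exp t)).hasDerivAt.comp t (hasDerivAt_exp t))).congr_deriv ?_
  simp only [id, Function.comp_apply]
  ring

theorem wr_exp {g h : ℂ → ℂ} (hg : Differentiable ℂ g) (hh : Differentiable ℂ h) (σ σ' t : ℂ) :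
    wr (fun t => exp (σ * t) * g (exp t)) (fun t => exp (σ' * t) * h (exp t)) t =
      exp ((σ + σ' - 1) * t) * ((σ' - σ) * g (exp t) * h (exp t) +
        exp t * (g (exp t) * deriv h (exp t) - deriv g (exp t) * h (exp t))) := by
  rw [wr, (hasDerivAt_exp_mul_comp_exp hg σ t).deriv, (hasDerivAt_exp_mul_comp_exp hh σ' t).deriv]
  have h1 : exp ((σ + σ' - 1) * t) = exp (-t) * exp (σ * t) * exp (σ' * t) := by
    rw [← exp_add, ← exp_add]
    congr 1
    ring
  rw [h1]
  ring

/-- The logarithms cancel in the Wronskian, which becomes a constant function of x with a continuous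
formula at 0. Evaluating at x = 0 leaves only the leading coefficients. -/
theorem IsFrobeniusPair.wr_eq {m : ℕ} {a' : Fin (m - 1) → ℂ} {p : ℂ}
    (hp : ∀ n : ℕ, p ≠ -((n : ℂ) + 1)) {f : (ℂ → ℂ) × (ℂ → ℂ)} (hf : IsFrobeniusPair m a' p f)
    (t : ℂ) : wr f.1 f.2 t = if p = 0 then 1 else -p := by
  obtain ⟨hs1, hs2, μ, g₁, g₂, hg₁, hg₂, hg0, hf1, hf2, hnon, hpos, hzero⟩ := hf
  have h1 : f.1 = fun t => exp (s p * t) * g₁ (exp t) := funext hf1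
  have hv : Differentiable ℂ fun t => exp (s (-p) * t) * g₂ (exp t) :=
    fun t => (hasDerivAt_exp_mul_comp_exp hg₂ _ t).differentiableAt
  have key : ∀ t, wr f.1 f.2 t = μ * (exp (p * t) * g₁ (exp t) ^ 2) + (-p * g₁ (exp t) *
      g₂ (exp t) + exp t * (g₁ (exp t) * deriv g₂ (exp t) - deriv g₁ (exp t) * g₂ (exp t))) := by
    intro t
    have h2 : deriv f.2 t = μ * (deriv f.1 t * t + f.1 t) +
        deriv (fun t => exp (s (-p) * t) * g₂ (exp t)) t := by
      rw [funext hf2]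
      refine (((((hs1.1 t).hasDerivAt.const_mul μ).mul (hasDerivAt_id t))).add
        (hv t).hasDerivAt).deriv.trans ?_
      simp only [id]
      ring
    have h3 : wr f.1 f.2 t = μ * (exp (-t) * f.1 t ^ 2) +
        wr f.1 (fun t => exp (s (-p) * t) * g₂ (exp t)) t := by
      rw [wr, wr, h2, hf2]
      ring
    have h4 : exp (-t) * f.1 t ^ 2 = exp (p * t) * g₁ (exp t) ^ 2 := by
      have : exp (p * t) = exp (-t) * exp (s p * t) * exp (s p * t) := by
        rw [← exp_add, ← exp_add]
        congr 1
        unfold s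
        ring
      rw [hf1, this]
      ring
    have h5 : s p + s (-p) - 1 = 0 := by unfold s; ring
    have h6 : s (-p) - s p = -p := by unfold s; ring
    rw [h3, h4, h1, wr_exp hg₁ hg₂, h5, h6, zero_mul, exp_zero, one_mul]
  have hc : Continuous fun x => -p * g₁ x * g₂ x + x * (g₁ x * deriv g₂ x - deriv g₁ x * g₂ x) := by
    have := hg₁.continuous
    have := hg₂.continuous
    have := hg₁.deriv.continuous
    have := hg₂.deriv.continuous
    fun_prop
  by_cases hZ : ∃ n : ℕ, p = n
  · obtain ⟨n, rfl⟩ := hZ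
    have hc' : Continuous fun x => μ * (x ^ n * g₁ x ^ 2) + (-(n : ℂ) * g₁ x * g₂ x +
        x * (g₁ x * deriv g₂ x - deriv g₁ x * g₂ x)) := by
      have := hg₁.continuous
      exact (by fun_prop : Continuous fun x => μ * (x ^ n * g₁ x ^ 2)).add hc
    have h7 := const_of_exp hc' (c := wr f.1 f.2 t) (fun t' => by
      rw [← exp_nat_mul, ← key, wr_const hs1 hs2]) 0
    rw [← h7]
    rcases Nat.eq_zero_or_pos n with rfl | hn
    · obtain ⟨hμ, h8⟩ := hzero (by simp)
      simp [hμ, h8, hg0]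
    · rw [if_neg (Nat.cast_ne_zero.2 hn.ne'), zero_pow hn.ne', hg0, (hpos n hn rfl).1]
      ring
  · have hZ' : ∀ n : ℤ, p ≠ n := by
      rintro n rfl
      rcases Int.eq_nat_or_neg n with ⟨k, rfl | rfl⟩
      · exact hZ ⟨k, by simp⟩
      · rcases k with _ | k
        · exact hZ ⟨0, by simp⟩
        · exact hp k (by push_cast; ring)
    obtain ⟨hμ, h8⟩ := hnon hZ'
    have h7 := const_of_exp hc (c := wr f.1 f.2 t) (fun t' => by
      rw [wr_const hs1 hs2 t t', key, hμ, zero_mul, zero_add]) 0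
    rw [← h7, if_neg (fun h => hZ ⟨0, by simpa using h⟩), hg0, h8]
    ring

theorem IsFrobeniusPair.wr_ne_zero {m : ℕ} {a' : Fin (m - 1) → ℂ} {p : ℂ}
    (hp : ∀ n : ℕ, p ≠ -((n : ℂ) + 1)) {f : (ℂ → ℂ) × (ℂ → ℂ)} (hf : IsFrobeniusPair m a' p f)
    (t : ℂ) : wr f.1 f.2 t ≠ 0 := by
  rw [hf.wr_eq hp]
  split_ifs with h
  · exact one_ne_zero
  · exact neg_ne_zero.2 h

/-! ### A global basis of solutions for every parameter -/

theorem ofPrime_eq {m : ℕ} (a : Fin m → ℂ) {p : ℂ}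
    (hp : ∀ h : m - 1 < m, p ^ 2 = 1 + 4 * a ⟨m - 1, h⟩) :
    a = ofPrime m (fun i => a ⟨i, by omega⟩) p := by
  funext i
  unfold ofPrime
  split_ifs with h
  · rfl
  · have h1 : i = ⟨m - 1, by omega⟩ := Fin.ext (by simp only; omega)
    have h2 := hp (by omega)
    rw [← h1] at h2
    rw [h2]
    ring

/-- One of the two determinations of a square root is not a negative integer. -/
theorem exists_sign (p : ℂ) : ∃ q : ℂ, (q = p ∨ q = -p) ∧ ∀ n : ℕ, q ≠ -((n : ℂ) + 1) := by
  by_cases h : ∀ n : ℕ, p ≠ -((n : ℂ) + 1)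
  · exact ⟨p, Or.inl rfl, h⟩
  · push Not at h
    obtain ⟨k, hk⟩ := h
    refine ⟨-p, Or.inr rfl, fun n hn => ?_⟩
    have h1 : ((k + n + 2 : ℕ) : ℂ) = 0 := by
      push_cast
      linear_combination hk + hn
    exact Nat.cast_ne_zero.2 (by omega) h1

theorem exists_ofPrime {m : ℕ} (a : Fin m → ℂ) :
    ∃ (a' : Fin (m - 1) → ℂ) (p : ℂ), (∀ n : ℕ, p ≠ -((n : ℂ) + 1)) ∧ a = ofPrime m a' p := by
  have h0 : ∃ p : ℂ, ∀ h : m - 1 < m, p ^ 2 = 1 + 4 * a ⟨m - 1, h⟩ := by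
    by_cases h : m - 1 < m
    · obtain ⟨p, hp⟩ := IsAlgClosed.exists_pow_nat_eq (1 + 4 * a ⟨m - 1, h⟩) two_pos
      exact ⟨p, fun _ => hp⟩
    · exact ⟨0, fun h' => absurd h' h⟩
  obtain ⟨p, hp⟩ := h0
  obtain ⟨q, hq, hqn⟩ := exists_sign p
  have hq2 : q ^ 2 = p ^ 2 := by rcases hq with rfl | rfl <;> ring
  exact ⟨_, q, hqn, ofPrime_eq a fun h => hq2.trans (hp h)⟩

/-- This stands in for the existence and uniqueness theorem for linear equations: solutions on the
whole covering are produced, and others identified, by means of this basis. -/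
theorem exists_basis {m : ℕ} (hm : 1 ≤ m) (a : Fin m → ℂ) :
    ∃ f g, IsSolution m a f ∧ IsSolution m a g ∧ wr f g 0 ≠ 0 := by
  obtain ⟨a', p, hp, rfl⟩ := exists_ofPrime a
  obtain ⟨f, hf⟩ := exists_isFrobeniusPair hm a' hp
  exact ⟨f.1, f.2, hf.1, hf.2.1, hf.wr_ne_zero hp 0⟩

theorem IsSolution.eq_mul {m : ℕ} (hm : 1 ≤ m) {a : Fin m → ℂ} {u v : ℂ → ℂ}
    (hu : IsSolution m a u) (hv : IsSolution m a v) {t₁ : ℂ} (h : wr u v t₁ = 0) {t₀ : ℂ}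
    (ht₀ : v t₀ ≠ 0) (t : ℂ) : u t = u t₀ / v t₀ * v t := by
  obtain ⟨f, g, hf, hg, hfg⟩ := exists_basis hm a
  exact hu.eq_mul_of_wr_eq_zero hv hf hg hfg (wr_const hu hv 0 t₁ ▸ h) ht₀ t

/-- Uniqueness of the normalized solution with exponent `s p` at the origin. -/
theorem eq_of_exponent {m : ℕ} (hm : 1 ≤ m) {a : Fin m → ℂ} {p : ℂ}
    (hp : ∀ n : ℕ, p ≠ -((n : ℂ) + 1)) {g h : ℂ → ℂ} (hg : Differentiable ℂ g)
    (hh : Differentiable ℂ h) (hg0 : g 0 = 1) (hh0 : h 0 = 1)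
    (hu : IsSolution m a fun t => exp (s p * t) * g (exp t))
    (hv : IsSolution m a fun t => exp (s p * t) * h (exp t)) : g = h := by
  set Ψ : ℂ → ℂ := fun x => x * (g x * deriv h x - deriv g x * h x) with hΨ
  have hc : Continuous Ψ := by
    have := hg.continuous
    have := hh.continuous
    have := hg.deriv.continuous
    have := hh.deriv.continuous
    fun_prop
  have key : ∀ t, wr (fun t => exp (s p * t) * g (exp t)) (fun t => exp (s p * t) * h (exp t)) t =
      exp (p * t) * Ψ (exp t) := fun t => by
    have h1 : s p + s p - 1 = p := by unfold s; ring
    rw [wr_exp hg hh, h1, sub_self, zero_mul, zero_mul, zero_add]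
  have hw : wr (fun t => exp (s p * t) * g (exp t)) (fun t => exp (s p * t) * h (exp t)) 0 = 0 := by
    -- The Wronskian is x^p Ψ(x) with Ψ(0) = 0. If p is a natural number, its value at x = 0 is 0.
    -- If p is not an integer, a turn around the origin multiplies it by e^{2πip} ≠ 1, although it
    -- is constant.
    by_cases hZ : ∃ n : ℤ, p = n
    · obtain ⟨n, rfl⟩ : ∃ n : ℕ, p = n := by
        obtain ⟨n, rfl⟩ := hZ
        rcases Int.eq_nat_or_neg n with ⟨k, rfl | rfl⟩
        · exact ⟨k, by simp⟩
        · rcases k with _ | k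
          · exact ⟨0, by simp⟩
          · exact absurd (by push_cast; ring) (hp k)
      have h7 := const_of_exp (Ψ := fun x => x ^ n * Ψ x) (by fun_prop) (fun t' => by
        rw [← exp_nat_mul, ← key, wr_const hu hv t' 0]) 0
      rw [← h7]
      simp [hΨ]
    · have h1 := wr_const hu hv (2 * π * I) 0
      rw [key, exp_two_pi_mul_I] at h1
      rw [key] at h1 ⊢
      rw [mul_zero, exp_zero, one_mul] at h1 ⊢
      have h2 : exp (p * (2 * π * I)) ≠ 1 := fun h => hZ <| by
        obtain ⟨n, hn⟩ := exp_eq_one_iff.1 h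
        exact ⟨n, mul_right_cancel₀ two_pi_I_ne_zero hn⟩
      have h3 : (exp (p * (2 * π * I)) - 1) * Ψ 1 = 0 := by linear_combination h1
      exact (mul_eq_zero.1 h3).resolve_left (sub_ne_zero.2 h2)
  obtain ⟨t₀, ht₀⟩ : ∃ t₀, h (exp t₀) ≠ 0 := by
    by_contra hcon
    push Not at hcon
    have := const_of_exp hh.continuous hcon 0
    rw [hh0] at this
    exact one_ne_zero this
  have h1 := hu.eq_mul hm hv hw (t₀ := t₀) (mul_ne_zero (exp_ne_zero _) ht₀)
  set c := exp (s p * t₀) * g (exp t₀) / (exp (s p * t₀) * h (exp t₀)) with hc_def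
  have h2 : ∀ t, g (exp t) - c * h (exp t) = 0 := fun t => by
    have h3 := h1 t
    have h4 : exp (s p * t) * (g (exp t) - c * h (exp t)) = 0 := by linear_combination h3
    exact (mul_eq_zero.1 h4).resolve_left (exp_ne_zero _)
  have h5 := const_of_exp (Ψ := fun x => g x - c * h x)
    (hg.continuous.sub (continuous_const.mul hh.continuous)) h2
  have h6 : c = 1 := by
    have := h5 0
    simp only [hg0, hh0] at this
    linear_combination -this
  funext x
  have := h5 x
  simp only [h6] at this
  linear_combination this

/-! ### Solutions with prescribed asymptotics in a cone -/

theorem exists_ev_sub_bound {m : ℕ} (q : Polynomial (MvPolynomial (Fin m) ℂ))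
    {K : Set (Fin m → ℂ)} (hK : IsCompact K) : ∃ C : ℝ, 0 ≤ C ∧ ∀ a ∈ K, ∀ ξ : ℂ, ‖ξ‖ ≤ 1 →
      ‖ev a ξ q - MvPolynomial.eval a (q.coeff 0)‖ ≤ C * ‖ξ‖ := by
  obtain ⟨C, hC0, hC⟩ := exists_ev_bound q.divX hK
  refine ⟨C, hC0, fun a ha ξ hξ => ?_⟩
  have h1 : ev a ξ q = ev a ξ q.divX * ξ + MvPolynomial.eval a (q.coeff 0) := by
    conv_lhs => rw [← Polynomial.divX_mul_X_add q, map_add, map_mul, ev_X, ev_C]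
  rw [h1, add_sub_cancel_right, norm_mul]
  exact mul_le_mul_of_nonneg_right (hC a ha ξ hξ) (norm_nonneg _)

theorem norm_le_of_logDeriv_nonpos {f w : ℝ → ℂ} (hf : ∀ s, 0 ≤ s → HasDerivAt f (f s * w s) s)
    (hw : ∀ s, 0 ≤ s → (w s).re ≤ 0) {s : ℝ} (hs : 0 ≤ s) : ‖f s‖ ≤ ‖f 0‖ := by
  have hd : ∀ s, 0 ≤ s → HasDerivAt (fun s => ‖f s‖ ^ 2) (2 * (‖f s‖ ^ 2 * (w s).re)) s := by
    intro s hs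
    refine (hf s hs).norm_sq.congr_deriv ?_
    rw [Complex.inner, mul_right_comm, mul_conj, re_ofReal_mul, normSq_eq_norm_sq]
  have h1 : AntitoneOn (fun s => ‖f s‖ ^ 2) (Set.Ici 0) := by
    refine antitoneOn_of_deriv_nonpos (convex_Ici 0)
      (fun s hs => (hd s hs).continuousAt.continuousWithinAt)
      (fun s hs => (hd s (interior_subset hs)).differentiableAt.differentiableWithinAt)
      fun s hs => ?_
    rw [(hd s (interior_subset hs)).deriv]
    have := mul_nonpos_of_nonneg_of_nonpos (sq_nonneg ‖f s‖) (hw s (interior_subset hs))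
    linarith
  have h2 := h1 (Set.self_mem_Ici) (Set.mem_Ici.2 hs) hs
  exact le_of_sq_le_sq h2 (norm_nonneg _)

/-- The coordinate `t` as a function of `z = x ^ (m/2) e ^ (-iψ)`. -/
noncomputable def tau (m : ℕ) (ψ : ℝ) (z : ℂ) : ℂ := 2 / m * (log z + ψ * I)

theorem hasDerivAt_tau (m : ℕ) (ψ : ℝ) {z : ℂ} (hz : z ∈ slitPlane) :
    HasDerivAt (tau m ψ) (2 / (m * z)) z := by
  refine (((hasDerivAt_log hz).add_const (ψ * I)).const_mul (2 / (m : ℂ))).congr_deriv ?_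
  rw [← div_eq_mul_inv, div_div]

theorem zeta_tau {m : ℕ} (hm : 1 ≤ m) (ψ : ℝ) {z : ℂ} (hz : z ≠ 0) :
    zeta m (tau m ψ z) = z * exp (ψ * I) := by
  have hm0 : (m : ℂ) ≠ 0 := Nat.cast_ne_zero.2 (by omega)
  have h1 : (m : ℂ) / 2 * (2 / m * (log z + ψ * I)) = log z + ψ * I := by field_simp
  rw [zeta, tau, h1, exp_add, exp_log hz]

theorem norm_mul_norm_xi_tau_pow {m : ℕ} (hm : 1 ≤ m) (ψ : ℝ) {z : ℂ} (hz : z ≠ 0) :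
    ‖z‖ * ‖xi m (tau m ψ z)‖ ^ halfDeg m = 1 := by
  have h := congrArg norm (zeta_mul_xi_pow m (tau m ψ z))
  rwa [norm_mul, norm_pow, zeta_tau hm ψ hz, norm_mul, norm_exp_ofReal_mul_I, mul_one, norm_one]
    at h

theorem norm_xi_tau_pow {m : ℕ} (hm : 1 ≤ m) (ψ : ℝ) {z : ℂ} (hz : z ≠ 0) (j : ℕ) :
    ‖xi m (tau m ψ z)‖ ^ (halfDeg m * j) = (‖z‖ ^ j)⁻¹ := by
  rw [pow_mul, ← inv_pow]
  congr 1
  exact eq_inv_of_mul_eq_one_right (norm_mul_norm_xi_tau_pow hm ψ hz)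

theorem exists_xi_tau_le {m : ℕ} (hm : 1 ≤ m) (ψ : ℝ) {κ : ℝ} (hκ : 0 < κ) (hκ1 : κ ≤ 1) {ε : ℝ}
    (hε : 0 < ε) : ∃ R₀ : ℝ, 2 ≤ R₀ ∧ ∀ z ∈ cone κ R₀, ‖xi m (tau m ψ z)‖ ≤ ε := by
  refine ⟨max 2 (2 / ε ^ halfDeg m), le_max_left _ _, fun z hz => ?_⟩
  have h1 := cone_norm hκ.le hκ1 hz
  have h2 : 2 / ε ^ halfDeg m < 2 * ‖z‖ := (le_max_right _ _).trans_lt h1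
  have hz0 : z ≠ 0 := by
    rintro rfl
    rw [norm_zero, mul_zero] at h1
    linarith [le_max_left 2 (2 / ε ^ halfDeg m)]
  have h3 := norm_mul_norm_xi_tau_pow hm ψ hz0
  by_contra hcon
  push Not at hcon
  have h4 : ε ^ halfDeg m < ‖xi m (tau m ψ z)‖ ^ halfDeg m :=
    pow_lt_pow_left₀ hcon hε.le (halfDeg_pos hm).ne'
  have h5 : 0 < ε ^ halfDeg m := by positivity
  rw [div_lt_iff₀ h5] at h2
  have h6 : 0 < ‖z‖ := norm_pos_iff.2 hz0
  nlinarith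

/-- The weight of the first-order system for the ratio of an exact and an approximate solution. -/
noncomputable def weight (m N : ℕ) (a : Fin m → ℂ) (ψ : ℝ) (z : ℂ) : ℂ :=
  z * approx m N a (tau m ψ z) ^ 2 * exp (-tau m ψ z)

/-- The contributions of z, of e^{-t} and of ν cancel, because z x^{2ν-1} is constant. What remains
is the exponential part, governed by `sqrtP`. -/
theorem hasDerivAt_leading_weight {m : ℕ} (hm : 1 ≤ m) (a : Fin m → ℂ) (ψ : ℝ) {z : ℂ}
    (hz : z ∈ slitPlane) :
    HasDerivAt (fun z => z * leading m a (tau m ψ z) ^ 2 * exp (-tau m ψ z))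
      (z * leading m a (tau m ψ z) ^ 2 * exp (-tau m ψ z) *
        (-(4 / m) * (exp (ψ * I) * ev a (xi m (tau m ψ z)) (sqrtPol m)))) z := by
  have hz0 := slitPlane_ne_zero hz
  have hm0 : (m : ℂ) ≠ 0 := Nat.cast_ne_zero.2 (by omega)
  have ht := hasDerivAt_tau m ψ hz
  have h1 := (hasDerivAt_leading hm a (tau m ψ z)).comp z ht
  refine (((hasDerivAt_id z).mul (h1.pow 2)).mul ht.neg.cexp).congr_deriv ?_
  have h2 := sqrtP_eq m a (tau m ψ z)
  rw [zeta_tau hm ψ hz0] at h2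
  simp only [Pi.mul_apply, Pi.neg_apply, Pi.pow_apply, id, Function.comp_apply, h2, nu]
  field_simp
  ring

theorem cos_pos_of_abs_lt {ψ : ℝ} (hψ : |ψ| < π / 2) : 0 < Real.cos ψ :=
  Real.cos_pos_of_mem_Ioo ⟨by linarith [neg_abs_le ψ], by linarith [le_abs_self ψ]⟩

/-- The logarithmic derivative is -(4/m) e^{iψ} (1 + δ) with |δ| ≤ cos ψ, and its real part is at
most -(4/m)(cos ψ - |δ|) ≤ 0. -/
theorem norm_leading_weight_le {m : ℕ} (hm : 1 ≤ m) {a : Fin m → ℂ} {ψ : ℝ} {κ R : ℝ}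
    (hκ : 0 < κ) (hR : 0 ≤ R)
    (h : ∀ z ∈ cone κ R, ‖ev a (xi m (tau m ψ z)) (sqrtPol m) - 1‖ ≤ Real.cos ψ) {z : ℂ}
    (hz : z ∈ cone κ R) {s : ℝ} (hs : 0 ≤ s) :
    ‖(z + s) * leading m a (tau m ψ (z + s)) ^ 2 * exp (-tau m ψ (z + s))‖ ≤
      ‖z * leading m a (tau m ψ z) ^ 2 * exp (-tau m ψ z)‖ := by
  set G : ℂ → ℂ := fun z => z * leading m a (tau m ψ z) ^ 2 * exp (-tau m ψ z) with hG
  set w : ℂ → ℂ := fun z => -(4 / m) * (exp (ψ * I) * ev a (xi m (tau m ψ z)) (sqrtPol m)) with hw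
  have hGd : ∀ s : ℝ, 0 ≤ s → HasDerivAt (fun s : ℝ => G (z + s)) (G (z + s) * w (z + s)) s := by
    intro s hs
    have h1 := hasDerivAt_leading_weight hm a ψ (cone_slit hκ hR (cone_add hκ.le hz hs))
    exact (h1.comp_const_add z (s : ℂ)).comp_ofReal
  have hre : ∀ s : ℝ, 0 ≤ s → (w (z + s)).re ≤ 0 := by
    intro s hs
    set δ := ev a (xi m (tau m ψ (z + s))) (sqrtPol m) - 1 with hδ
    have h1 : ‖δ‖ ≤ Real.cos ψ := h _ (cone_add hκ.le hz hs)
    have h2 : w (z + s) = ((-(4 / m : ℝ) : ℝ) : ℂ) * (exp (ψ * I) + exp (ψ * I) * δ) := by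
      simp only [hw, hδ]
      push_cast
      ring
    have h3 : (exp (ψ * I)).re = Real.cos ψ := exp_ofReal_mul_I_re ψ
    have h4 : -‖δ‖ ≤ (exp (ψ * I) * δ).re := by
      have := (neg_abs_le (exp (ψ * I) * δ).re)
      have h5 := abs_re_le_norm (exp (ψ * I) * δ)
      rw [norm_mul, norm_exp_ofReal_mul_I, one_mul] at h5
      linarith
    rw [h2, re_ofReal_mul, add_re, h3]
    have h6 : (0 : ℝ) ≤ 4 / m := by positivity
    nlinarith
  have := norm_le_of_logDeriv_nonpos (f := fun s : ℝ => G (z + s)) (w := fun s : ℝ => w (z + s))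
    hGd hre hs
  simpa only [ofReal_zero, add_zero] using this

theorem coeff_zero_formalPol (m : ℕ) {N : ℕ} (hN : 1 ≤ N) : (formalPol m N).coeff 0 = 1 := by
  rw [formalPol, Polynomial.finsetSum_coeff, Finset.sum_eq_single 0]
  · simp [formalCoeff_zero]
  · intro n _ hn
    rw [Polynomial.coeff_C_mul_X_pow, if_neg hn.symm]
  · intro h
    exact absurd (Finset.mem_range.2 hN) h

/-- Exact solutions near the truncated formal solution in a cone. -/
theorem exists_solution_cone {m : ℕ} (hm : 1 ≤ m) {K : Set (Fin m → ℂ)} (hK : IsCompact K) {ψ : ℝ}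
    (hψ : |ψ| < π / 2) {κ : ℝ} (hκ : 0 < κ) (hκ1 : κ ≤ 1) {n : ℕ} (hn : 1 ≤ n) :
    ∃ A R : ℝ, 2 ≤ R ∧ 0 ≤ A ∧ ∀ a ∈ K, ∃ F, IsSolution m a F ∧ ∀ z ∈ cone κ R,
      ‖F (tau m ψ z) - approx m (halfDeg m * (n + 3)) a (tau m ψ z)‖ ≤
        A * ‖leading m a (tau m ψ z)‖ * (‖z‖ ^ n)⁻¹ := by
  -- Since |ξ|^{halfDeg m} = 1/|z|, this order makes the relative residual O(|z| · |z|^{-(n+3)}).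
  -- The factor z^{-2} in `g` below brings it to the O(|z|^{-(n+4)}) required by the Volterra lemma.
  set N := halfDeg m * (n + 3) with hN
  have hN1 : 1 ≤ N := Nat.mul_pos (halfDeg_pos hm) (by omega)
  have hm0 : (m : ℂ) ≠ 0 := Nat.cast_ne_zero.2 (by omega)
  have hm1 : (1 : ℝ) ≤ m := by exact_mod_cast hm
  obtain ⟨q, hq⟩ := X_pow_dvd_residualPol hm N
  obtain ⟨C₁, hC₁0, hC₁⟩ := exists_ev_sub_bound (sqrtPol m) hK
  obtain ⟨C₂, hC₂0, hC₂⟩ := exists_ev_sub_bound (formalPol m N) hK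
  obtain ⟨C₃, hC₃0, hC₃⟩ := exists_ev_bound q hK
  rw [coeff_zero_sqrtPol] at hC₁
  rw [coeff_zero_formalPol m hN1] at hC₂
  have hcos := cos_pos_of_abs_lt hψ
  -- The three thresholds make the polynomial bounds applicable, put `sqrtPol` within cos ψ of 1 so
  -- that the weight decreases, and put the truncated series within 1/2 of 1.
  obtain ⟨R₀, hR₀, hξ⟩ := exists_xi_tau_le hm ψ hκ hκ1
    (ε := min 1 (min (Real.cos ψ / (C₁ + 1)) (1 / (2 * (C₂ + 1))))) (by positivity)
  set A := 8 * C₃ with hA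
  set C := 9 * A * (3 + 2 / κ) ^ (2 * n + 8) with hC
  have hA0 : 0 ≤ A := by positivity
  have hC0 : 0 ≤ C := by positivity
  set R := max R₀ (4 * C) with hR
  have hR2 : 2 ≤ R := hR₀.trans (le_max_left _ _)
  refine ⟨2 * (2 * C), R, hR2, by positivity, fun a ha => ?_⟩
  have hslit : ∀ z ∈ cone κ R, z ∈ slitPlane := fun z hz => cone_slit hκ (by linarith) hz
  have hz0 : ∀ z ∈ cone κ R, z ≠ 0 := fun z hz => slitPlane_ne_zero (hslit z hz)
  have hξR : ∀ z ∈ cone κ R, ‖xi m (tau m ψ z)‖ ≤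
      min 1 (min (Real.cos ψ / (C₁ + 1)) (1 / (2 * (C₂ + 1)))) :=
    fun z hz => hξ z (cone_anti (le_max_left _ _) hz)
  have hξ1 : ∀ z ∈ cone κ R, ‖xi m (tau m ψ z)‖ ≤ 1 := fun z hz =>
    (hξR z hz).trans (min_le_left _ _)
  have hY : ∀ z ∈ cone κ R, ‖ev a (xi m (tau m ψ z)) (sqrtPol m) - 1‖ ≤ Real.cos ψ := by
    intro z hz
    have h1 := hC₁ a ha _ (hξ1 z hz)
    rw [map_one] at h1
    have h2 : ‖xi m (tau m ψ z)‖ ≤ Real.cos ψ / (C₁ + 1) :=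
      (hξR z hz).trans ((min_le_right _ _).trans (min_le_left _ _))
    rw [le_div_iff₀ (by positivity)] at h2
    nlinarith [norm_nonneg (xi m (tau m ψ z))]
  have hφ : ∀ z ∈ cone κ R, ‖ev a (xi m (tau m ψ z)) (formalPol m N) - 1‖ ≤ 1 / 2 := by
    intro z hz
    have h1 := hC₂ a ha _ (hξ1 z hz)
    rw [map_one] at h1
    have h2 : ‖xi m (tau m ψ z)‖ ≤ 1 / (2 * (C₂ + 1)) :=
      (hξR z hz).trans ((min_le_right _ _).trans (min_le_right _ _))
    rw [le_div_iff₀ (by positivity)] at h2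
    nlinarith [norm_nonneg (xi m (tau m ψ z))]
  set φ : ℂ → ℂ := fun z => ev a (xi m (tau m ψ z)) (formalPol m N) with hφ_def
  have hφlow : ∀ z ∈ cone κ R, 1 / 2 ≤ ‖φ z‖ := by
    intro z hz
    have h1 := norm_sub_norm_le (1 : ℂ) (1 - φ z)
    rw [sub_sub_cancel, norm_one, norm_sub_rev] at h1
    linarith [hφ z hz]
  have hφup : ∀ z ∈ cone κ R, ‖φ z‖ ≤ 3 / 2 := by
    intro z hz
    have h1 := norm_add_le (1 : ℂ) (φ z - 1)
    rw [add_sub_cancel, norm_one] at h1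
    linarith [hφ z hz]
  have hφ0 : ∀ z ∈ cone κ R, φ z ≠ 0 := fun z hz => by
    rw [← norm_pos_iff]
    linarith [hφlow z hz]
  set Λ := approx m N a with hΛ
  have hΛe : ∀ z, Λ (tau m ψ z) = leading m a (tau m ψ z) * φ z := fun z => rfl
  have hΛ0 : ∀ z ∈ cone κ R, Λ (tau m ψ z) ≠ 0 := fun z hz =>
    mul_ne_zero (leading_ne_zero m a _) (hφ0 z hz)
  have hΛd : Differentiable ℂ Λ := (approx_residual hm N a 0).1
  have hres := fun t => (approx_residual hm N a t).2
  rw [← hΛ] at hres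
  have hτ : ∀ z ∈ cone κ R, HasDerivAt (tau m ψ) (2 / (m * z)) z := fun z hz =>
    hasDerivAt_tau m ψ (hslit z hz)
  set H := weight m N a ψ with hH
  set res : ℂ → ℂ := fun t => deriv (deriv Λ) t - deriv Λ t - P m a (exp t) * Λ t with hres_def
  have hresd : Differentiable ℂ res := by
    have h1 : Differentiable ℂ fun t => P m a (exp t) := by
      unfold P
      fun_prop
    exact (hΛd.deriv.deriv.sub hΛd.deriv).sub (h1.mul hΛd)
  -- Substituting u = Λ V gives (e^{-t} Λ² V_t)_t = -e^{-t} Λ res V. With dt/dz = 2/(mz) this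
  -- becomes (H V')' = -H g V.
  set g : ℂ → ℂ := fun z => 4 / (m ^ 2 * z ^ 2) * (res (tau m ψ z) / Λ (tau m ψ z)) with hg
  have hτd : DifferentiableOn ℂ (tau m ψ) (cone κ R) := fun z hz =>
    (hτ z hz).differentiableAt.differentiableWithinAt
  have hΛτd : DifferentiableOn ℂ (fun z => Λ (tau m ψ z)) (cone κ R) :=
    hΛd.comp_differentiableOn hτd
  have hHd : DifferentiableOn ℂ H (cone κ R) :=
    (differentiableOn_id.mul (hΛτd.pow 2)).mul hτd.neg.cexp
  have hH0 : ∀ z ∈ cone κ R, H z ≠ 0 := fun z hz =>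
    mul_ne_zero (mul_ne_zero (hz0 z hz) (pow_ne_zero 2 (hΛ0 z hz))) (exp_ne_zero _)
  -- The truncated series φ has modulus between 1/2 and 3/2, so |φ|² varies by a factor of at most
  -- 3² = 9.
  have hHs : ∀ z ∈ cone κ R, ∀ s : ℝ, 0 ≤ s → ‖H (z + s)‖ ≤ 9 * ‖H z‖ := by
    intro z hz s hs
    have hzs := cone_add hκ.le hz hs
    have h1 : ∀ z, ‖H z‖ =
        ‖z * leading m a (tau m ψ z) ^ 2 * exp (-tau m ψ z)‖ * ‖φ z‖ ^ 2 := fun z => by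
      rw [← norm_pow, ← norm_mul, hH, weight, ← hΛ, hΛe]
      congr 1
      ring
    have h2 := norm_leading_weight_le hm hκ (by linarith) hY hz hs
    have h3 : ‖φ (z + s)‖ ^ 2 ≤ 9 * ‖φ z‖ ^ 2 := by
      have := hφup _ hzs
      have := hφlow z hz
      calc ‖φ (z + s)‖ ^ 2 ≤ (3 * ‖φ z‖) ^ 2 := by gcongr; linarith
        _ = _ := by ring
    rw [h1, h1]
    calc _ ≤ ‖z * leading m a (tau m ψ z) ^ 2 * exp (-tau m ψ z)‖ * (9 * ‖φ z‖ ^ 2) := by gcongr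
      _ = _ := by ring
  have hgd : DifferentiableOn ℂ g (cone κ R) := by
    refine DifferentiableOn.mul (DifferentiableOn.div (differentiableOn_const _)
      ((differentiableOn_const _).mul (differentiableOn_pow 2)) fun z hz => ?_)
      ((hresd.comp_differentiableOn hτd).div hΛτd hΛ0)
    exact mul_ne_zero (pow_ne_zero 2 hm0) (pow_ne_zero 2 (hz0 z hz))
  have hgA : ∀ z ∈ cone κ R, ‖g z‖ ≤ A * (‖z‖ ^ (n + 4))⁻¹ := by
    intro z hz
    have hzn : 0 < ‖z‖ := norm_pos_iff.2 (hz0 z hz)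
    have h1 : res (tau m ψ z) / Λ (tau m ψ z) =
        z * exp (ψ * I) * (xi m (tau m ψ z) ^ N * ev a (xi m (tau m ψ z)) q) / φ z := by
      rw [hres_def]
      simp only
      rw [hres, hΛe, mul_div_mul_left _ _ (leading_ne_zero m a _), zeta_tau hm ψ (hz0 z hz), hq,
        map_mul, map_pow, ev_X]
    have h2 : ‖xi m (tau m ψ z)‖ ^ N = (‖z‖ ^ (n + 3))⁻¹ := norm_xi_tau_pow hm ψ (hz0 z hz) (n + 3)
    have h3 : ‖res (tau m ψ z) / Λ (tau m ψ z)‖ ≤ ‖z‖ * ((‖z‖ ^ (n + 3))⁻¹ * C₃) / (1 / 2) := by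
      rw [h1, norm_div, norm_mul, norm_mul, norm_mul, norm_exp_ofReal_mul_I, mul_one, norm_pow, h2]
      have := hC₃ a ha _ (hξ1 z hz)
      gcongr
      exact hφlow z hz
    have h4 : ‖(4 : ℂ) / (m ^ 2 * z ^ 2)‖ ≤ 4 / ‖z‖ ^ 2 := by
      rw [norm_div, norm_mul, norm_pow, norm_pow, norm_natCast, norm_ofNat]
      have : (1 : ℝ) ≤ (m : ℝ) ^ 2 := one_le_pow₀ hm1
      have h5 : 0 < ‖z‖ ^ 2 := by positivity
      gcongr
      nlinarith
    rw [hg, norm_mul]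
    calc _ ≤ 4 / ‖z‖ ^ 2 * (‖z‖ * ((‖z‖ ^ (n + 3))⁻¹ * C₃) / (1 / 2)) := by gcongr
      _ = A * (‖z‖ ^ (n + 4))⁻¹ := by
        rw [hA]
        field_simp
        ring
  obtain ⟨V, Q, hVQ⟩ := exists_volterra hκ hκ1 hR2 hA0 (by norm_num : (0 : ℝ) ≤ 9) hn
    (le_max_right _ _) hHd hH0 hHs hgd hgA
  -- This is the Wronskian of ΛV with f, written with Q in place of V'. Its constancy expresses that
  -- ΛV solves the equation in the cone.
  set w : (ℂ → ℂ) → ℂ → ℂ := fun f z =>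
    V z * wr Λ f (tau m ψ z) - m / 2 * (H z * Q z) * (f (tau m ψ z) / Λ (tau m ψ z)) with hw
  have hwd : ∀ f, IsSolution m a f → ∀ z ∈ cone κ R, HasDerivAt (w f) 0 z := by
    intro f hf z hz
    have h1 := ((hVQ z hz).1.mul ((hasDerivAt_wr hΛd hf.1 (tau m ψ z)).comp z (hτ z hz))).sub
      ((((hVQ z hz).2.1).const_mul ((m : ℂ) / 2)).mul
        (((hf.1 _).hasDerivAt.comp z (hτ z hz)).div ((hΛd _).hasDerivAt.comp z (hτ z hz))
          (hΛ0 z hz)))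
    refine h1.congr_deriv ?_
    simp only [Function.comp_apply, Pi.div_apply, wr, hf.deriv_deriv, hg, hres_def]
    have h2 := hΛ0 z hz
    have h3 := hz0 z hz
    simp only [hH, weight, ← hΛ]
    generalize Λ (tau m ψ z) = L at h2 ⊢
    generalize deriv Λ (tau m ψ z) = L₁
    generalize deriv (deriv Λ) (tau m ψ z) = L₂
    generalize exp (-tau m ψ z) = e
    generalize f (tau m ψ z) = F
    generalize deriv f (tau m ψ z) = F₁
    field_simp
    ring
  have hwc : ∀ f, IsSolution m a f → ∃ c, ∀ z ∈ cone κ R, w f z = c := fun f hf =>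
    (isOpen_cone κ R).exists_is_const_of_deriv_eq_zero (isPreconnected_cone hκ R)
      (fun z hz => (hwd f hf z hz).differentiableAt.differentiableWithinAt)
      fun z hz => (hwd f hf z hz).deriv
  obtain ⟨f₁, f₂, hf₁, hf₂, hW⟩ := exists_basis hm a
  obtain ⟨c₁, hc₁⟩ := hwc f₁ hf₁
  obtain ⟨c₂, hc₂⟩ := hwc f₂ hf₂
  -- Cramer's rule writes ΛV as a combination of the global basis, which continues it to the whole
  -- covering.
  refine ⟨_, hf₁.linear hf₂ (c₂ / wr f₁ f₂ 0) (-(c₁ / wr f₁ f₂ 0)), fun z hz => ?_⟩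
  have hF : c₂ / wr f₁ f₂ 0 * f₁ (tau m ψ z) + -(c₁ / wr f₁ f₂ 0) * f₂ (tau m ψ z) =
      Λ (tau m ψ z) * V z := by
    have h1 : c₂ * f₁ (tau m ψ z) - c₁ * f₂ (tau m ψ z) = Λ (tau m ψ z) * V z * wr f₁ f₂ 0 := by
      rw [← hc₁ z hz, ← hc₂ z hz, wr_const hf₁ hf₂ 0 (tau m ψ z)]
      simp only [hw, wr]
      have h2 := hΛ0 z hz
      field_simp
      ring
    field_simp
    linear_combination h1
  rw [hF]
  have h5 : Λ (tau m ψ z) * V z - Λ (tau m ψ z) =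
      leading m a (tau m ψ z) * φ z * (V z - 1) := by
    rw [hΛe]
    ring
  rw [h5, norm_mul, norm_mul]
  calc _ ≤ ‖leading m a (tau m ψ z)‖ * 2 * (2 * C * (‖z‖ ^ n)⁻¹) := by
        gcongr
        · linarith [hφup z hz]
        · exact (hVQ z hz).2.2
    _ = _ := by ring

/-! ### Wronskians at infinity -/

open Filter Topology

theorem tendsto_exp_neg_mul {h : ℝ} (hh : 0 < h) (A : ℝ) :
    Tendsto (fun x : ℝ => A * Real.exp (-(h * x))) atTop (𝓝 0) := by
  have h1 : Tendsto (fun x : ℝ => h * x) atTop atTop := tendsto_id.const_mul_atTop hh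
  simpa using (Real.tendsto_exp_neg_atTop_nhds_zero.comp h1).const_mul A

/-- The bound is needed on a strip and not only on the axis: Cauchy's estimate on discs of radius δ
carries it over to the derivative of the ratio. -/
theorem tendsto_ratio {u L : ℂ → ℂ} (hu : Differentiable ℂ u) (hL : Differentiable ℂ L)
    (hL0 : ∀ t, L t ≠ 0) {A R δ h : ℝ} (hδ : 0 < δ) (hh : 0 < h)
    (hb : ∀ t : ℂ, |t.im| ≤ δ → R ≤ t.re → ‖u t - L t‖ ≤ A * ‖L t‖ * Real.exp (-(h * t.re))) :
    Tendsto (fun x : ℝ => u x / L x) atTop (𝓝 1) ∧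
      Tendsto (fun x : ℝ => deriv (fun t => u t / L t) x) atTop (𝓝 0) := by
  set ε : ℂ → ℂ := fun t => u t / L t - 1 with hε
  have hεd : Differentiable ℂ ε := (hu.div hL hL0).sub_const 1
  have hεb : ∀ t : ℂ, |t.im| ≤ δ → R ≤ t.re → ‖ε t‖ ≤ A * Real.exp (-(h * t.re)) := by
    intro t h1 h2
    have h3 : ε t = (u t - L t) / L t := by
      simp only [hε]
      have := hL0 t
      field_simp
    have h4 : 0 < ‖L t‖ := norm_pos_iff.2 (hL0 t)
    rw [h3, norm_div, div_le_iff₀ h4]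
    linarith [hb t h1 h2]
  constructor
  · have h1 : Tendsto (fun x : ℝ => ε x) atTop (𝓝 0) := by
      refine squeeze_zero_norm' (eventually_atTop.2 ⟨R, fun x hx => ?_⟩)
        (tendsto_exp_neg_mul hh A)
      simpa using hεb x (by simpa using hδ.le) (by simpa using hx)
    simpa [hε] using h1.add_const 1
  · have h1 : ∀ t, deriv (fun t => u t / L t) t = deriv ε t := fun t => by
      rw [hε, deriv_sub_const]
    simp only [h1]
    refine squeeze_zero_norm' (eventually_atTop.2 ⟨R + δ, fun x hx => ?_⟩)
      (tendsto_exp_neg_mul hh (A * Real.exp (h * δ) / δ))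
    have h2 := norm_deriv_le_of_forall_mem_sphere_norm_le (c := (x : ℂ)) (f := ε)
      (C := A * Real.exp (h * δ) * Real.exp (-(h * x))) hδ hεd.diffContOnCl fun t ht => ?_
    · refine h2.trans (le_of_eq ?_)
      ring
    · rw [mem_sphere_iff_norm] at ht
      have h3 := abs_re_le_norm (t - x)
      have h4 := abs_im_le_norm (t - x)
      rw [ht, sub_re, ofReal_re] at h3
      rw [ht, sub_im, ofReal_im, sub_zero] at h4
      have h5 : x - δ ≤ t.re := by linarith [(abs_le.1 h3).1]
      have h6 := hεb t h4 (by linarith)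
      have hA : 0 ≤ A := by
        have := (norm_nonneg _).trans h6
        exact nonneg_of_mul_nonneg_left this (Real.exp_pos _)
      refine h6.trans ?_
      rw [mul_assoc, ← Real.exp_add]
      refine mul_le_mul_of_nonneg_left (Real.exp_le_exp.2 ?_) hA
      nlinarith

/-- Writing each u as L times a ratio splits the Wronskian into a main term with E₂ - E₁ and a term
with the derivatives of the ratios. The latter tend to 0 and are multiplied by e^{-x} L₁ L₂, which
also tends to 0. -/
theorem tendsto_wr {u₁ u₂ L₁ L₂ E₁ E₂ : ℂ → ℂ} (hu₁ : Differentiable ℂ u₁)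
    (hu₂ : Differentiable ℂ u₂) (hL₁ : ∀ t, HasDerivAt L₁ (E₁ t * L₁ t) t)
    (hL₂ : ∀ t, HasDerivAt L₂ (E₂ t * L₂ t) t) (hL₁0 : ∀ t, L₁ t ≠ 0) (hL₂0 : ∀ t, L₂ t ≠ 0)
    {A R δ h : ℝ} (hδ : 0 < δ) (hh : 0 < h)
    (hb₁ : ∀ t : ℂ, |t.im| ≤ δ → R ≤ t.re → ‖u₁ t - L₁ t‖ ≤ A * ‖L₁ t‖ * Real.exp (-(h * t.re)))
    (hb₂ : ∀ t : ℂ, |t.im| ≤ δ → R ≤ t.re → ‖u₂ t - L₂ t‖ ≤ A * ‖L₂ t‖ * Real.exp (-(h * t.re)))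
    (hlim₀ : Tendsto (fun x : ℝ => exp (-x) * L₁ x * L₂ x) atTop (𝓝 0)) {ℓ : ℂ}
    (hlim : Tendsto (fun x : ℝ => exp (-x) * L₁ x * L₂ x * (E₂ x - E₁ x)) atTop (𝓝 ℓ)) :
    Tendsto (fun x : ℝ => wr u₁ u₂ x) atTop (𝓝 ℓ) := by
  have hd₁ : Differentiable ℂ L₁ := fun t => (hL₁ t).differentiableAt
  have hd₂ : Differentiable ℂ L₂ := fun t => (hL₂ t).differentiableAt
  obtain ⟨h1, h1'⟩ := tendsto_ratio hu₁ hd₁ hL₁0 hδ hh hb₁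
  obtain ⟨h2, h2'⟩ := tendsto_ratio hu₂ hd₂ hL₂0 hδ hh hb₂
  have hder : ∀ {u L E : ℂ → ℂ}, Differentiable ℂ u → (∀ t, HasDerivAt L (E t * L t) t) →
      (∀ t, L t ≠ 0) → ∀ t, deriv u t = L t * (E t * (u t / L t) + deriv (fun t => u t / L t) t) := by
    intro u L E hu hL hL0 t
    have hdv : deriv (fun t => u t / L t) t = _ :=
      ((hu t).hasDerivAt.fun_div (hL t) (hL0 t)).deriv
    rw [hdv]
    have := hL0 t
    field_simp
    ring
  have key : ∀ x : ℝ, wr u₁ u₂ x =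
      exp (-x) * L₁ x * L₂ x * (E₂ x - E₁ x) * ((u₁ x / L₁ x) * (u₂ x / L₂ x)) +
      exp (-x) * L₁ x * L₂ x * ((u₁ x / L₁ x) * deriv (fun t => u₂ t / L₂ t) x -
        deriv (fun t => u₁ t / L₁ t) x * (u₂ x / L₂ x)) := by
    intro x
    rw [wr, hder hu₁ hL₁ hL₁0, hder hu₂ hL₂ hL₂0]
    have h3 := hL₁0 x
    have h4 := hL₂0 x
    field_simp
    ring
  simp only [key]
  have h5 := (hlim.mul (h1.mul h2)).add (hlim₀.mul ((h1.mul h2').sub (h1'.mul h2)))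
  simpa using h5

theorem tendsto_xi (m : ℕ) : Tendsto (fun x : ℝ => xi m x) atTop (𝓝 0) := by
  rw [tendsto_zero_iff_norm_tendsto_zero]
  have h := tendsto_exp_neg_mul (stepExp_pos m) 1
  refine h.congr fun x => ?_
  rw [xi, norm_exp, one_mul]
  congr 1
  simp

theorem continuous_ev {m : ℕ} (a : Fin m → ℂ) (q : Polynomial (MvPolynomial (Fin m) ℂ)) :
    Continuous fun ξ => ev a ξ q := by
  have : (fun ξ => ev a ξ q) = fun ξ => (q.map (MvPolynomial.eval a)).eval ξ :=
    funext fun ξ => (Polynomial.eval_map _ _).symm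
  rw [this]
  exact Polynomial.continuous _

theorem tendsto_ev_sqrtPol (m : ℕ) (a : Fin m → ℂ) :
    Tendsto (fun x : ℝ => ev a (xi m x) (sqrtPol m)) atTop (𝓝 1) := by
  have h1 := ((continuous_ev a (sqrtPol m)).tendsto 0).comp (tendsto_xi m)
  have h2 : ev a 0 (sqrtPol m) = 1 := by
    have : ev a 0 (sqrtPol m) = MvPolynomial.eval a ((sqrtPol m).coeff 0) := Polynomial.eval₂_at_zero _
    rw [this, coeff_zero_sqrtPol, map_one]
  rwa [h2] at h1

/-- For large x the real part of `sqrtP` exceeds that of ν, so `leading`² is bounded, and the factor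
e^{-x} gives the limit. -/
theorem tendsto_leading_sq {m : ℕ} (hm : 1 ≤ m) (a : Fin m → ℂ) :
    Tendsto (fun x : ℝ => exp (-x) * leading m a x * leading m a x) atTop (𝓝 0) := by
  have h1 := ((tendsto_ev_sqrtPol m a).eventually
    (Metric.ball_mem_nhds (1 : ℂ) (by norm_num : (0 : ℝ) < 1 / 2)))
  obtain ⟨x₀, hx₀⟩ := eventually_atTop.1 h1
  set X := max x₀ 0 with hX
  set f : ℝ → ℂ := fun s => leading m a (X + s) ^ 2 with hf
  have hfd : ∀ s : ℝ, 0 ≤ s → HasDerivAt f (f s * (2 * (nu m - sqrtP m a (X + s)))) s := by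
    intro s _
    have h2 := ((hasDerivAt_leading hm a (X + s)).comp_const_add (X : ℂ) (s : ℂ)).comp_ofReal
    refine (h2.pow 2).congr_deriv ?_
    simp only [hf]
    ring
  have hre : ∀ s : ℝ, 0 ≤ s → (2 * (nu m - sqrtP m a (X + s))).re ≤ 0 := by
    intro s hs
    have h3 := hx₀ (X + s) (by linarith [le_max_left x₀ 0])
    rw [dist_eq] at h3
    have h4 : zeta m (X + s) = (Real.exp (m / 2 * (X + s)) : ℂ) := by
      rw [zeta]
      push_cast
      rfl
    have h5 : 1 ≤ Real.exp (m / 2 * (X + s)) := by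
      rw [Real.one_le_exp_iff]
      have : 0 ≤ X := le_max_right _ _
      positivity
    have h6 : 1 / 2 ≤ (ev a (xi m (X + s)) (sqrtPol m)).re := by
      have h7 := abs_re_le_norm (ev a (xi m ((X + s : ℝ) : ℂ)) (sqrtPol m) - 1)
      rw [sub_re, one_re] at h7
      push_cast at h7 h3
      linarith [(abs_le.1 h7).1]
    have h8 : 1 / 2 ≤ (sqrtP m a (X + s)).re := by
      rw [sqrtP_eq, h4, re_ofReal_mul]
      nlinarith
    have h9 : (nu m).re ≤ 1 / 2 := by
      have : nu m = ((1 / 2 - m / 4 : ℝ) : ℂ) := by unfold nu; push_cast; ring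
      rw [this, ofReal_re]
      have : (0 : ℝ) ≤ m := Nat.cast_nonneg m
      linarith
    have h10 : (2 * (nu m - sqrtP m a (X + s))).re = 2 * ((nu m).re - (sqrtP m a (X + s)).re) := by
      rw [show (2 : ℂ) = ((2 : ℝ) : ℂ) by norm_num, re_ofReal_mul, sub_re]
    rw [h10]
    linarith
  refine squeeze_zero_norm' (eventually_atTop.2 ⟨X, fun x hx => ?_⟩)
    (tendsto_exp_neg_mul one_pos ‖f 0‖)
  have h11 := norm_le_of_logDeriv_nonpos hfd hre (sub_nonneg.2 hx)
  have h12 : f (x - X) = leading m a x ^ 2 := by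
    simp only [hf]
    push_cast
    congr 2
    ring
  rw [h12] at h11
  rw [mul_assoc, ← sq, norm_mul, norm_exp, mul_comm]
  simp only [neg_re, ofReal_re, one_mul]
  gcongr

/-- The property of having the asymptotic behaviour of `leading` near the positive real axis. -/
def HasLeading (m : ℕ) (a : Fin m → ℂ) (F : ℂ → ℂ) : Prop :=
  ∃ A R δ : ℝ, 0 < δ ∧ ∀ t : ℂ, |t.im| ≤ δ → R ≤ t.re →
    ‖F t - leading m a t‖ ≤ A * ‖leading m a t‖ * Real.exp (-(stepExp m * t.re))

/-- The behaviour is recessive: the Wronskian of two such solutions tends to 0, hence vanishes. They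
are then proportional, and the common leading term fixes the factor as 1. -/
theorem HasLeading.unique {m : ℕ} (hm : 1 ≤ m) {a : Fin m → ℂ} {F G : ℂ → ℂ}
    (hF : IsSolution m a F) (hG : IsSolution m a G) (hF' : HasLeading m a F)
    (hG' : HasLeading m a G) : F = G := by
  obtain ⟨A, R, δ, hδ, hA⟩ := hF'
  obtain ⟨A', R', δ', hδ', hA'⟩ := hG'
  have hLd : Differentiable ℂ (leading m a) := fun t => (hasDerivAt_leading hm a t).differentiableAt
  have hL0 := leading_ne_zero m a
  have hlim := tendsto_wr (u₁ := F) (u₂ := G) (A := max A A') (R := max R R') (δ := min δ δ')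
    (ℓ := 0) hF.1 hG.1 (hasDerivAt_leading hm a) (hasDerivAt_leading hm a) hL0 hL0
    (lt_min hδ hδ') (stepExp_pos m)
    (fun t h1 h2 => (hA t (h1.trans (min_le_left _ _)) ((le_max_left _ _).trans h2)).trans
      (by gcongr; exact le_max_left _ _))
    (fun t h1 h2 => (hA' t (h1.trans (min_le_right _ _)) ((le_max_right _ _).trans h2)).trans
      (by gcongr; exact le_max_right _ _))
    (tendsto_leading_sq hm a) (by simp)
  have hw : wr F G 0 = 0 := by
    refine tendsto_nhds_unique (tendsto_const_nhds.congr fun x : ℝ => ?_) hlim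
    exact wr_const hF hG 0 x
  have h1 := (tendsto_ratio hF.1 hLd hL0 hδ (stepExp_pos m) hA).1
  have h2 := (tendsto_ratio hG.1 hLd hL0 hδ' (stepExp_pos m) hA').1
  obtain ⟨x₀, hx₀⟩ := (h2.eventually_ne one_ne_zero).exists
  have hG0 : G x₀ ≠ 0 := fun h => hx₀ (by rw [h, zero_div])
  have h3 := hF.eq_mul hm hG hw hG0
  have h4 : F x₀ / G x₀ = 1 := by
    refine tendsto_nhds_unique ?_ h1
    have h5 := h2.const_mul (F x₀ / G x₀)
    rw [mul_one] at h5
    refine h5.congr fun x => ?_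
    rw [h3 x]
    ring
  funext t
  rw [h3 t, h4, one_mul]

/-! ### Existence of the solution `Φ_0` -/

/-- This makes the slope κ = sin η / 2 suitable for the sector |arg z| ≤ π - η. Where cos α < 0 one
has |sin α| ≥ sin η, twice the possible loss from the cosine. -/
theorem le_cone_function {η α : ℝ} (hη : 0 < η) (hη' : η ≤ π / 2) (hα : |α| ≤ π - η) :
    Real.sin η / 2 ≤ Real.sin η / 2 * Real.cos α + |Real.sin α| := by
  have hs0 : 0 < Real.sin η := Real.sin_pos_of_pos_of_lt_pi hη (by linarith [Real.pi_pos])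
  have hs1 := Real.sin_le_one η
  rcases le_or_gt 0 (Real.cos α) with h | h
  · have h1 : 1 ≤ Real.cos α + |Real.sin α| := by
      have h2 := Real.cos_sq_add_sin_sq α
      have h3 := Real.cos_le_one α
      have h4 := Real.abs_sin_le_one α
      rw [← sq_abs (Real.sin α)] at h2
      nlinarith [abs_nonneg (Real.sin α)]
    nlinarith [abs_nonneg (Real.sin α)]
  · have h1 : π / 2 < |α| := by
      by_contra hcon
      push Not at hcon
      exact absurd (Real.cos_nonneg_of_mem_Icc ⟨(abs_le.1 hcon).1, (abs_le.1 hcon).2⟩) (not_le.2 h)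
    have h2 : Real.sin η ≤ |Real.sin α| := by
      have h3 : |Real.sin α| = Real.sin (π - |α|) := by
        rw [Real.sin_pi_sub, Real.abs_sin_eq_sin_abs_of_abs_le_pi (by linarith)]
      rw [h3]
      exact Real.sin_le_sin_of_le_of_le_pi_div_two (by linarith) (by linarith) (by linarith)
    nlinarith [Real.neg_one_le_cos α]

/-- The point is z = exp((m/2) t - iψ). The angle condition lies within the range of the principal
logarithm, so `tau` recovers t; as m ≥ 1, the bound on Re t makes |z| > R/κ. -/
theorem exists_coordinate {m : ℕ} (hm : 1 ≤ m) {ψ η : ℝ} (hη : 0 < η) (hη' : η ≤ π / 2) {R : ℝ}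
    (hR : 0 ≤ R) {t : ℂ} (ht : |m / 2 * t.im - ψ| ≤ π - η) (htR : 2 * R / (Real.sin η / 2) ≤ t.re) :
    ∃ z ∈ cone (Real.sin η / 2) R, tau m ψ z = t ∧ z ≠ 0 := by
  have hs0 : 0 < Real.sin η := Real.sin_pos_of_pos_of_lt_pi hη (by linarith [Real.pi_pos])
  have hm0 : (m : ℂ) ≠ 0 := Nat.cast_ne_zero.2 (by omega)
  have hm1 : (1 : ℝ) ≤ m := by exact_mod_cast hm
  set w : ℂ := m / 2 * t - ψ * I with hw
  have him : w.im = m / 2 * t.im - ψ := by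
    have : w = ((m / 2 : ℝ) : ℂ) * t - ψ * I := by rw [hw]; push_cast; ring
    rw [this, sub_im, im_ofReal_mul, im_ofReal_mul, I_im, mul_one]
  have hre : w.re = m / 2 * t.re := by
    have : w = ((m / 2 : ℝ) : ℂ) * t - ψ * I := by rw [hw]; push_cast; ring
    rw [this, sub_re, re_ofReal_mul, re_ofReal_mul, I_re, mul_zero, sub_zero]
  refine ⟨exp w, ?_, ?_, exp_ne_zero _⟩
  · have h1 : R / (Real.sin η / 2) < Real.exp w.re := by
      have h2 := Real.add_one_le_exp w.re
      have h3 : 0 ≤ t.re := le_trans (by positivity) htR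
      have h4 : 2 * R / (Real.sin η / 2) = 2 * (R / (Real.sin η / 2)) := by ring
      rw [hre] at h2 ⊢
      nlinarith
    rw [div_lt_iff₀ (by positivity)] at h1
    have h5 := le_cone_function hη hη' (him ▸ ht)
    simp only [cone, Set.mem_ofPred_eq, exp_re, exp_im, abs_mul, Real.abs_exp]
    have h6 := mul_le_mul_of_nonneg_left h5 (Real.exp_pos w.re).le
    linarith
  · have h1 : |w.im| ≤ π - η := him ▸ ht
    rw [tau, log_exp (by linarith [(abs_le.1 h1).1]) (by linarith [(abs_le.1 h1).2]), hw]
    field_simp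
    ring

theorem exists_formal_tail {m N N' : ℕ} (h : N ≤ N') {K : Set (Fin m → ℂ)} (hK : IsCompact K) :
    ∃ C : ℝ, 0 ≤ C ∧ ∀ a ∈ K, ∀ ξ : ℂ, ‖ξ‖ ≤ 1 →
      ‖ev a ξ (formalPol m N') - ev a ξ (formalPol m N)‖ ≤ C * ‖ξ‖ ^ N := by
  obtain ⟨k, hk⟩ := Nat.exists_eq_add_of_le h
  obtain ⟨q, hq⟩ : ∃ q : Polynomial (MvPolynomial (Fin m) ℂ),
      ∀ a ξ, ev a ξ q = ∑ n ∈ Finset.range k, MvPolynomial.eval a (formalCoeff m (N + n)) * ξ ^ n :=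
    ⟨∑ n ∈ Finset.range k, Polynomial.C (formalCoeff m (N + n)) * Polynomial.X ^ n, fun a ξ => by
      simp only [map_sum, map_mul, map_pow, ev_C, ev_X]⟩
  obtain ⟨C, hC0, hC⟩ := exists_ev_bound q hK
  refine ⟨C, hC0, fun a ha ξ hξ => ?_⟩
  have h1 : ev a ξ (formalPol m N') - ev a ξ (formalPol m N) = ev a ξ q * ξ ^ N := by
    rw [ev_formalPol, ev_formalPol, hq, hk, Finset.sum_range_add, add_sub_cancel_left,
      Finset.sum_mul]
    exact Finset.sum_congr rfl fun n _ => by rw [pow_add, mul_assoc, mul_comm (ξ ^ N)]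
  rw [h1, norm_mul, norm_pow]
  exact mul_le_mul_of_nonneg_right (hC a ha ξ hξ) (by positivity)

/-- The solution is built near a longer truncation, and the excess terms are then discarded. Both
orders are recorded for the same F: j = 1 identifies it by uniqueness, j = N is the expansion
sought. -/
theorem exists_solution_strip {m : ℕ} (hm : 1 ≤ m) {K : Set (Fin m → ℂ)} (hK : IsCompact K)
    {ψ η : ℝ} (hψ : |ψ| < π / 2) (hη : 0 < η) (hη' : η ≤ π / 2) (N : ℕ) :
    ∃ A R : ℝ, ∀ a ∈ K, ∃ F, IsSolution m a F ∧ ∀ t : ℂ, |m / 2 * t.im - ψ| ≤ π - η → R ≤ t.re →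
      ∀ j, j = 1 ∨ j = N →
        ‖F t - approx m j a t‖ ≤ A * ‖leading m a t‖ * ‖xi m t‖ ^ j := by
  have hs0 : 0 < Real.sin η := Real.sin_pos_of_pos_of_lt_pi hη (by linarith [Real.pi_pos])
  have hs1 := Real.sin_le_one η
  set n := N + 1 with hn
  have hM := halfDeg_pos hm
  have hMn : n ≤ halfDeg m * n := Nat.le_mul_of_pos_left n hM
  have hMn' : halfDeg m * n ≤ halfDeg m * (n + 3) := Nat.mul_le_mul_left _ (by omega)
  obtain ⟨A, R, hR2, hA0, hA⟩ := exists_solution_cone hm hK hψ (κ := Real.sin η / 2)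
    (by positivity) (by linarith) (n := n) (by omega)
  obtain ⟨C₁, hC₁0, hC₁⟩ := exists_formal_tail (m := m) (N := 1) (N' := halfDeg m * (n + 3))
    (by omega) hK
  obtain ⟨C₂, hC₂0, hC₂⟩ := exists_formal_tail (m := m) (N := N) (N' := halfDeg m * (n + 3))
    (by omega) hK
  refine ⟨A + C₁ + C₂, 2 * R / (Real.sin η / 2), fun a ha => ?_⟩
  obtain ⟨F, hF, hFb⟩ := hA a ha
  refine ⟨F, hF, fun t ht htR j hj => ?_⟩
  have htre : 0 ≤ t.re := le_trans (by positivity) htR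
  obtain ⟨z, hz, rfl, hz0⟩ := exists_coordinate hm hη hη' (by linarith) ht htR
  have hξ := norm_xi_le_one m htre
  set t := tau m ψ z with ht_def
  have hjn : j ≤ halfDeg m * n := by rcases hj with rfl | rfl <;> omega
  have h1 : ‖F t - approx m (halfDeg m * (n + 3)) a t‖ ≤ A * ‖leading m a t‖ * ‖xi m t‖ ^ j := by
    refine (hFb z hz).trans ?_
    rw [← norm_xi_tau_pow hm ψ hz0]
    exact mul_le_mul_of_nonneg_left (pow_le_pow_of_le_one (norm_nonneg _) hξ hjn) (by positivity)
  have h2 : ‖approx m (halfDeg m * (n + 3)) a t - approx m j a t‖ ≤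
      (C₁ + C₂) * ‖leading m a t‖ * ‖xi m t‖ ^ j := by
    rw [approx, approx, ← mul_sub, norm_mul]
    have h3 : ‖ev a (xi m t) (formalPol m (halfDeg m * (n + 3))) - ev a (xi m t) (formalPol m j)‖ ≤
        (C₁ + C₂) * ‖xi m t‖ ^ j := by
      rcases hj with rfl | rfl
      · refine (hC₁ a ha _ hξ).trans ?_
        gcongr
        linarith
      · refine (hC₂ a ha _ hξ).trans ?_
        gcongr
        linarith
    calc _ ≤ ‖leading m a t‖ * ((C₁ + C₂) * ‖xi m t‖ ^ j) := by gcongr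
      _ = _ := by ring
  calc ‖F t - approx m j a t‖ = ‖(F t - approx m (halfDeg m * (n + 3)) a t) +
        (approx m (halfDeg m * (n + 3)) a t - approx m j a t)‖ := by rw [sub_add_sub_cancel]
    _ ≤ _ := norm_add_le _ _
    _ ≤ A * ‖leading m a t‖ * ‖xi m t‖ ^ j + (C₁ + C₂) * ‖leading m a t‖ * ‖xi m t‖ ^ j :=
      add_le_add h1 h2
    _ = _ := by ring

theorem approx_one (m : ℕ) (a : Fin m → ℂ) (t : ℂ) : approx m 1 a t = leading m a t := by
  rw [approx, ev_formalPol]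
  simp [formalCoeff_zero]

theorem norm_xi (m : ℕ) (t : ℂ) : ‖xi m t‖ = Real.exp (-(stepExp m * t.re)) := by
  have := norm_xi_pow m 1 t
  rw [pow_one] at this
  rw [this]
  congr 1
  push_cast
  ring

theorem hasLeading_of_strip {m : ℕ} (hm : 1 ≤ m) {a : Fin m → ℂ} {F : ℂ → ℂ} {ψ η A R : ℝ}
    (hψ : |ψ| < π / 2) (hη : η < π / 2)
    (h : ∀ t : ℂ, |m / 2 * t.im - ψ| ≤ π - η → R ≤ t.re →
      ‖F t - approx m 1 a t‖ ≤ A * ‖leading m a t‖ * ‖xi m t‖ ^ 1) : HasLeading m a F := by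
  have hm1 : (1 : ℝ) ≤ m := by exact_mod_cast hm
  refine ⟨A, R, (π / 2 - η) / m, by have : 0 < π / 2 - η := by linarith
                                    positivity, fun t ht htR => ?_⟩
  have h1 := h t ?_ htR
  · rwa [approx_one, pow_one, norm_xi] at h1
  · rw [le_div_iff₀ (by linarith)] at ht
    have h2 : |m / 2 * t.im| ≤ π / 2 - η := by
      rw [abs_mul, abs_of_nonneg (by positivity)]
      nlinarith [abs_nonneg t.im]
    calc |m / 2 * t.im - ψ| ≤ |m / 2 * t.im| + |ψ| := abs_sub _ _
      _ ≤ _ := by linarith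

/-- One solution is chosen for each a, before K, θ and N. For given K, θ, N, uniqueness identifies
it with the solutions built for two rotated cones, which share the positive axis and together cover
|arg x| ≤ θ. -/
theorem exists_isPhi0 {m : ℕ} (hm : 1 ≤ m) : ∃ F, IsPhi0 m F := by
  have hm1 : (1 : ℝ) ≤ m := by exact_mod_cast hm
  have hm0 : (0 : ℝ) < m := by linarith
  have hπ := Real.pi_pos
  have h0 : ∀ a : Fin m → ℂ, ∃ F, IsSolution m a F ∧ HasLeading m a F := by
    intro a
    obtain ⟨A, R, hA⟩ := exists_solution_strip hm (isCompact_singleton (x := a)) (ψ := 0)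
      (η := π / 4) (by simpa using hπ) (by linarith) (by linarith) 1
    obtain ⟨F, hF, hFb⟩ := hA a rfl
    exact ⟨F, hF, hasLeading_of_strip hm (by simpa using hπ) (by linarith)
      fun t h1 h2 => hFb t h1 h2 1 (Or.inl rfl)⟩
  choose F hF hFL using h0
  refine ⟨F, hF, formalCoeff m, formalCoeff_zero m, fun K hK θ hθ N => ?_⟩
  -- With ψ = ±(π/2 - η) the outer edge of the cone is at (m/2) arg x = ±(3π/2 - 2η), which must
  -- reach ±mθ/2.
  set η := min (π / 4) ((3 * π / 2 - m * θ / 2) / 2) with hη_def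
  have hη4 : η ≤ π / 4 := min_le_left _ _
  have hηθ : 2 * η ≤ 3 * π / 2 - m * θ / 2 := by
    have := min_le_right (π / 4) ((3 * π / 2 - m * θ / 2) / 2)
    linarith
  have hη : 0 < η := by
    refine lt_min (by linarith) ?_
    rw [lt_div_iff₀ hm0] at hθ
    linarith
  have hψ : ∀ σ : ℝ, |σ| = 1 → |σ * (π / 2 - η)| < π / 2 := fun σ hσ => by
    rw [abs_mul, hσ, one_mul, abs_of_nonneg (by linarith)]
    linarith
  obtain ⟨A₁, R₁, hA₁⟩ := exists_solution_strip hm hK (hψ 1 (by simp)) hη (by linarith) N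
  obtain ⟨A₂, R₂, hA₂⟩ := exists_solution_strip hm hK (hψ (-1) (by simp)) hη (by linarith) N
  refine ⟨max A₁ A₂, max R₁ R₂, fun a ha t ht htR => ?_⟩
  have hsum : leading m a t * ∑ n ∈ Finset.range N,
      MvPolynomial.eval a (formalCoeff m n) * exp (-(n * stepExp m : ℝ) * t) = approx m N a t := by
    rw [approx, ev_formalPol]
    congr 1
    refine Finset.sum_congr rfl fun n _ => ?_
    rw [xi_pow]
    congr 2
    push_cast
    ring
  rw [hsum, ← norm_xi_pow]
  have key : ∀ {σ A R : ℝ}, |σ| = 1 → (∀ a ∈ K, ∃ F, IsSolution m a F ∧ ∀ t : ℂ,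
      |m / 2 * t.im - σ * (π / 2 - η)| ≤ π - η → R ≤ t.re → ∀ j, j = 1 ∨ j = N →
        ‖F t - approx m j a t‖ ≤ A * ‖leading m a t‖ * ‖xi m t‖ ^ j) → A ≤ max A₁ A₂ →
      |m / 2 * t.im - σ * (π / 2 - η)| ≤ π - η → R ≤ t.re →
      ‖F a t - approx m N a t‖ ≤ max A₁ A₂ * ‖leading m a t‖ * ‖xi m t‖ ^ N := by
    intro σ A R hσ hA hAm hσt htR
    obtain ⟨G, hG, hGb⟩ := hA a ha
    have h1 : F a = G := HasLeading.unique hm (hF a) hG (hFL a) (hasLeading_of_strip hm (hψ σ hσ)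
      (by linarith) fun t h1 h2 => hGb t h1 h2 1 (Or.inl rfl))
    rw [h1]
    refine (hGb t hσt htR N (Or.inr rfl)).trans ?_
    gcongr
  have h3 : |m / 2 * t.im| ≤ m * θ / 2 := by
    rw [abs_mul, abs_of_nonneg (by positivity)]
    nlinarith
  have h3' := abs_le.1 h3
  rcases le_or_gt 0 t.im with h | h
  · refine key (by simp) hA₁ (le_max_left _ _) ?_ ((le_max_left _ _).trans htR)
    have h4 : 0 ≤ m / 2 * t.im := by positivity
    rw [abs_le]
    constructor <;> linarith
  · refine key (by simp) hA₂ (le_max_right _ _) ?_ ((le_max_right _ _).trans htR)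
    have h4 : m / 2 * t.im ≤ 0 := mul_nonpos_of_nonneg_of_nonpos (by positivity) h.le
    rw [abs_le]
    constructor <;> linarith

/-! ### The solutions `Φ_k` -/

theorem isPhi0_Phi0 {m : ℕ} (hm : 1 ≤ m) : IsPhi0 m (Phi0 m) := by
  have h := exists_isPhi0 hm
  unfold Phi0
  rw [dif_pos h]
  exact h.choose_spec

theorem Phi0_bound {m : ℕ} (hm : 1 ≤ m) (a : Fin m → ℂ) {θ : ℝ} (hθ : θ < 3 * π / m) :
    ∃ A R : ℝ, ∀ t : ℂ, |t.im| ≤ θ → R ≤ t.re →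
      ‖Phi0 m a t - leading m a t‖ ≤ A * ‖leading m a t‖ * Real.exp (-(stepExp m * t.re)) := by
  obtain ⟨-, c, hc0, hc⟩ := isPhi0_Phi0 hm
  obtain ⟨A, R, hA⟩ := hc {a} isCompact_singleton θ hθ 1
  refine ⟨A, R, fun t h1 h2 => ?_⟩
  have h3 := hA a rfl t h1 h2
  simpa [hc0] using h3

theorem sqrtCoeff_scale {l : ℂ} {c d : ℕ → ℂ} (h : ∀ k, d k = l ^ k * c k) (k : ℕ) :
    sqrtCoeff d k = l ^ k * sqrtCoeff c k := by
  induction k using Nat.strong_induction_on with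
  | _ k ih =>
    cases k with
    | zero => simp [sqrtCoeff]
    | succ k =>
      rw [sqrtCoeff.eq_2 d, sqrtCoeff.eq_2 c, h, ← mul_div_assoc, mul_sub, Finset.mul_sum]
      congr 2
      refine Finset.sum_congr rfl fun i _ => ?_
      have hi := i.isLt
      rw [ih _ (by omega), ih _ (by omega), show k + 1 = ((i : ℕ) + 1) + (k - i) by omega, pow_add]
      ring

theorem b_scale (m : ℕ) (a : Fin m → ℂ) (l : ℂ) (k : ℕ) :
    b m (scale l a) k = l ^ k * b m a k := by
  refine sqrtCoeff_scale (fun k => ?_) k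
  cases k with
  | zero => simp [revCoeff]
  | succ k =>
    simp only [revCoeff, scale]
    split_ifs <;> simp

/-- The rotation multiplies x^{m/2-k} by e^{iπ} ω^{-k}, and the weight ω^k of b_{m/2-k} cancels the
second factor. So one turn by ω changes the sign of every term of S and of `sqrtP`. -/
theorem omega_pow_mul_exp {m : ℕ} (hm : 1 ≤ m) (k : ℕ) (t : ℂ) :
    omega m ^ k * exp ((m / 2 - k) * (t + 2 * π * I / m)) = -exp ((m / 2 - k) * t) := by
  have hm0 : (m : ℂ) ≠ 0 := Nat.cast_ne_zero.2 (by omega)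
  rw [omega, ← exp_nat_mul, ← exp_add]
  have h1 : k * (2 * π * I / m) + (m / 2 - k) * (t + 2 * π * I / m) =
      (m / 2 - k) * t + π * I := by
    field_simp
    ring
  rw [h1, exp_add, exp_pi_mul_I, mul_neg_one]

theorem sqrtP_scale {m : ℕ} (hm : 1 ≤ m) (a : Fin m → ℂ) (t : ℂ) :
    sqrtP m (scale (omega m) a) (t + 2 * π * I / m) = -sqrtP m a t := by
  rw [sqrtP, sqrtP, ← Finset.sum_neg_distrib]
  refine Finset.sum_congr rfl fun k _ => ?_
  rw [b_scale, mul_comm (omega m ^ k), mul_assoc, omega_pow_mul_exp hm]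
  ring

theorem S_scale {m : ℕ} (hm : 1 ≤ m) (a : Fin m → ℂ) (t : ℂ) :
    S m (scale (omega m) a) (t + 2 * π * I / m) = -S m a t := by
  have h0 := omega_pow_mul_exp hm 0 t
  simp only [pow_zero, one_mul, Nat.cast_zero, sub_zero] at h0
  rw [S, S, h0, neg_add, ← Finset.sum_neg_distrib]
  congr 1
  · ring
  · refine Finset.sum_congr rfl fun k _ => ?_
    rw [b_scale, mul_comm (omega m ^ k), mul_div_right_comm, mul_assoc, omega_pow_mul_exp hm]
    ring

/-- For even m the coefficient b_0 has weight m/2 and changes sign, as ω^{m/2} = -1. -/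
theorem r_scale {m : ℕ} (hm : 1 ≤ m) (a : Fin m → ℂ) :
    r m (scale (omega m) a) = 1 - m / 2 - r m a := by
  unfold r
  split_ifs with h
  · have h1 : omega m ^ (m / 2) = -1 := by
      have h2 := omega_pow_mul_exp hm (m / 2) 0
      have h3 : ((m / 2 : ℕ) : ℂ) = m / 2 := Nat.cast_div_charZero h.two_dvd
      rw [h3] at h2
      simpa using h2
    rw [b_scale, h1]
    ring
  · ring

/-- The exponentials are inverse to each other, and the two exponents r add up to 1 - m/2. -/
theorem exp_neg_mul_leading {m : ℕ} (hm : 1 ≤ m) (a : Fin m → ℂ) (t : ℂ) :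
    exp (-t) * leading m a t * leading m (scale (omega m) a) (t + 2 * π * I / m) =
      omegaPow m (r m (scale (omega m) a)) * exp (-(m / 2 * t)) := by
  rw [leading, leading, S_scale hm, omegaPow]
  simp only [← exp_add]
  congr 1
  rw [r_scale hm]
  ring

theorem Phi_zero (m : ℕ) (a : Fin m → ℂ) : Phi m 0 a = Phi0 m a := by
  funext t
  simp [Phi, scale_one]

theorem Phi_shift (m : ℕ) (k l : ℤ) (a : Fin m → ℂ) (t : ℂ) :
    Phi m k (scale (omega m ^ l) a) (t + 2 * π * I * l / m) = Phi m (k + l) a t := by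
  rw [Phi, Phi, scale_scale, ← zpow_add₀ (omega_ne_zero m)]
  congr 1
  push_cast
  ring

theorem isSolution_Phi {m : ℕ} (hm : 1 ≤ m) (k : ℤ) (a : Fin m → ℂ) : IsSolution m a (Phi m k a) :=
  ((isPhi0_Phi0 hm).1 _).shift (omega_zpow_pow hm k) (omega_zpow m k).symm

theorem wr_Phi_shift (m : ℕ) (k k' l : ℤ) (a : Fin m → ℂ) (t : ℂ) :
    wr (Phi m (k + l) a) (Phi m (k' + l) a) t =
      omega m ^ l * wr (Phi m k (scale (omega m ^ l) a)) (Phi m k' (scale (omega m ^ l) a))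
        (t + 2 * π * I * l / m) := by
  have h : ∀ k, Phi m (k + l) a = fun t => Phi m k (scale (omega m ^ l) a) (t + 2 * π * I * l / m) :=
    fun k => funext fun t => (Phi_shift m k l a t).symm
  rw [h, h, wr_shift, omega_zpow]

/-- On the positive axis both expansions are valid. The product e^{-x} L₁ L₂ is ω^{r(ω·a)} times the
power -m/2 of the variable, while E₂ - E₁ = 2 `sqrtP` is equivalent to twice its power m/2. -/
theorem wr_Phi_zero_one {m : ℕ} (hm : 1 ≤ m) (a : Fin m → ℂ) (t : ℂ) :
    wr (Phi m 0 a) (Phi m 1 a) t = 2 * omegaPow m (r m (scale (omega m) a)) := by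
  have hm0 : (0 : ℝ) < m := by exact_mod_cast hm
  have hπ := Real.pi_pos
  set c : ℂ := 2 * π * I / m with hc
  -- For Φ_1 the argument is displaced by 2π/m; this width keeps the strip inside the sector, since
  -- δ + 2π/m < 3π/m.
  set δ : ℝ := π / (2 * m) with hδ
  have hδ0 : 0 < δ := by positivity
  have hcre : c.re = 0 := by
    have : c = ((2 * π / m : ℝ) : ℂ) * I := by rw [hc]; push_cast; ring
    rw [this, re_ofReal_mul, I_re, mul_zero]
  have hcim : c.im = 2 * π / m := by
    have : c = ((2 * π / m : ℝ) : ℂ) * I := by rw [hc]; push_cast; ring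
    rw [this, im_ofReal_mul, I_im, mul_one]
  have hθ : δ + 2 * π / m < 3 * π / m := by
    rw [hδ, ← sub_pos]
    have : 3 * π / m - (π / (2 * m) + 2 * π / m) = π / (2 * m) := by field_simp; ring
    rw [this]
    positivity
  have hθ' : δ < 3 * π / m := lt_of_le_of_lt (by have : 0 < 2 * π / m := by positivity
                                                 linarith) hθ
  obtain ⟨A₁, R₁, hA₁⟩ := Phi0_bound hm a hθ'
  obtain ⟨A₂, R₂, hA₂⟩ := Phi0_bound hm (scale (omega m) a) hθ
  have hPhi1 : ∀ t, Phi m 1 a t = Phi0 m (scale (omega m) a) (t + c) := fun t => by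
    simp [Phi, hc]
  have hL := hasDerivAt_leading hm a
  have hL' : ∀ t, HasDerivAt (fun t => leading m (scale (omega m) a) (t + c))
      ((nu m + sqrtP m a t) * leading m (scale (omega m) a) (t + c)) t := fun t => by
    have h := (hasDerivAt_leading hm (scale (omega m) a) (t + c)).comp_add_const t c
    rwa [sqrtP_scale hm, sub_neg_eq_add] at h
  have hprod : ∀ x : ℝ, exp (-x) * leading m a x * leading m (scale (omega m) a) (x + c) =
      omegaPow m (r m (scale (omega m) a)) * exp (-(m / 2 * x)) := fun x =>
    exp_neg_mul_leading hm a x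
  have h0 : Tendsto (fun x : ℝ => exp (-(m / 2 * x : ℂ))) atTop (𝓝 0) := by
    rw [tendsto_zero_iff_norm_tendsto_zero]
    refine (tendsto_exp_neg_mul (h := m / 2) (by positivity) 1).congr fun x => ?_
    rw [norm_exp, one_mul]
    congr 1
    have : (-(m / 2 * x : ℂ)) = ((-(m / 2 * x) : ℝ) : ℂ) := by push_cast; ring
    rw [this, ofReal_re]
  have hlim₀ : Tendsto (fun x : ℝ => exp (-x) * leading m a x *
      (fun t => leading m (scale (omega m) a) (t + c)) x) atTop (𝓝 0) := by
    simp only [hprod]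
    simpa using h0.const_mul (omegaPow m (r m (scale (omega m) a)))
  have hlim : Tendsto (fun x : ℝ => exp (-x) * leading m a x *
      (fun t => leading m (scale (omega m) a) (t + c)) x *
        ((fun t => nu m + sqrtP m a t) x - (fun t => nu m - sqrtP m a t) x)) atTop
      (𝓝 (2 * omegaPow m (r m (scale (omega m) a)))) := by
    simp only [hprod]
    have h1 := (tendsto_ev_sqrtPol m a).const_mul (2 * omegaPow m (r m (scale (omega m) a)))
    rw [mul_one] at h1
    refine h1.congr fun x => ?_
    have h2 : exp (-(m / 2 * x : ℂ)) * zeta m x = 1 := by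
      rw [zeta, ← exp_add, neg_add_cancel, exp_zero]
    rw [sqrtP_eq]
    linear_combination (-2 * omegaPow m (r m (scale (omega m) a)) *
      ev a (xi m x) (sqrtPol m)) * h2
  have h3 := tendsto_wr (u₁ := Phi m 0 a) (u₂ := Phi m 1 a) (A := max A₁ A₂) (R := max R₁ R₂)
    (δ := δ) (isSolution_Phi hm 0 a).1 (isSolution_Phi hm 1 a).1 hL hL'
    (leading_ne_zero m a) (fun t => leading_ne_zero m _ _) hδ0 (stepExp_pos m)
    (fun t h1 h2 => by
      rw [Phi_zero]
      exact (hA₁ t h1 ((le_max_left _ _).trans h2)).trans (by gcongr; exact le_max_left _ _))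
    (fun t h1 h2 => by
      have h4 : (t + c).re = t.re := by rw [add_re, hcre, add_zero]
      have h5 : |(t + c).im| ≤ δ + 2 * π / m := by
        rw [add_im, hcim]
        refine (abs_add_le _ _).trans (add_le_add h1 (abs_of_nonneg (by positivity)).le)
      have h6 := hA₂ (t + c) h5 (by rw [h4]; exact (le_max_right _ _).trans h2)
      rw [h4] at h6
      rw [hPhi1]
      exact h6.trans (by gcongr; exact le_max_right _ _))
    hlim₀ hlim
  refine tendsto_nhds_unique (tendsto_const_nhds.congr fun x : ℝ => ?_) h3
  exact wr_const (isSolution_Phi hm 0 a) (isSolution_Phi hm 1 a) t x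

theorem omegaPow_ne_zero (m : ℕ) (α : ℂ) : omegaPow m α ≠ 0 := exp_ne_zero _

theorem omegaPow_add (m : ℕ) (α β : ℂ) : omegaPow m (α + β) = omegaPow m α * omegaPow m β := by
  rw [omegaPow, omegaPow, omegaPow, ← exp_add]
  congr 1
  ring

theorem omega_zpow_eq (m : ℕ) (k : ℤ) : omega m ^ k = omegaPow m k := by
  rw [omega_zpow, omegaPow]

theorem wr_Phi_zero_one_ne_zero {m : ℕ} (hm : 1 ≤ m) (a : Fin m → ℂ) (t : ℂ) :
    wr (Phi m 0 a) (Phi m 1 a) t ≠ 0 := by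
  rw [wr_Phi_zero_one hm]
  exact mul_ne_zero two_ne_zero (omegaPow_ne_zero _ _)

theorem wr_Phi_neg_one_zero {m : ℕ} (hm : 1 ≤ m) (a : Fin m → ℂ) (t : ℂ) :
    wr (Phi m (-1) a) (Phi m 0 a) t = 2 * omegaPow m (r m a - 1) := by
  have h := wr_Phi_shift m 0 1 (-1) a t
  norm_num only at h
  rw [wr_Phi_zero_one hm, scale_scale, zpow_neg_one, mul_inv_cancel₀ (omega_ne_zero m),
    scale_one] at h
  rw [h, sub_eq_add_neg, omegaPow_add, ← zpow_neg_one, omega_zpow_eq]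
  push_cast
  ring

/-- The defining relation of the Stokes–Sibuya coefficients, with the explicit value of `C̃_0`. -/
theorem Phi_neg_one_eq {m : ℕ} (hm : 1 ≤ m) (a : Fin m → ℂ) (t : ℂ) :
    Phi m (-1) a t = C m 0 a * Phi m 0 a t +
      -omegaPow m (2 * r m a - 2 + m / 2) * Phi m 1 a t := by
  have hex : ∃ c : ℂ × ℂ, ∀ t, Phi m (0 - 1) a t = c.1 * Phi m 0 a t + c.2 * Phi m (0 + 1) a t :=
    ⟨(_, _), fun t => (isSolution_Phi hm (0 - 1) a).eq_combination (isSolution_Phi hm 0 a)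
      (isSolution_Phi hm (0 + 1) a) (by simpa using wr_Phi_zero_one_ne_zero hm a 0) t⟩
  have hspec := hex.choose_spec
  have hC : hex.choose = stokesSibuya m 0 a := by rw [stokesSibuya, dif_pos hex]
  rw [hC] at hspec
  simp only [zero_sub, zero_add] at hspec
  have h1 : Phi m (-1) a = fun t => (stokesSibuya m 0 a).1 * Phi m 0 a t +
      (stokesSibuya m 0 a).2 * Phi m 1 a t := funext hspec
  -- Pairing the relation with Φ_0 removes C_0 and isolates C̃_0.
  have h2 := wr_Phi_neg_one_zero hm a 0
  rw [wr_swap (Phi m 0 a), h1, wr_linear (isSolution_Phi hm 0 a).1 (isSolution_Phi hm 1 a).1,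
    wr_self, wr_Phi_zero_one hm, mul_zero, zero_add] at h2
  have h3 : (stokesSibuya m 0 a).2 = -omegaPow m (2 * r m a - 2 + m / 2) := by
    have h4 : omegaPow m (2 * r m a - 2 + m / 2) * omegaPow m (r m (scale (omega m) a)) =
        omegaPow m (r m a - 1) := by
      rw [← omegaPow_add, r_scale hm]
      congr 1
      ring
    refine mul_right_cancel₀ (omegaPow_ne_zero m (r m (scale (omega m) a))) ?_
    linear_combination (-1 / 2 : ℂ) * h2 + h4
  rw [hspec t, h3, C]

/-! ### The canonical solutions at the origin -/

theorem isFrobeniusPair_frobenius {m : ℕ} (hm : 1 ≤ m) (a' : Fin (m - 1) → ℂ) {p : ℂ}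
    (hp : ∀ n : ℕ, p ≠ -((n : ℂ) + 1)) : IsFrobeniusPair m a' p (frobenius m a' p) := by
  have h := exists_isFrobeniusPair hm a' hp
  unfold frobenius
  rw [dif_pos h]
  exact h.choose_spec

/-- After division by ω^{k s(p)} the rotated function is again a solution with exponent s(p) and
leading coefficient 1, so `eq_of_exponent` applies. -/
theorem frobenius_scale {m : ℕ} (hm : 1 ≤ m) (a' : Fin (m - 1) → ℂ) {p : ℂ}
    (hp : ∀ n : ℕ, p ≠ -((n : ℂ) + 1)) (k : ℤ) (t : ℂ) :
    (frobenius m (scale (omega m ^ k) a') p).1 (t + 2 * π * I * k / m) =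
      omegaPow m (k * s p) * (frobenius m a' p).1 t := by
  obtain ⟨hs1, -, -, g, -, hg, -, hg0, hf, -⟩ := isFrobeniusPair_frobenius hm a' hp
  obtain ⟨hs1', -, -, h, -, hh, -, hh0, hf', -⟩ :=
    isFrobeniusPair_frobenius hm (scale (omega m ^ k) a') hp
  rw [← ofPrime_scale hm (omega_zpow_pow hm k)] at hs1'
  have h1 : ∀ t, (frobenius m (scale (omega m ^ k) a') p).1 (t + 2 * π * I * k / m) =
      omegaPow m (k * s p) * (exp (s p * t) * h (omega m ^ k * exp t)) := fun t => by
    rw [hf', omegaPow, ← mul_assoc, ← exp_add, exp_add t, ← omega_zpow, mul_comm (exp t)]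
    congr 2
    ring
  have h2 := ((hs1'.shift (omega_zpow_pow hm k) (omega_zpow m k).symm).linear
    (hs1'.shift (omega_zpow_pow hm k) (omega_zpow m k).symm) (omegaPow m (k * s p))⁻¹ 0)
  have h3 := eq_of_exponent hm hp (g := g) (h := fun x => h (omega m ^ k * x)) hg
    (hh.comp (differentiable_id.const_mul _)) hg0 (by simpa using hh0)
    (by simpa only [← hf] using hs1) (by
      refine (congrArg (IsSolution m _) (funext fun t => ?_)).mp h2
      rw [h1, zero_mul, add_zero, inv_mul_cancel_left₀ (omegaPow_ne_zero _ _)])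
  rw [h1, hf, h3]

/-- Pairing with f_1 kills the f_1-component. Thus f_2 enters only through W(f_1, f_2), and its own
behaviour under rotation, with possible logarithms, is never needed. -/
theorem Ltilde_spec {m : ℕ} (hm : 1 ≤ m) (a' : Fin (m - 1) → ℂ) {p : ℂ}
    (hp : ∀ n : ℕ, p ≠ -((n : ℂ) + 1)) (t : ℂ) :
    wr (frobenius m a' p).1 (Phi m (-1) (ofPrime m a' p)) t =
      Ltilde m 0 a' p * if p = 0 then 1 else -p := by
  have hF := isFrobeniusPair_frobenius hm a' hp
  have hex : ∃ M : Matrix (Fin 2) (Fin 2) ℂ, ∀ t,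
      ![Phi m (0 - 1) (ofPrime m a' p) t, Phi m 0 (ofPrime m a' p) t] =
        M.mulVec ![(frobenius m a' p).1 t, (frobenius m a' p).2 t] := by
    have h1 : ∀ k, ∃ α β : ℂ, ∀ t, Phi m k (ofPrime m a' p) t =
        α * (frobenius m a' p).1 t + β * (frobenius m a' p).2 t := fun k =>
      ⟨_, _, (isSolution_Phi hm k (ofPrime m a' p)).eq_combination hF.1 hF.2.1
        (hF.wr_ne_zero hp 0)⟩
    choose α β h1 using h1
    refine ⟨!![α (0 - 1), β (0 - 1); α 0, β 0], fun t => ?_⟩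
    rw [h1 (0 - 1), h1 0]
    funext i
    fin_cases i <;> simp [Matrix.mulVec, dotProduct, Fin.sum_univ_two]
  have hM : hex.choose = connection m 0 a' p := by rw [connection, dif_pos hex]
  have hspec := hex.choose_spec
  rw [hM] at hspec
  have h1 : Phi m (-1) (ofPrime m a' p) = fun t =>
      connection m 0 a' p 0 0 * (frobenius m a' p).1 t +
        connection m 0 a' p 0 1 * (frobenius m a' p).2 t := by
    funext t
    simpa [Matrix.mulVec, dotProduct, Fin.sum_univ_two] using congrFun (hspec t) 0
  rw [h1, wr_linear hF.1.1 hF.2.1.1, wr_self, hF.wr_eq hp, mul_zero, zero_add, Ltilde]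

theorem wr_const_mul (α β : ℂ) {u v : ℂ → ℂ} (t : ℂ) :
    wr (fun t => α * u t) (fun t => β * v t) t = α * β * wr u v t := by
  unfold wr
  rw [deriv_const_mul_field, deriv_const_mul_field]
  ring

/-- Rotation by ω^k turns Φ_{-1} into Φ_{k-1}, multiplies the Wronskian by ω^k and f_1 by ω^{k
s(p)}. -/
theorem wr_frobenius_Phi {m : ℕ} (hm : 1 ≤ m) (a' : Fin (m - 1) → ℂ) {p : ℂ}
    (hp : ∀ n : ℕ, p ≠ -((n : ℂ) + 1)) (k : ℕ) (t : ℂ) :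
    wr (frobenius m a' p).1 (Phi m (k - 1) (ofPrime m a' p)) t =
      omegaPow m (k * (1 - s p)) * Ltilde m 0 (scale (omega m ^ k) a') p *
        if p = 0 then 1 else -p := by
  have h1 := Ltilde_spec hm (scale (omega m ^ k) a') hp (t + 2 * π * I * (k : ℤ) / m)
  have h2 := wr_shift (frobenius m (scale (omega m ^ k) a') p).1
    (Phi m (-1) (ofPrime m (scale (omega m ^ k) a') p)) (2 * π * I * (k : ℤ) / m) t
  rw [h1, ← omega_zpow] at h2
  have h3 : (fun t => (frobenius m (scale (omega m ^ k) a') p).1 (t + 2 * π * I * (k : ℤ) / m)) =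
      fun t => omegaPow m (k * s p) * (frobenius m a' p).1 t := funext fun t => by
    have := frobenius_scale hm a' hp k t
    rwa [zpow_natCast] at this
  have h4 : (fun t => Phi m (-1) (ofPrime m (scale (omega m ^ k) a') p)
      (t + 2 * π * I * (k : ℤ) / m)) =
      fun t => 1 * Phi m (k - 1) (ofPrime m a' p) t := funext fun t => by
    have := Phi_shift m (-1) k (ofPrime m a' p) t
    rw [ofPrime_scale hm (omega_zpow_pow hm k), zpow_natCast] at this
    rw [this, one_mul, neg_add_eq_sub]
  rw [h3, h4, wr_const_mul, mul_one, omega_zpow_eq] at h2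
  refine mul_left_cancel₀ (omegaPow_ne_zero m (k * s p)) (h2.trans ?_)
  rw [← mul_assoc, ← mul_assoc, ← mul_assoc, ← omegaPow_add]
  congr 3
  push_cast
  ring

/-- The relation between the Stokes–Sibuya coefficient `C_0` and the connection coefficient. -/
theorem C_mul_Ltilde {m : ℕ} (hm : 1 ≤ m) (a' : Fin (m - 1) → ℂ) {p : ℂ}
    (hp : ∀ n : ℕ, p ≠ -((n : ℂ) + 1)) :
    C m 0 (ofPrime m a' p) * Ltilde m 0 (scale (omega m) a') p =
      omegaPow m (s p - 1) * Ltilde m 0 a' p +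
        omegaPow m (2 * r m (ofPrime m a' p) - 1 + m / 2 - s p) *
          Ltilde m 0 (scale (omega m ^ 2) a') p := by
  set a := ofPrime m a' p with ha
  have hD : (if p = 0 then 1 else -p) ≠ 0 := by
    split_ifs with h
    · exact one_ne_zero
    · exact neg_ne_zero.2 h
  -- The cases k = 0, 1, 2 are the pairings of f_1 with Φ_{-1}, Φ_0 and Φ_1.
  have h0 := wr_frobenius_Phi hm a' hp 0 0
  have h1 := wr_frobenius_Phi hm a' hp 1 0
  have h2 := wr_frobenius_Phi hm a' hp 2 0
  norm_num only [Nat.cast_zero, Nat.cast_one, Nat.cast_ofNat] at h0 h1 h2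
  simp only [zero_mul, one_mul, pow_zero, pow_one, scale_one, ← ha] at h0 h1 h2
  have h3 : omegaPow m 0 = 1 := by simp [omegaPow]
  have h4 : Phi m (-1) a = fun t => C m 0 a * Phi m 0 a t +
      -omegaPow m (2 * r m a - 2 + m / 2) * Phi m 1 a t := funext (Phi_neg_one_eq hm a)
  rw [h4, wr_linear (isSolution_Phi hm 0 a).1 (isSolution_Phi hm 1 a).1, h1, h2, h3] at h0
  have h5 : omegaPow m (s p - 1) * omegaPow m (1 - s p) = 1 := by
    rw [← omegaPow_add, ← h3]
    congr 1
    ring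
  have h6 : omegaPow m (2 * r m a - 1 + m / 2 - s p) =
      omegaPow m (s p - 1) * (omegaPow m (2 * r m a - 2 + m / 2) * omegaPow m (2 * (1 - s p))) := by
    rw [← omegaPow_add, ← omegaPow_add]
    congr 1
    ring
  refine mul_right_cancel₀ hD ?_
  rw [h6]
  linear_combination omegaPow m (s p - 1) * h0 -
    C m 0 a * Ltilde m 0 (scale (omega m) a') p * (if p = 0 then 1 else -p) * h5

/-! ### The cases m = 1, m = 2 and general m -/

theorem scale_one_sub_one (l : ℂ) (a' : Fin (1 - 1) → ℂ) : scale l a' = a' :=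
  funext fun i => absurd i.isLt (by omega)

/-- For m = 1 the tuple a' is empty, so L̃_0 = 0 would make f_1 have zero Wronskian with both Φ_{-1}
and Φ_0. These form a basis, which would force f_1 = 0. -/
theorem Ltilde_one_ne_zero (a' : Fin (1 - 1) → ℂ) {p : ℂ} (hp : ∀ n : ℕ, p ≠ -((n : ℂ) + 1)) :
    Ltilde 1 0 a' p ≠ 0 := by
  intro h
  have hF := isFrobeniusPair_frobenius le_rfl a' hp
  have hw : ∀ (k : ℕ) t, wr (frobenius 1 a' p).1 (Phi 1 (k - 1) (ofPrime 1 a' p)) t = 0 := by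
    intro k t
    rw [wr_frobenius_Phi le_rfl a' hp, scale_one_sub_one, h]
    ring
  have h0 : ∀ t, (frobenius 1 a' p).1 t = 0 := by
    intro t
    have h1 := wr_cramer (frobenius 1 a' p).1 (Phi 1 (-1) (ofPrime 1 a' p))
      (Phi 1 0 (ofPrime 1 a' p)) t
    have h2 := hw 0 t
    have h3 := hw 1 t
    norm_num only [Nat.cast_zero, Nat.cast_one] at h2 h3
    rw [wr_swap (frobenius 1 a' p).1, h2, h3, wr_Phi_neg_one_zero le_rfl, neg_zero, mul_zero,
      mul_zero, add_zero, add_zero] at h1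
    exact (mul_eq_zero.1 h1).resolve_right (mul_ne_zero two_ne_zero (omegaPow_ne_zero _ _))
  refine hF.wr_ne_zero hp 0 ?_
  rw [show (frobenius 1 a' p).1 = fun _ => 0 from funext h0]
  simp [wr]

/-- The cosine is even in p, so the determination of the square root may be chosen outside the
negative integers, where L̃_0 is nonzero and can be cancelled. -/
theorem C_one (a : Fin 1 → ℂ) {p : ℂ} (hp : p ^ 2 = 1 + 4 * a 0) :
    C 1 0 a = -2 * Complex.cos (π * p) := by
  obtain ⟨q, hq, hqn⟩ := exists_sign p
  have hcos : Complex.cos (π * p) = Complex.cos (π * q) := by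
    rcases hq with rfl | rfl
    · rfl
    · rw [mul_neg, Complex.cos_neg]
  have hq2 : q ^ 2 = p ^ 2 := by rcases hq with rfl | rfl <;> ring
  have ha := ofPrime_eq a (p := q) fun _ => hq2.trans hp
  set a' : Fin (1 - 1) → ℂ := fun i => a ⟨i, by omega⟩
  have h := C_mul_Ltilde le_rfl a' hqn
  rw [← ha, scale_one_sub_one, scale_one_sub_one, ← add_mul] at h
  rw [mul_right_cancel₀ (Ltilde_one_ne_zero a' hqn) h, hcos]
  have hr : r 1 a = 1 / 4 := by
    rw [r, if_neg (by decide)]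
    norm_num
  have h1 : omegaPow 1 (s q - 1) = -exp (π * q * I) := by
    rw [omegaPow, s, show 2 * π * I * ((1 + q) / 2 - 1) / ((1 : ℕ) : ℂ) = π * q * I - π * I by
      push_cast; ring, exp_sub, exp_pi_mul_I, div_neg, div_one]
  have h2 : omegaPow 1 (2 * r 1 a - 1 + (1 : ℕ) / 2 - s q) = -exp (-(π * q) * I) := by
    rw [omegaPow, s, hr, show 2 * π * I * (2 * (1 / 4) - 1 + ((1 : ℕ) : ℂ) / 2 - (1 + q) / 2) /
      ((1 : ℕ) : ℂ) = -(π * q) * I - π * I by push_cast; ring, exp_sub, exp_pi_mul_I, div_neg,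
      div_one]
  rw [h1, h2, Complex.cos]
  ring

/-- As ω² = 1, both terms on the right contain the same L̃_0, and r = -a_1/2 makes their
coefficients the two exponentials of a cosine. -/
theorem C_two_mul_Ltilde (a' : Fin 1 → ℂ) {p : ℂ} (hp : ∀ n : ℕ, p ≠ -((n : ℂ) + 1)) :
    C 2 0 (ofPrime 2 a' p) * Ltilde 2 0 (scale (omega 2) a') p =
      -2 * I * exp (-I * π * (a' 0 / 2)) * Complex.cos (π / 2 * (p + a' 0)) *
        Ltilde 2 0 a' p := by
  have h := C_mul_Ltilde one_le_two a' hp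
  rw [omega_pow_self one_le_two, scale_one, ← add_mul] at h
  rw [h]
  congr 1
  have hr : r 2 (ofPrime 2 a' p) = -(a' 0 / 2) := by
    have h1 : b 2 (ofPrime 2 a' p) 1 = a' 0 / 2 := by
      rw [b, sqrtCoeff]
      simp [revCoeff, ofPrime]
    rw [r, if_pos even_two, Nat.div_self two_pos, h1]
    push_cast
    ring
  have hI : ∀ z, -I * z = exp (-π / 2 * I) * z := fun z => by rw [exp_neg_pi_div_two_mul_I]
  have h1 : omegaPow 2 (s p - 1) =
      -I * (exp (-I * π * (a' 0 / 2)) * exp (π / 2 * (p + a' 0) * I)) := by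
    rw [omegaPow, s, hI, ← exp_add, ← exp_add]
    congr 1
    push_cast
    ring
  have h2 : omegaPow 2 (2 * r 2 (ofPrime 2 a' p) - 1 + (2 : ℕ) / 2 - s p) =
      -I * (exp (-I * π * (a' 0 / 2)) * exp (-(π / 2 * (p + a' 0)) * I)) := by
    rw [omegaPow, s, hr, hI, ← exp_add, ← exp_add]
    congr 1
    push_cast
    ring
  rw [h1, h2, Complex.cos]
  ring

theorem C_mul_Ltilde_factored {m : ℕ} (hm : 1 ≤ m) (a' : Fin (m - 1) → ℂ) {p : ℂ}
    (hp : ∀ n : ℕ, p ≠ -((n : ℂ) + 1)) :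
    C m 0 (ofPrime m a' p) * Ltilde m 0 (scale (omega m) a') p =
      omegaPow m (r m (ofPrime m a' p) - 1 + m / 4) *
        (Ltilde m 0 a' p * omegaPow m (-r m (ofPrime m a' p) + 1 / 2 - m / 4 + p / 2) +
          Ltilde m 0 (scale (omega m ^ 2) a') p *
            omegaPow m (r m (ofPrime m a' p) - 1 / 2 + m / 4 - p / 2)) := by
  rw [C_mul_Ltilde hm a' hp]
  set ρ := r m (ofPrime m a' p)
  have h1 : omegaPow m (s p - 1) =
      omegaPow m (ρ - 1 + m / 4) * omegaPow m (-ρ + 1 / 2 - m / 4 + p / 2) := by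
    rw [← omegaPow_add, s]
    congr 1
    ring
  have h2 : omegaPow m (2 * ρ - 1 + m / 2 - s p) =
      omegaPow m (ρ - 1 + m / 4) * omegaPow m (ρ - 1 / 2 + m / 4 - p / 2) := by
    rw [← omegaPow_add, s]
    congr 1
    ring
  rw [h1, h2]
  ring

end StokesSibuya

/-! ### The corollary -/

open StokesSibuya in
theorem corollary6p6 :
    (∀ (a : Fin 1 → ℂ) (p : ℂ), p ^ 2 = 1 + 4 * a 0 →
      C 1 0 a = -2 * Complex.cos (π * p)) ∧
    (∀ (a' : Fin 1 → ℂ) (p : ℂ), (∀ n : ℕ, p ≠ -(n : ℂ)) →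
      C 2 0 (ofPrime 2 a' p) * Ltilde 2 0 (scale (omega 2) a') p =
        -2 * Complex.I * Complex.exp (-Complex.I * π * (a' 0 / 2)) *
          Complex.cos (π / 2 * (p + a' 0)) * Ltilde 2 0 a' p) ∧
    (∀ m : ℕ, 3 ≤ m → ∀ (a' : Fin (m - 1) → ℂ) (p : ℂ), (∀ n : ℕ, p ≠ -(n : ℂ)) →
      C m 0 (ofPrime m a' p) * Ltilde m 0 (scale (omega m) a') p =
        omegaPow m (r m (ofPrime m a' p) - 1 + m / 4) *
          (Ltilde m 0 a' p *
              omegaPow m (-r m (ofPrime m a' p) + 1 / 2 - m / 4 + p / 2) +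
            Ltilde m 0 (scale (omega m ^ 2) a') p *
              omegaPow m (r m (ofPrime m a' p) - 1 / 2 + m / 4 - p / 2))) := by
  have hneg : ∀ {p : ℂ}, (∀ n : ℕ, p ≠ -(n : ℂ)) → ∀ n : ℕ, p ≠ -((n : ℂ) + 1) :=
    fun hp n => by simpa using hp (n + 1)
  exact ⟨fun a p hp => C_one a hp, fun a' p hp => C_two_mul_Ltilde a' (hneg hp),
    fun m hm a' p hp => C_mul_Ltilde_factored (by omega) a' (hneg hp)⟩
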